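/- Let $k$ be a field of characteristic zero (for instance $\mathbb R$ or $\mathbb C$), $V$ a finite-dimensional $k$-vector space, and $G$ a finite group acting linearly on $V$. Let $A=\mathrm{Poly}(V)$ be the algebra of polynomial functions, with $G$-action $(gf)(v)=f(g^{-1}v)$, and let $B=A\rtimes G$ be the crossed product, with elements $\sum_g a_gU_g$ and product $(aU_g)(bU_h)=a\,g(b)\,U_{gh}$. For $g\in G$ write $V=V^g\oplus N^g$, where $V^g$ is the fixed space of $g$ and $N^g=(1-g)V$ is the sum of the nontrivial irreducible subrepresentations of $\langle g\rangle$; put $l(g)=\dim N^g$. *The complexes.* $C^\bullet(B,B)$ is the Hochschild cochain complex, $C^k(B,B)=\mathrm{Hom}_k(B^{\otimes k},B)$, with $$(\partial\xi)(a_0,\dots,a_n)=a_0\xi(a_1,\dots,a_n)+\sum_{i=1}^n(-1)^i\xi(\dots,a_{i-1}a_i,\dots)+(-1)^{n+1}\xi(a_0,\dots,a_{n-1})a_n .$$ $\Gamma^\bullet=\Gamma\big(\bigoplus_{g\in G}\wedge^{\bullet-l(g)}TV^g\otimes\wedge^{l(g)}N^g\big)^G$, with zero differential: its degree-$k$ part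 consists of the families $\xi=(\xi_g)_{g\in G}$ with $\xi_g\in \mathrm{Poly}(V^g)\otimes\wedge^{k-l(g)}V^g\otimes\wedge^{l(g)}N^g$ (which is $0$ if $k<l(g)$) such that $\xi_{hgh^{-1}}$ is the push-forward $h_*\xi_g$ for all $g,h\in G$. $C^k(A,B)^G$ is the space of $k$-linear maps $\Psi:A^{\otimes k}\to B$ with $h\Psi=\Psi$ for all $h\in G$, where $(h\Psi)(a_1,\dots,a_k)=U_{h^{-1}}\Psi(ha_1,\dots,ha_k)U_h$. *The map $T$.* For each $g$ choose any linear coordinates $y^1,\dots,y^l$ ($l=l(g)$) on $N^g$ (for instance coordinates diagonalizing $g$, if they exist), seen as functions on $V=V^g\oplus N^g$; write points of $V$ as $(x,y)$ with $x\in V^g$, let $\tilde y^i=g(y^i)$, and for $\sigma\in S_l$ and $0\le j\le l$ let $z_\sigma^j$ be obtained from $(y^1,\dots,y^l)$ by replacing $y^{\sigma(1)},\dots,y^{\sigma(j)}$ by $\tilde y^{\sigma(1)},\dots,\tilde y^{\sigma(j)}$. The twisted cocycle is $$\Omega_g(f_1,\dots,f_l)(x,y)=\frac1{l!}\sum_{\sigma\in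 S_l}(-1)^\sigma\frac{\prod_{j=1}^l\big(f_j(x,z_\sigma^{j-1})-f_j(x,z_\sigma^j)\big)}{\prod_{i=1}^l(y^i-\tilde y^i)}\in A .$$ Let $\Lambda_g=\frac{\partial}{\partial y^1}\wedge\dots\wedge\frac{\partial}{\partial y^l}$. For $\xi_g=X\otimes\Lambda_g$ with $X$ a polynomial $p$-vector field on $V^g$, $p=k-l(g)$, put $T_1^g(\xi_g)(f_1,\dots,f_k)=X(f_1,\dots,f_p)\,\Omega_g(f_{p+1},\dots,f_k)$, where the coefficients of $X$ are extended constantly along $N^g$ and $X_1\wedge\dots\wedge X_p$ acts by $\frac1{p!}\sum_\sigma(-1)^\sigma X_{\sigma(1)}(f_1)\cdots X_{\sigma(p)}(f_p)$. Define $T_1:\Gamma^k\to C^k(A,B)^G$ by $T_1(\xi)=\frac1{|G|}\sum_{h\in G}h\Phi_\xi$, where $\Phi_\xi=\sum_gT_1^g(\xi_g)U_g$ (so $T_1(\xi)=\Phi_\xi$ whenever $\Phi_\xi$ is already invariant), define $T_2:C^k(A,B)^G\to C^k(B,B)$ by $$T_2(\Phi)(a_1U_{g_1},\dots,a_kU_{g_k})=\Phi\big(a_1,g_1(a_2),\dots,g_1\cdots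 g_{k-1}(a_k)\big)U_{g_1\cdots g_k},$$ and let $T=T_2\circ T_1$. *The map $L$.* Let $L=L_3\circ L_2\circ L_1$, where $L_1(\Psi)=\frac1{|G|}\sum_{h\in G}h(\Psi|_A)\in C^k(A,B)^G$; $L_2$ is given on the $g$-component $\Psi_g\in \mathrm{Hom}_k(A^{\otimes k},A)$ of $\Psi=\sum_g\Psi_gU_g$, in linear coordinates $x^1,\dots,x^n$ on $V$, by $$L_2^g(\Psi_g)(x)=\sum_{i_1,\dots,i_k}\frac1{k!}\sum_{\sigma\in S_k}(-1)^\sigma\,\Psi_g\big((x_{\sigma(1)}^{i_1}-x^{i_1})\cdots(x_{\sigma(k)}^{i_k}-x^{i_k})\big)(x)\,\frac{\partial}{\partial x^{i_1}}\wedge\dots\wedge\frac{\partial}{\partial x^{i_k}}$$ (the variable $x_j$ belongs to the $j$-th argument of $\Psi_g$, and the point $x$ is frozen while $\Psi_g$ is applied); and $L_3$ restricts the $g$-component to $V^g$ and projects it from $\wedge^kV$ to $\wedge^{k-l(g)}V^g\otimes\wedge^{l(g)}N^g$. **Theorem.** For all choices of coordinates, $T:\Gamma^\bullet\to C^\bullet(B,B)$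 and $L:C^\bullet(B,B)\to\Gamma^\bullet$ are well-defined morphisms of cochain complexes, $L\circ T=\mathrm{id}$, and $T$ is a quasi-isomorphism. -/

import Mathlib

open CategoryTheory
open scoped TensorProduct

noncomputable section

namespace TwistedHH

section Hochschild

variable (𝕜 : Type*) [CommRing 𝕜] (B : Type*) [Ring B] [Algebra 𝕜 B]

/-- `n`-cochains `Hom(B^{⊗ n}, M)`, as multilinear maps in `n` arguments. -/
abbrev Cochain (B M : Type*) [AddCommMonoid B] [Module 𝕜 B] [AddCommMonoid M] [Module 𝕜 M]
    (n : ℕ) : Type _ :=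
  MultilinearMap 𝕜 (fun _ : Fin n => B) M

variable {B}

theorem contractNth_update {n : ℕ} (i : Fin n) (a : Fin (n + 1) → B) (j : Fin (n + 1))
    [DecidableEq (Fin (n + 1))] :
    ∃ (k : Fin n) (φ : B →ₗ[𝕜] B), ∀ x : B,
      Fin.contractNth i.castSucc (· * ·) (Function.update a j x) =
        Function.update (Fin.contractNth i.castSucc (· * ·) a) k (φ x) := by
  have key : ∀ (k : Fin n) (φ : B → B),
      (∀ (x : B) (m : Fin n), Fin.contractNth i.castSucc (· * ·) (Function.update a j x) m =
        if m = k then φ x else Fin.contractNth i.castSucc (· * ·) a m) →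
      ∀ x : B, Fin.contractNth i.castSucc (· * ·) (Function.update a j x) =
        Function.update (Fin.contractNth i.castSucc (· * ·) a) k (φ x) := by
    intro k φ h x
    funext m
    rw [h, Function.update_apply]
  rcases lt_trichotomy (j : ℕ) (i : ℕ) with h | h | h
  · refine ⟨⟨j, by omega⟩, LinearMap.id, key _ _ ?_⟩
    intro x m
    simp only [Fin.contractNth, Function.update_apply, Fin.ext_iff, Fin.val_castSucc, Fin.val_succ,
      LinearMap.id_apply]
    split_ifs <;> first | rfl | omega
  · refine ⟨i, LinearMap.mulRight 𝕜 (a i.succ), key _ _ ?_⟩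
    intro x m
    simp only [Fin.contractNth, Function.update_apply, Fin.ext_iff, Fin.val_castSucc, Fin.val_succ,
      LinearMap.mulRight_apply]
    split_ifs with h1 h2 h3 h4 h5 h6 h7 <;> first | rfl | omega | skip
    all_goals (have : m = i := Fin.ext (by omega)); subst this; rfl
  · by_cases h' : (j : ℕ) = i + 1
    · refine ⟨i, LinearMap.mulLeft 𝕜 (a i.castSucc), key _ _ ?_⟩
      intro x m
      simp only [Fin.contractNth, Function.update_apply, Fin.ext_iff, Fin.val_castSucc,
        Fin.val_succ, LinearMap.mulLeft_apply]
      split_ifs with h1 h2 h3 h4 h5 h6 h7 <;> first | rfl | omega | skip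
      all_goals (have : m = i := Fin.ext (by omega)); subst this; rfl
    · refine ⟨⟨j - 1, by omega⟩, LinearMap.id, key _ _ ?_⟩
      intro x m
      simp only [Fin.contractNth, Function.update_apply, Fin.ext_iff, Fin.val_castSucc,
        Fin.val_succ, LinearMap.id_apply]
      split_ifs <;> first | rfl | omega

/-- `(a₀, …, aₙ) ↦ ξ (a₀, …, aᵢ aᵢ₊₁, …, aₙ)`. -/
def mulFace {n : ℕ} (i : Fin n) (ξ : Cochain 𝕜 B B n) : Cochain 𝕜 B B (n + 1) where
  toFun a := ξ (Fin.contractNth i.castSucc (· * ·) a)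
  map_update_add' a j x y := by
    obtain ⟨k, φ, h⟩ := contractNth_update 𝕜 i a j
    simp only [h, map_add, MultilinearMap.map_update_add]
  map_update_smul' a j c x := by
    obtain ⟨k, φ, h⟩ := contractNth_update 𝕜 i a j
    simp only [h, map_smul, MultilinearMap.map_update_smul]

/-- `(a₀, …, aₙ) ↦ a₀ ξ (a₁, …, aₙ)`. -/
def firstFace {n : ℕ} (ξ : Cochain 𝕜 B B n) : Cochain 𝕜 B B (n + 1) where
  toFun a := a 0 * ξ (Fin.tail a)
  map_update_add' := by
    intro inst a j x y
    obtain rfl := Subsingleton.elim inst (instDecidableEqFin _)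
    refine Fin.cases ?_ (fun j => ?_) j
    · simp [Fin.tail_update_zero, add_mul]
    · simp [Fin.tail_update_succ, mul_add, Function.update_of_ne (Fin.succ_ne_zero j).symm]
  map_update_smul' := by
    intro inst a j c x
    obtain rfl := Subsingleton.elim inst (instDecidableEqFin _)
    refine Fin.cases ?_ (fun j => ?_) j
    · simp [Fin.tail_update_zero]
    · simp [Fin.tail_update_succ, Function.update_of_ne (Fin.succ_ne_zero j).symm]

/-- `(a₀, …, aₙ) ↦ ξ (a₀, …, aₙ₋₁) aₙ`. -/
def lastFace {n : ℕ} (ξ : Cochain 𝕜 B B n) : Cochain 𝕜 B B (n + 1) where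
  toFun a := ξ (Fin.init a) * a (Fin.last n)
  map_update_add' := by
    intro inst a j x y
    obtain rfl := Subsingleton.elim inst (instDecidableEqFin _)
    refine Fin.lastCases ?_ (fun j => ?_) j
    · simp [Fin.init_update_last, mul_add]
    · simp [Fin.init_update_castSucc, add_mul, Function.update_of_ne (Fin.castSucc_ne_last j).symm]
  map_update_smul' := by
    intro inst a j c x
    obtain rfl := Subsingleton.elim inst (instDecidableEqFin _)
    refine Fin.lastCases ?_ (fun j => ?_) j
    · simp [Fin.init_update_last]
    · simp [Fin.init_update_castSucc,
        Function.update_of_ne (Fin.castSucc_ne_last j).symm]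

/-- The Hochschild differential
`(∂ξ)(a₀, …, aₙ) = a₀ ξ(a₁, …, aₙ) + ∑_{i=1}^{n} (-1)^i ξ(…, aᵢ₋₁ aᵢ, …)
  + (-1)^{n+1} ξ(a₀, …, aₙ₋₁) aₙ`. -/
def hochschildD (n : ℕ) : Cochain 𝕜 B B n →ₗ[𝕜] Cochain 𝕜 B B (n + 1) where
  toFun ξ := firstFace 𝕜 ξ + ∑ i : Fin n, (-1 : 𝕜) ^ ((i : ℕ) + 1) • mulFace 𝕜 i ξ +
    (-1 : 𝕜) ^ (n + 1) • lastFace 𝕜 ξ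
  map_add' ξ η := by
    ext a
    simp only [firstFace, mulFace, lastFace, _root_.add_apply, _root_.smul_apply,
      MultilinearMap.coe_mk, _root_.sum_apply, mul_add, add_mul, smul_add,
      Finset.sum_add_distrib]
    abel
  map_smul' c ξ := by
    ext a
    simp only [firstFace, mulFace, lastFace, _root_.add_apply, _root_.smul_apply,
      MultilinearMap.coe_mk, _root_.sum_apply, mul_smul_comm, smul_mul_assoc, smul_add,
      Finset.smul_sum, RingHom.id_apply, smul_comm c]

theorem hochschildD_apply {n : ℕ} (ξ : Cochain 𝕜 B B n) (a : Fin (n + 1) → B) :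
    hochschildD 𝕜 n ξ a = a 0 * ξ (Fin.tail a) +
      ∑ i : Fin n, (-1 : 𝕜) ^ ((i : ℕ) + 1) • ξ (Fin.contractNth i.castSucc (· * ·) a) +
      (-1 : 𝕜) ^ (n + 1) • (ξ (Fin.init a) * a (Fin.last n)) := by
  simp [hochschildD, firstFace, mulFace, lastFace]

/-- `(b, a₁, …, aₙ, c) ↦ b ξ(a₁, …, aₙ) c`. -/
def barExt {n : ℕ} (ξ : Cochain 𝕜 B B n) (t : Fin (n + 2) → B) : B :=
  t 0 * ξ (fun i => t i.castSucc.succ) * t (Fin.last (n + 1))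

theorem barExt_hochschildD {n : ℕ} (ξ : Cochain 𝕜 B B n) (t : Fin (n + 3) → B) :
    barExt 𝕜 (hochschildD 𝕜 n ξ) t =
      ∑ i : Fin (n + 2), (-1 : 𝕜) ^ (i : ℕ) • barExt 𝕜 ξ
        (Fin.contractNth i.castSucc (· * ·) t) := by
  rw [Fin.sum_univ_succ, Fin.sum_univ_castSucc]
  simp only [barExt, hochschildD_apply, mul_add, add_mul, Finset.mul_sum, Finset.sum_mul,
    mul_smul_comm, smul_mul_assoc, ← add_assoc]
  congr 1
  · congr 1
    · simp only [Fin.val_zero, pow_zero, one_smul, ← mul_assoc]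
      congr 1
    · refine Finset.sum_congr rfl fun i _ => ?_
      simp only [Fin.val_succ, Fin.val_castSucc]
      congr 1
      congr 1
      · congr 1
        congr 1
        funext m
        simp only [Fin.contractNth, Fin.val_succ, Fin.val_castSucc, add_lt_add_iff_right,
          add_left_inj]
        rfl
      · simp only [Fin.contractNth, Fin.val_succ, Fin.val_castSucc, Fin.val_last]
        have h1 : ¬ (n + 1 < (i : ℕ) + 1) := by omega
        have h2 : ¬ (n + 1 = (i : ℕ) + 1) := by omega
        simp only [h1, h2, if_false]
        rfl
  · simp only [Fin.val_succ, Fin.val_last, mul_assoc]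
    congr 1
    congr 1
    congr 1
    · congr 1
      funext m
      simp only [Fin.contractNth, Fin.val_succ, Fin.val_castSucc, Fin.val_last]
      have h1 : (m : ℕ) + 1 < n + 1 := by omega
      simp only [h1, if_true]
      rfl
    · simp only [Fin.contractNth, Fin.val_succ, Fin.val_castSucc, Fin.val_last, lt_irrefl, if_false,
        if_true]
      rfl

theorem contractNth_contractNth {n : ℕ} (t : Fin (n + 2) → B) (i j : Fin n) (h : i ≤ j) :
    Fin.contractNth i.castSucc (· * ·) (Fin.contractNth j.succ.castSucc (· * ·) t) =
      Fin.contractNth j.castSucc (· * ·) (Fin.contractNth i.castSucc.castSucc (· * ·) t) := by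
  have h' : (i : ℕ) ≤ j := h
  funext m
  simp only [Fin.contractNth, Fin.val_succ, Fin.val_castSucc]
  split_ifs <;> first | rfl | omega | (simp only [mul_assoc]; rfl)

theorem hochschildD_hochschildD {n : ℕ} (ξ : Cochain 𝕜 B B n) :
    hochschildD 𝕜 (n + 1) (hochschildD 𝕜 n ξ) = 0 := by
  have key : ∀ t : Fin (n + 4) → B,
      barExt 𝕜 (hochschildD 𝕜 (n + 1) (hochschildD 𝕜 n ξ)) t = 0 := by
    intro t
    simp only [barExt_hochschildD, Finset.smul_sum, smul_smul, ← pow_add]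
    rw [← Finset.sum_product', Finset.univ_product_univ]
    let P := Fin (n + 3) × Fin (n + 2)
    let S : Finset P := {p : P | (p.2 : ℕ) < (p.1 : ℕ)}
    rw [← Finset.sum_add_sum_compl S, ← eq_neg_iff_add_eq_zero, ← Finset.sum_neg_distrib]
    refine Finset.sum_bij'
      (fun p hp => (p.2.castSucc, p.1.pred (by
        have : (p.2 : ℕ) < (p.1 : ℕ) := by simpa [S] using hp
        intro h0; rw [h0] at this; simp at this)))
      (fun p hp => (p.2.succ, p.1.castLT (by
        have : (p.1 : ℕ) ≤ (p.2 : ℕ) := by simpa [S] using hp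
        omega))) ?_ ?_ ?_ ?_ ?_
    · intro p hp
      have : (p.2 : ℕ) < (p.1 : ℕ) := by simpa [S] using hp
      simp [S]
      omega
    · intro p hp
      have : (p.1 : ℕ) ≤ (p.2 : ℕ) := by simpa [S] using hp
      simp [S]
      omega
    · intro p hp
      simp
    · intro p hp
      simp
    · rintro ⟨j, i⟩ hp
      have hij : (i : ℕ) < (j : ℕ) := by simpa [S] using hp
      obtain ⟨j, rfl⟩ := Fin.exists_succ_eq.2 (show j ≠ 0 by rintro rfl; simp at hij)
      have hij' : i ≤ j := by
        rw [Fin.le_def]; rw [Fin.val_succ] at hij; omega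
      simp only [Fin.pred_succ, Fin.val_succ, Fin.val_castSucc]
      rw [contractNth_contractNth t i j hij', ← neg_smul]
      congr 1
      ring
  ext a
  have h := key (Fin.cons 1 (Fin.snoc (α := fun _ => B) a 1))
  have h1 : (Fin.cons 1 (Fin.snoc (α := fun _ => B) a 1) : Fin (n + 4) → B)
      (Fin.last (n + 2 + 1)) = 1 := by
    rw [← Fin.succ_last, Fin.cons_succ, Fin.snoc_last]
  simpa [barExt, h1] using h

end Hochschild

section Complex
universe u v
variable (𝕜 : Type u) [CommRing 𝕜] (B : Type v) [Ring B] [Algebra 𝕜 B]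

/-- The Hochschild cochain complex `C^•(B, B)`. -/
def hochschildComplex : CochainComplex (ModuleCat.{v} 𝕜) ℕ :=
  CochainComplex.of (fun n => ModuleCat.of 𝕜 (Cochain 𝕜 B B n))
    (fun n => ModuleCat.ofHom (hochschildD 𝕜 n)) (fun n => by
      ext1
      exact LinearMap.ext fun ξ => hochschildD_hochschildD 𝕜 ξ)
end Complex
section Polynomials

variable (𝕜 : Type*) [Field 𝕜] (W : Type*) [AddCommGroup W] [Module 𝕜 W]

/-- The algebra of polynomial functions on `W`, realised as `Sym(W^*)`. -/
def Poly : Type _ := SymmetricAlgebra 𝕜 (Module.Dual 𝕜 W)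

instance : CommRing (Poly 𝕜 W) :=
  inferInstanceAs (CommRing (SymmetricAlgebra 𝕜 (Module.Dual 𝕜 W)))

instance : Algebra 𝕜 (Poly 𝕜 W) :=
  inferInstanceAs (Algebra 𝕜 (SymmetricAlgebra 𝕜 (Module.Dual 𝕜 W)))

instance : IsDomain (Poly 𝕜 W) :=
  inferInstanceAs (IsDomain (SymmetricAlgebra 𝕜 (Module.Dual 𝕜 W)))

namespace Poly

variable {W}

/-- A linear functional, seen as a polynomial function. -/
def lin : Module.Dual 𝕜 W →ₗ[𝕜] Poly 𝕜 W := SymmetricAlgebra.ι 𝕜 (Module.Dual 𝕜 W)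

variable {𝕜}

/-- The algebra homomorphism out of `Poly 𝕜 W` with prescribed values on linear functionals. -/
def lift {R : Type*} [CommRing R] [Algebra 𝕜 R] (φ : Module.Dual 𝕜 W →ₗ[𝕜] R) :
    Poly 𝕜 W →ₐ[𝕜] R :=
  SymmetricAlgebra.lift φ

@[simp] theorem lift_lin {R : Type*} [CommRing R] [Algebra 𝕜 R] (φ : Module.Dual 𝕜 W →ₗ[𝕜] R)
    (ℓ : Module.Dual 𝕜 W) : lift φ (lin 𝕜 ℓ) = φ ℓ :=
  SymmetricAlgebra.lift_ι_apply (f := φ) ℓ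

theorem algHom_ext {R : Type*} [CommRing R] [Algebra 𝕜 R] {F F' : Poly 𝕜 W →ₐ[𝕜] R}
    (h : ∀ ℓ, F (lin 𝕜 ℓ) = F' (lin 𝕜 ℓ)) : F = F' :=
  SymmetricAlgebra.algHom_ext (LinearMap.ext h)

theorem induction {P : Poly 𝕜 W → Prop} (hC : ∀ r, P (algebraMap 𝕜 _ r))
    (hl : ∀ ℓ, P (lin 𝕜 ℓ)) (hm : ∀ a b, P a → P b → P (a * b))
    (ha : ∀ a b, P a → P b → P (a + b)) (f : Poly 𝕜 W) : P f :=
  SymmetricAlgebra.induction 𝕜 (Module.Dual 𝕜 W) (motive := P) hC hl hm ha f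

theorem lin_injective : Function.Injective (lin 𝕜 : Module.Dual 𝕜 W →ₗ[𝕜] Poly 𝕜 W) := by
  intro ℓ ℓ' h
  let F : Poly 𝕜 W →ₐ[𝕜] TrivSqZeroExt 𝕜 (Module.Dual 𝕜 W) :=
    lift (TrivSqZeroExt.inrHom 𝕜 (Module.Dual 𝕜 W))
  have := congrArg (fun f => (F f).snd) h
  simpa [F] using this

/-- The value `f(w)`. -/
def eval (w : W) : Poly 𝕜 W →ₐ[𝕜] 𝕜 := lift (Module.Dual.eval 𝕜 W w)

/-- The pull back `f ↦ f ∘ φ` along a linear map `φ`. -/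
def comap {W' : Type*} [AddCommGroup W'] [Module 𝕜 W'] (φ : W →ₗ[𝕜] W') :
    Poly 𝕜 W' →ₐ[𝕜] Poly 𝕜 W :=
  lift (lin 𝕜 ∘ₗ φ.dualMap)

@[simp] theorem comap_lin {W' : Type*} [AddCommGroup W'] [Module 𝕜 W'] (φ : W →ₗ[𝕜] W')
    (ℓ : Module.Dual 𝕜 W') : comap φ (lin 𝕜 ℓ) = lin 𝕜 (ℓ ∘ₗ φ) := lift_lin _ _

theorem eval_comap {W' : Type*} [AddCommGroup W'] [Module 𝕜 W'] (φ : W →ₗ[𝕜] W')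
    (f : Poly 𝕜 W') (w : W) : eval w (comap φ f) = eval (φ w) f := by
  have : (eval w).comp (comap φ) = eval (φ w) := algHom_ext fun ℓ => by simp [eval]
  exact DFunLike.congr_fun this f

/-- `f(x) ↦ f(x + ε v)`, with `ε² = 0`. -/
def taylor (v : W) : Poly 𝕜 W →ₐ[𝕜] DualNumber (Poly 𝕜 W) :=
  lift ((TrivSqZeroExt.inlAlgHom 𝕜 (Poly 𝕜 W) (Poly 𝕜 W)).toLinearMap ∘ₗ lin 𝕜 +
    ((TrivSqZeroExt.inrHom (Poly 𝕜 W) (Poly 𝕜 W)).restrictScalars 𝕜) ∘ₗ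
      Algebra.linearMap 𝕜 (Poly 𝕜 W) ∘ₗ Module.Dual.eval 𝕜 W v)

theorem fst_taylor (v : W) (f : Poly 𝕜 W) : (taylor v f).fst = f := by
  have : (TrivSqZeroExt.fstHom 𝕜 (Poly 𝕜 W) (Poly 𝕜 W)).comp (taylor v) = AlgHom.id 𝕜 _ :=
    algHom_ext fun ℓ => by simp [taylor]
  exact DFunLike.congr_fun this f

theorem snd_algebraMap (r : 𝕜) :
    (algebraMap 𝕜 (DualNumber (Poly 𝕜 W)) r).snd = 0 := rfl

theorem snd_taylor_lin (v : W) (ℓ : Module.Dual 𝕜 W) :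
    (taylor v (lin 𝕜 ℓ)).snd = algebraMap 𝕜 _ (ℓ v) := by
  simp [taylor, Algebra.algebraMap_eq_smul_one]

/-- The directional derivative `∂_v f`, that is, the coefficient of `ε` in `f(x + ε v)`;
it is linear in `v` and `f`. -/
def deriv : W →ₗ[𝕜] Poly 𝕜 W →ₗ[𝕜] Poly 𝕜 W where
  toFun v := ((TrivSqZeroExt.sndHom (Poly 𝕜 W) (Poly 𝕜 W)).restrictScalars 𝕜) ∘ₗ
    (taylor v).toLinearMap
  map_add' v v' := by
    ext f
    simp only [LinearMap.comp_apply, LinearMap.add_apply, AlgHom.toLinearMap_apply]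
    induction f using induction with
    | hC r => simp [snd_algebraMap]
    | hl ℓ => simp [snd_taylor_lin]
    | hm a b ha hb => 
      simp only [LinearMap.restrictScalars_apply, TrivSqZeroExt.sndHom_apply] at ha hb ⊢
      simp only [map_mul, TrivSqZeroExt.snd_mul, fst_taylor, ha, hb, smul_eq_mul, MulOpposite.smul_eq_mul_unop, MulOpposite.unop_op]
      ring
    | ha a b ha hb =>
      simp only [map_add, ha, hb]
      abel
  map_smul' c v := by
    ext f
    simp only [LinearMap.comp_apply, LinearMap.smul_apply, AlgHom.toLinearMap_apply, RingHom.id_apply]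
    induction f using induction with
    | hC r => simp [snd_algebraMap]
    | hl ℓ => simp [snd_taylor_lin, Algebra.smul_def]
    | hm a b ha hb => 
      simp only [LinearMap.restrictScalars_apply, TrivSqZeroExt.sndHom_apply] at ha hb ⊢
      simp only [map_mul, TrivSqZeroExt.snd_mul, fst_taylor, ha, hb, smul_eq_mul, MulOpposite.smul_eq_mul_unop, MulOpposite.unop_op, Algebra.smul_def]
      ring
    | ha a b ha hb =>
      simp only [map_add, ha, hb, smul_add]

theorem deriv_lin (v : W) (ℓ : Module.Dual 𝕜 W) :
    deriv v (lin 𝕜 ℓ) = algebraMap 𝕜 _ (ℓ v) :=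
  snd_taylor_lin v ℓ

theorem deriv_mul (v : W) (a b : Poly 𝕜 W) :
    deriv v (a * b) = a * deriv v b + deriv v a * b := by
  simp only [deriv, LinearMap.coe_mk, AddHom.coe_mk, LinearMap.comp_apply,
    AlgHom.toLinearMap_apply, LinearMap.restrictScalars_apply, TrivSqZeroExt.sndHom_apply, map_mul,
    TrivSqZeroExt.snd_mul, fst_taylor, smul_eq_mul, MulOpposite.smul_eq_mul_unop,
    MulOpposite.unop_op]

end Poly

end Polynomials

section Action

variable (𝕜 : Type*) [Field 𝕜] {V : Type*} [AddCommGroup V] [Module 𝕜 V]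
  {G : Type*} [Group G] [DistribMulAction G V] [SMulCommClass G 𝕜 V]

/-- The linear map `v ↦ g v`. -/
abbrev act (g : G) : V →ₗ[𝕜] V := DistribSMul.toLinearMap 𝕜 V g

/-- `G` acts on `Poly(V)` by `(g f)(v) = f(g⁻¹ v)`. -/
instance : MulSemiringAction G (Poly 𝕜 V) where
  smul g f := Poly.comap (act 𝕜 g⁻¹) f
  one_smul f := by
    change Poly.comap (act 𝕜 (1 : G)⁻¹) f = AlgHom.id 𝕜 _ f
    congr 1
    refine Poly.algHom_ext fun ℓ => ?_
    rw [Poly.comap_lin]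
    change _ = Poly.lin 𝕜 ℓ
    congr 1
    ext v
    simp
  mul_smul g h f := by
    change Poly.comap (act 𝕜 (g * h)⁻¹) f =
      ((Poly.comap (act 𝕜 g⁻¹)).comp (Poly.comap (act 𝕜 h⁻¹))) f
    congr 1
    refine Poly.algHom_ext fun ℓ => ?_
    simp only [AlgHom.comp_apply, Poly.comap_lin]
    congr 1
    ext v
    simp [mul_smul]
  smul_zero g := map_zero _
  smul_add g := map_add _
  smul_one g := map_one _
  smul_mul g := map_mul _

theorem smul_poly_def (g : G) (f : Poly 𝕜 V) : g • f = Poly.comap (act 𝕜 g⁻¹) f := rfl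

instance : SMulCommClass G 𝕜 (Poly 𝕜 V) where
  smul_comm g c f := map_smul (Poly.comap (act 𝕜 g⁻¹)) c f

instance : SMulCommClass 𝕜 G (Poly 𝕜 V) := SMulCommClass.symm _ _ _

theorem eval_smul_poly (g : G) (f : Poly 𝕜 V) (v : V) :
    Poly.eval v (g • f) = Poly.eval (g⁻¹ • v) f := by
  rw [smul_poly_def, Poly.eval_comap]
  rfl

variable (V)

/-- The fixed subspace `V^g`. -/
def fixedSpace (g : G) : Submodule 𝕜 V := LinearMap.ker (LinearMap.id - act 𝕜 g)

/-- The normal space `N^g = (1 - g) V`, the sum of the nontrivial irreducible subrepresentations of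
the cyclic group generated by `g`; it is the unique `g`-stable complement of `V^g`. -/
def normalSpace (g : G) : Submodule 𝕜 V := LinearMap.range (LinearMap.id - act 𝕜 g)

variable [CharZero 𝕜] [Finite G]

theorem isCompl_fixed_normal (g : G) : IsCompl (fixedSpace 𝕜 V g) (normalSpace 𝕜 V g) := by
  set n := orderOf g with hn
  have hpos : 0 < n := orderOf_pos g
  have hne : (n : 𝕜) ≠ 0 := by exact_mod_cast hpos.ne'
  have hsum : ∀ v : V, ∑ i ∈ Finset.range n, g ^ i • (v - g • v) = 0 := by
    intro v
    have : ∀ i, g ^ i • (v - g • v) = g ^ i • v - g ^ (i + 1) • v := by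
      intro i; rw [smul_sub, pow_succ, mul_smul]
    simp only [this]
    rw [Finset.sum_range_sub', hn, pow_orderOf_eq_one]
    simp
  constructor
  · rw [Submodule.disjoint_def]
    rintro _ hv ⟨w, rfl⟩
    have hv' : g • (w - g • w) = w - g • w := by
      have := hv
      simp only [fixedSpace, LinearMap.mem_ker, LinearMap.sub_apply, LinearMap.id_apply, sub_eq_zero] at this
      exact this.symm
    have hp : ∀ i : ℕ, g ^ i • (w - g • w) = w - g • w := by
      intro i
      induction i with
      | zero => simp
      | succ i ih => rw [pow_succ, mul_smul, hv', ih]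
    have h := hsum w
    simp only [hp, Finset.sum_const, Finset.card_range] at h
    rw [← Nat.cast_smul_eq_nsmul 𝕜] at h
    simpa [hne] using h
  · rw [codisjoint_iff, eq_top_iff]
    intro v _
    have hdiff : ∀ i : ℕ, v - g ^ i • v ∈ normalSpace 𝕜 V g := by
      intro i
      induction i with
      | zero => simp
      | succ i ih =>
        have : v - g ^ (i + 1) • v = (v - g ^ i • v) + (g ^ i • v - g • (g ^ i • v)) := by
          rw [pow_succ', mul_smul]; abel
        rw [this]
        exact Submodule.add_mem _ ih ⟨g ^ i • v, rfl⟩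
    have hfix : (∑ i ∈ Finset.range n, g ^ i • v) ∈ fixedSpace 𝕜 V g := by
      change (∑ i ∈ Finset.range n, g ^ i • v) - g • (∑ i ∈ Finset.range n, g ^ i • v) = 0
      rw [Finset.smul_sum, ← Finset.sum_sub_distrib]
      rw [← hsum v]
      refine Finset.sum_congr rfl fun i _ => ?_
      rw [smul_sub, smul_smul, smul_smul, ← pow_succ', ← pow_succ]
    have hdec : (n : 𝕜) • v = (∑ i ∈ Finset.range n, g ^ i • v) +
        ∑ i ∈ Finset.range n, (v - g ^ i • v) := by
      rw [← Finset.sum_add_distrib, Nat.cast_smul_eq_nsmul]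
      simp
    have : v = (n : 𝕜)⁻¹ • ((∑ i ∈ Finset.range n, g ^ i • v) +
        ∑ i ∈ Finset.range n, (v - g ^ i • v)) := by
      rw [← hdec, smul_smul, inv_mul_cancel₀ hne, one_smul]
    rw [this]
    exact Submodule.smul_mem _ _ (Submodule.add_mem_sup hfix
      (Submodule.sum_mem _ fun i _ => hdiff i))

/-- The projection `V = V^g ⊕ N^g → V^g`. -/
def projFixed (g : G) : V →ₗ[𝕜] fixedSpace 𝕜 V g :=
  Submodule.projectionOnto _ _ (isCompl_fixed_normal 𝕜 V g)

/-- The projection `V = V^g ⊕ N^g → N^g`. -/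
def projNormal (g : G) : V →ₗ[𝕜] normalSpace 𝕜 V g :=
  Submodule.projectionOnto _ _ (isCompl_fixed_normal 𝕜 V g).symm

end Action

section TwistedCocycle

variable {𝕜 : Type*} [Field 𝕜] [CharZero 𝕜] {V : Type*} [AddCommGroup V] [Module 𝕜 V]
  {G : Type*} [Group G] [Finite G] [DistribMulAction G V] [SMulCommClass G 𝕜 V]

variable (𝕜 V) in
/-- The codimension `l(g) = dim N^g`. -/
def codim (g : G) : ℕ := Module.finrank 𝕜 (normalSpace 𝕜 V g)

/- In this section `e` is a basis `∂/∂y^1, …, ∂/∂y^{l(g)}` of `N^g`, that is, a choice of linear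
coordinates `y^1, …, y^{l(g)}` on `N^g`. -/
variable {g : G} (e : Module.Basis (Fin (codim 𝕜 V g)) 𝕜 (normalSpace 𝕜 V g))

/-- The coordinate function `y^i` on `V = V^g ⊕ N^g`. -/
def yCoord (i : Fin (codim 𝕜 V g)) : Module.Dual 𝕜 V := e.coord i ∘ₗ projNormal 𝕜 V g

/-- The function `ỹ^i = g(y^i)`. -/
def yTilde (i : Fin (codim 𝕜 V g)) : Module.Dual 𝕜 V := yCoord e i ∘ₗ act 𝕜 g⁻¹

/-- The map sending the point with coordinates `(x, y)` to the point `(x, z)`, where `z^i = ỹ^i`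
for `i ∈ S` and `z^i = y^i` for `i ∉ S`. -/
def zMap (S : Finset (Fin (codim 𝕜 V g))) : V →ₗ[𝕜] V :=
  (fixedSpace 𝕜 V g).subtype ∘ₗ projFixed 𝕜 V g +
    ∑ i, (if i ∈ S then yTilde e i else yCoord e i).smulRight (e i : V)

/-- The map `(x, y) ↦ (x, z_σ^j)`: the coordinates `y^{σ(1)}, …, y^{σ(j)}` are replaced by
`ỹ^{σ(1)}, …, ỹ^{σ(j)}`. -/
def zPoint (σ : Equiv.Perm (Fin (codim 𝕜 V g))) (j : ℕ) : V →ₗ[𝕜] V :=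
  zMap e {i | (σ.symm i : ℕ) < j}

theorem dvd_sub_of_dvd_lin {R : Type*} [CommRing R] [Algebra 𝕜 R] (F F' : Poly 𝕜 V →ₐ[𝕜] R)
    (d : R) (h : ∀ ℓ, d ∣ F (Poly.lin 𝕜 ℓ) - F' (Poly.lin 𝕜 ℓ)) (f : Poly 𝕜 V) :
    d ∣ F f - F' f := by
  induction f using Poly.induction with
  | hC r => simp
  | hl ℓ => exact h ℓ
  | hm a b ha hb =>
    have : F (a * b) - F' (a * b) = F a * (F b - F' b) + (F a - F' a) * F' b := by
      simp only [map_mul]; ring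
    rw [this]
    exact dvd_add (hb.mul_left _) (ha.mul_right _)
  | ha a b ha hb =>
    have : F (a + b) - F' (a + b) = (F a - F' a) + (F b - F' b) := by
      simp only [map_add]; ring
    rw [this]
    exact dvd_add ha hb

theorem zMap_sub (S S' : Finset (Fin (codim 𝕜 V g))) (i : Fin (codim 𝕜 V g)) (hi : i ∉ S)
    (hS : ∀ m, m ∈ S' ↔ m ∈ S ∨ m = i) (v : V) :
    zMap e S v - zMap e S' v = (yCoord e i - yTilde e i) v • (e i : V) := by
  simp only [zMap, LinearMap.add_apply, LinearMap.sum_apply, LinearMap.smulRight_apply,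
    add_sub_add_left_eq_sub, ← Finset.sum_sub_distrib]
  rw [Finset.sum_eq_single i]
  · simp [hi, hS, sub_smul]
  · intro m _ hm
    by_cases h : m ∈ S <;> simp [h, hS, hm]
  · simp

theorem zPoint_sub (σ : Equiv.Perm (Fin (codim 𝕜 V g))) (j : Fin (codim 𝕜 V g)) (v : V) :
    zPoint e σ j v - zPoint e σ (j + 1) v =
      (yCoord e (σ j) - yTilde e (σ j)) v • (e (σ j) : V) := by
  refine zMap_sub e _ _ (σ j) (by simp) (fun m => ?_) v
  simp only [Finset.mem_filter_univ, ← Equiv.symm_apply_eq, Fin.ext_iff]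
  omega

theorem exists_divDiff (σ : Equiv.Perm (Fin (codim 𝕜 V g))) (j : Fin (codim 𝕜 V g))
    (f : Poly 𝕜 V) :
    ∃ q : Poly 𝕜 V, Poly.comap (zPoint e σ j) f - Poly.comap (zPoint e σ (j + 1)) f =
      Poly.lin 𝕜 (yCoord e (σ j) - yTilde e (σ j)) * q := by
  refine dvd_sub_of_dvd_lin _ _ _ (fun ℓ => ?_) f
  refine ⟨algebraMap 𝕜 _ (ℓ (e (σ j) : V)), ?_⟩
  rw [Poly.comap_lin, Poly.comap_lin, ← map_sub, mul_comm, ← Algebra.smul_def, ← map_smul]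
  congr 1
  ext v
  simp only [LinearMap.sub_apply, LinearMap.comp_apply, LinearMap.smul_apply, ← map_sub,
    zPoint_sub]
  simp [mul_comm]

theorem yCoord_sub_yTilde_ne_zero (i : Fin (codim 𝕜 V g)) : yCoord e i - yTilde e i ≠ 0 := by
  intro h
  obtain ⟨w, hw⟩ := (e i).2
  have hw' : w - g • w = (e i : V) := hw
  have h1 : yCoord e i (e i : V) = 1 := by
    simp [yCoord, projNormal]
  have h2 := LinearMap.congr_fun h (g • w)
  simp only [LinearMap.sub_apply, yTilde, LinearMap.comp_apply, DistribSMul.toLinearMap_apply,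
    inv_smul_smul, LinearMap.zero_apply, ← map_sub] at h2
  rw [← hw', ← neg_sub, map_neg, h2] at h1
  simp at h1

theorem lin_ne_zero (i : Fin (codim 𝕜 V g)) : Poly.lin 𝕜 (yCoord e i - yTilde e i) ≠ 0 := by
  intro h
  exact yCoord_sub_yTilde_ne_zero e i (Poly.lin_injective (by simpa using h))

/-- The quotient `(f(x, z_σ^{j-1}) - f(x, z_σ^j)) / (y^{σ(j)} - ỹ^{σ(j)})` (with `j` counted
from `0` in the code), a polynomial function which is linear in `f`. -/
def divDiff (σ : Equiv.Perm (Fin (codim 𝕜 V g))) (j : Fin (codim 𝕜 V g)) :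
    Poly 𝕜 V →ₗ[𝕜] Poly 𝕜 V where
  toFun f := (exists_divDiff e σ j f).choose
  map_add' f f' := by
    apply mul_left_cancel₀ (lin_ne_zero e (σ j))
    rw [mul_add, ← (exists_divDiff e σ j _).choose_spec, ← (exists_divDiff e σ j f).choose_spec,
      ← (exists_divDiff e σ j f').choose_spec, map_add, map_add]
    ring
  map_smul' c f := by
    apply mul_left_cancel₀ (lin_ne_zero e (σ j))
    rw [RingHom.id_apply, mul_smul_comm, ← (exists_divDiff e σ j _).choose_spec,
      ← (exists_divDiff e σ j f).choose_spec, map_smul, map_smul, smul_sub]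

theorem lin_mul_divDiff (σ : Equiv.Perm (Fin (codim 𝕜 V g))) (j : Fin (codim 𝕜 V g))
    (f : Poly 𝕜 V) :
    Poly.lin 𝕜 (yCoord e (σ j) - yTilde e (σ j)) * divDiff e σ j f =
      Poly.comap (zPoint e σ j) f - Poly.comap (zPoint e σ (j + 1)) f :=
  (exists_divDiff e σ j f).choose_spec.symm

/-- The twisted cocycle
`Ω_g(f₁, …, f_l)(x, y) = (l!)⁻¹ ∑_σ (-1)^σ ∏_j (f_j(x, z_σ^{j-1}) - f_j(x, z_σ^j)) / ∏_i (y^i - ỹ^i)`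
with `l = l(g)`. The quotient of products is written as a product of quotients; the formula with
cleared denominator is `prod_mul_twistedCocycle`. -/
def twistedCocycle : Cochain 𝕜 (Poly 𝕜 V) (Poly 𝕜 V) (codim 𝕜 V g) :=
  ((codim 𝕜 V g).factorial : 𝕜)⁻¹ • ∑ σ : Equiv.Perm (Fin (codim 𝕜 V g)),
    (Equiv.Perm.sign σ : ℤ) • (MultilinearMap.mkPiAlgebra 𝕜 (Fin (codim 𝕜 V g))
      (Poly 𝕜 V)).compLinearMap (fun j => divDiff e σ j)

theorem prod_mul_twistedCocycle (f : Fin (codim 𝕜 V g) → Poly 𝕜 V) :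
    (∏ i, Poly.lin 𝕜 (yCoord e i - yTilde e i)) * twistedCocycle e f =
      ((codim 𝕜 V g).factorial : 𝕜)⁻¹ • ∑ σ : Equiv.Perm (Fin (codim 𝕜 V g)),
        (Equiv.Perm.sign σ : ℤ) • ∏ j : Fin (codim 𝕜 V g),
          (Poly.comap (zPoint e σ j) (f j) - Poly.comap (zPoint e σ (j + 1)) (f j)) := by
  simp only [twistedCocycle, _root_.smul_apply, _root_.sum_apply, mul_smul_comm,
    Finset.mul_sum]
  congr 1
  refine Finset.sum_congr rfl fun σ _ => ?_
  congr 1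
  rw [← Equiv.prod_comp σ]
  simp only [MultilinearMap.compLinearMap_apply, MultilinearMap.mkPiAlgebra_apply,
    ← Finset.prod_mul_distrib, lin_mul_divDiff]

end TwistedCocycle

section Sections

variable (𝕜 : Type*) [Field 𝕜] [CharZero 𝕜] (V : Type*) [AddCommGroup V] [Module 𝕜 V]
  {G : Type*} [Group G] [Finite G] [DistribMulAction G V] [SMulCommClass G 𝕜 V]

/-- The set of `p` with `p + l = k`: it is `{k - l}` if `l ≤ k`, and empty otherwise. -/
abbrev Deg (k l : ℕ) : Type := {p : Fin (k + 1) // (p : ℕ) + l = k}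

/-- For `p + l = k`, the first `p` and the last `l` of `k` slots. -/
def Deg.slots {k l : ℕ} (p : Deg k l) : Fin (p.1 : ℕ) ⊕ Fin l ≃ Fin k :=
  finSumFinEquiv.trans (finCongr p.2)

/-- `Γ(⋀^{k-l(g)} TV^g ⊗ ⋀^{l(g)} N^g)` (polynomial sections over `V^g`); it is `0` for
`k < l(g)`. -/
abbrev SectionsAt (g : G) (k : ℕ) : Type _ :=
  (p : Deg k (codim 𝕜 V g)) → Poly 𝕜 (fixedSpace 𝕜 V g) ⊗[𝕜]
    (⋀[𝕜]^(p.1 : ℕ) (fixedSpace 𝕜 V g) ⊗[𝕜] ⋀[𝕜]^(codim 𝕜 V g) (normalSpace 𝕜 V g))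

/-- Multiplication `⋀^p V^g ⊗ ⋀^l N^g → ⋀ V`, `u ⊗ w ↦ u ∧ w`. -/
def wedge (g : G) (p l : ℕ) :
    ⋀[𝕜]^p (fixedSpace 𝕜 V g) ⊗[𝕜] ⋀[𝕜]^l (normalSpace 𝕜 V g) →ₗ[𝕜] ExteriorAlgebra 𝕜 V :=
  LinearMap.mul' 𝕜 (ExteriorAlgebra 𝕜 V) ∘ₗ TensorProduct.map
    ((ExteriorAlgebra.map (fixedSpace 𝕜 V g).subtype).toLinearMap ∘ₗ Submodule.subtype _)
    ((ExteriorAlgebra.map (normalSpace 𝕜 V g).subtype).toLinearMap ∘ₗ Submodule.subtype _)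

/-- The inclusion of `Γ(⋀^{k-l(g)} TV^g ⊗ ⋀^{l(g)} N^g)` into the polynomial multivector fields
`Γ(⋀ TV) = Poly(V) ⊗ ⋀ V` on `V`, extending coefficients constantly along `N^g`. -/
def toMultivector (g : G) (k : ℕ) :
    SectionsAt 𝕜 V g k →ₗ[𝕜] Poly 𝕜 V ⊗[𝕜] ExteriorAlgebra 𝕜 V :=
  ∑ p, TensorProduct.map (Poly.comap (projFixed 𝕜 V g)).toLinearMap (wedge 𝕜 V g _ _) ∘ₗ
    LinearMap.proj p

/-- The push forward of polynomial multivector fields along `h`. -/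
def pushMultivector (h : G) :
    Poly 𝕜 V ⊗[𝕜] ExteriorAlgebra 𝕜 V →ₗ[𝕜] Poly 𝕜 V ⊗[𝕜] ExteriorAlgebra 𝕜 V :=
  TensorProduct.map (DistribSMul.toLinearMap 𝕜 (Poly 𝕜 V) h)
    (ExteriorAlgebra.map (act 𝕜 h)).toLinearMap

/-- The `G`-invariant elements of `⨁_g Γ(⋀^{k-l(g)} TV^g ⊗ ⋀^{l(g)} N^g)`: the component at
`h g h⁻¹` is the push forward along `h` of the component at `g`. -/
def invariantSections (G : Type*) [Group G] [Finite G] [DistribMulAction G V]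
    [SMulCommClass G 𝕜 V] (k : ℕ) : Submodule 𝕜 ((g : G) → SectionsAt 𝕜 V g k) where
  carrier := {ξ | ∀ h g : G, toMultivector 𝕜 V (h * g * h⁻¹) k (ξ (h * g * h⁻¹)) =
    pushMultivector 𝕜 V h (toMultivector 𝕜 V g k (ξ g))}
  zero_mem' h g := by simp
  add_mem' hξ hη h g := by simp [hξ h g, hη h g]
  smul_mem' c ξ hξ h g := by simp [hξ h g]

end Sections

section Maps

variable (𝕜 : Type*) [Field 𝕜] [CharZero 𝕜] (V : Type*) [AddCommGroup V] [Module 𝕜 V]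
  (G : Type*) [Group G] [Fintype G] [DistribMulAction G V] [SMulCommClass G 𝕜 V]

/-- The crossed product `Poly(V) ⋊ G`, with elements `∑ a_g U_g` and product
`(a U_g)(b U_h) = a g(b) U_{gh}`. -/
abbrev Crossed : Type _ := SkewMonoidAlgebra (Poly 𝕜 V) G

variable {G}

/-- The element `U_g` of the crossed product. -/
def U (g : G) : Crossed 𝕜 V G := SkewMonoidAlgebra.single g 1

/-- The coefficient map `∑ a_h U_h ↦ a_g`. -/
def coeffAt (g : G) : Crossed 𝕜 V G →ₗ[𝕜] Poly 𝕜 V where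
  toFun b := b.coeff g
  map_add' _ _ := by simp
  map_smul' _ _ := by simp

variable {𝕜 V}

/-- `(hΨ)(a₁, …, a_k) = U_{h⁻¹} Ψ(h a₁, …, h a_k) U_h`. -/
def conj (h : G) (k : ℕ) :
    Cochain 𝕜 (Poly 𝕜 V) (Crossed 𝕜 V G) k →ₗ[𝕜] Cochain 𝕜 (Poly 𝕜 V) (Crossed 𝕜 V G) k :=
  (LinearMap.mulLeft 𝕜 (U 𝕜 V h⁻¹) ∘ₗ LinearMap.mulRight 𝕜 (U 𝕜 V h)).compMultilinearMapₗ 𝕜 ∘ₗ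
    MultilinearMap.compLinearMapₗ (fun _ => DistribSMul.toLinearMap 𝕜 (Poly 𝕜 V) h)

theorem conj_apply (h : G) (k : ℕ) (Ψ : Cochain 𝕜 (Poly 𝕜 V) (Crossed 𝕜 V G) k)
    (a : Fin k → Poly 𝕜 V) :
    conj h k Ψ a = U 𝕜 V h⁻¹ * Ψ (fun j => h • a j) * U 𝕜 V h := by
  simp [conj, mul_assoc]

theorem U_mul_U (g h : G) : U 𝕜 V g * U 𝕜 V h = U 𝕜 V (g * h) := by
  simp [U, SkewMonoidAlgebra.single_mul_single]

theorem conj_conj (h h' : G) (k : ℕ) (Ψ : Cochain 𝕜 (Poly 𝕜 V) (Crossed 𝕜 V G) k) :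
    conj h' k (conj h k Ψ) = conj (h * h') k Ψ := by
  ext1 a
  simp only [conj_apply, smul_smul, mul_inv_rev, ← U_mul_U, mul_assoc]

variable (𝕜 V G) in
/-- The `G`-invariant cochains `C^k(Poly(V), Poly(V) ⋊ G)^G`. -/
def invariantCochains (k : ℕ) : Submodule 𝕜 (Cochain 𝕜 (Poly 𝕜 V) (Crossed 𝕜 V G) k) where
  carrier := {Ψ | ∀ h : G, conj h k Ψ = Ψ}
  zero_mem' h := by simp
  add_mem' hξ hη h := by simp [hξ h, hη h]
  smul_mem' c ξ hξ h := by simp [hξ h]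

/-- The average `Ψ ↦ |G|⁻¹ ∑_h hΨ`. -/
def average (k : ℕ) : Cochain 𝕜 (Poly 𝕜 V) (Crossed 𝕜 V G) k →ₗ[𝕜] invariantCochains 𝕜 V G k :=
  LinearMap.codRestrict _ ((Fintype.card G : 𝕜)⁻¹ • ∑ h : G, conj h k) (by
    intro Ψ h
    simp only [LinearMap.smul_apply, LinearMap.sum_apply, map_smul, map_sum, conj_conj]
    congr 1
    exact Equiv.sum_comp (Equiv.mulRight h) (fun h' => conj h' k Ψ))

/-- On an invariant cochain, averaging changes nothing. -/
theorem average_of_mem {k : ℕ} {Ψ : Cochain 𝕜 (Poly 𝕜 V) (Crossed 𝕜 V G) k}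
    (h : Ψ ∈ invariantCochains 𝕜 V G k) : (average k Ψ : Cochain 𝕜 _ _ k) = Ψ := by
  have h' : ∀ g : G, conj g k Ψ = Ψ := h
  have : (Fintype.card G : 𝕜) ≠ 0 := by simp
  change ((Fintype.card G : 𝕜)⁻¹ • ∑ g : G, conj g k) Ψ = Ψ
  simp only [LinearMap.smul_apply, LinearMap.sum_apply, h', Finset.sum_const, Finset.card_univ]
  rw [← Nat.cast_smul_eq_nsmul 𝕜, smul_smul, inv_mul_cancel₀ this, one_smul]

/-- An element `u₁ ∧ ⋯ ∧ u_p` of `⋀^p V^g` as a multidifferential operator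
`(f₁, …, f_p) ↦ (p!)⁻¹ ∑_σ (-1)^σ ∂_{u_{σ(1)}} f₁ ⋯ ∂_{u_{σ(p)}} f_p`. -/
def multivectorOp (g : G) (p : ℕ) :
    ⋀[𝕜]^p (fixedSpace 𝕜 V g) →ₗ[𝕜] Cochain 𝕜 (Poly 𝕜 V) (Poly 𝕜 V) p :=
  (p.factorial : 𝕜)⁻¹ • exteriorPower.alternatingMapLinearEquiv (MultilinearMap.alternatization
    ((MultilinearMap.piLinearMap (MultilinearMap.mkPiAlgebra 𝕜 (Fin p) (Poly 𝕜 V))).compLinearMap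
      (fun _ => Poly.deriv ∘ₗ (fixedSpace 𝕜 V g).subtype)))

/-- A multivector field `X = f ⊗ u` on `V^g` as a multidifferential operator on `Poly(V)`, with
coefficients extended constantly along `N^g`. -/
def fieldOp (g : G) (p : ℕ) :
    Poly 𝕜 (fixedSpace 𝕜 V g) ⊗[𝕜] ⋀[𝕜]^p (fixedSpace 𝕜 V g) →ₗ[𝕜]
      Cochain 𝕜 (Poly 𝕜 V) (Poly 𝕜 V) p :=
  TensorProduct.lift (LinearMap.mk₂ 𝕜
    (fun f u => (LinearMap.mulLeft 𝕜 (Poly.comap (projFixed 𝕜 V g) f)).compMultilinearMap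
      (multivectorOp g p u))
    (fun f f' u => by ext a; simp [add_mul]) (fun c f u => by ext a; simp)
    (fun f u u' => by ext a; simp [mul_add]) (fun c f u => by ext a; simp))

/-- `(X ♯ Ω)(f₁, …, f_k) = X(f₁, …, f_p) Ω(f_{p+1}, …, f_k)`, where `p + l = k`. -/
def sharp {k l : ℕ} (p : Deg k l) (Ω : Cochain 𝕜 (Poly 𝕜 V) (Poly 𝕜 V) l) :
    Cochain 𝕜 (Poly 𝕜 V) (Poly 𝕜 V) p.1 →ₗ[𝕜] Cochain 𝕜 (Poly 𝕜 V) (Poly 𝕜 V) k where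
  toFun X := ((LinearMap.mul' 𝕜 (Poly 𝕜 V)).compMultilinearMap
    (MultilinearMap.domCoprod X Ω)).domDomCongr p.slots
  map_add' X Y := by ext f; simp [add_mul]
  map_smul' c X := by ext f; simp

/-- For `ξ = X ⊗ Λ_g` with `Λ_g = ∂/∂y^1 ∧ ⋯ ∧ ∂/∂y^{l(g)}`, this is `X`. -/
def divideLambda {g : G} (e : Module.Basis (Fin (codim 𝕜 V g)) 𝕜 (normalSpace 𝕜 V g)) (p : ℕ) :
    Poly 𝕜 (fixedSpace 𝕜 V g) ⊗[𝕜]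
      (⋀[𝕜]^p (fixedSpace 𝕜 V g) ⊗[𝕜] ⋀[𝕜]^(codim 𝕜 V g) (normalSpace 𝕜 V g)) →ₗ[𝕜]
    Poly 𝕜 (fixedSpace 𝕜 V g) ⊗[𝕜] ⋀[𝕜]^p (fixedSpace 𝕜 V g) :=
  LinearMap.lTensor _ ((TensorProduct.rid 𝕜 _).toLinearMap ∘ₗ
    LinearMap.lTensor _ (exteriorPower.alternatingMapLinearEquiv e.det))

/-- `T_1^g(X ⊗ Λ_g) = X ♯ Ω_g`. -/
def mapT1At {g : G} (e : Module.Basis (Fin (codim 𝕜 V g)) 𝕜 (normalSpace 𝕜 V g)) (k : ℕ) :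
    SectionsAt 𝕜 V g k →ₗ[𝕜] Cochain 𝕜 (Poly 𝕜 V) (Poly 𝕜 V) k :=
  ∑ p, sharp p (twistedCocycle e) ∘ₗ fieldOp g _ ∘ₗ divideLambda e _ ∘ₗ LinearMap.proj p

section

variable (y : (g : G) → Module.Basis (Fin (codim 𝕜 V g)) 𝕜 (normalSpace 𝕜 V g)) (k : ℕ)

/-- `ξ ↦ ∑_g T_1^g(ξ_g) U_g`. -/
def mapT1Raw :
    ((g : G) → SectionsAt 𝕜 V g k) →ₗ[𝕜] Cochain 𝕜 (Poly 𝕜 V) (Crossed 𝕜 V G) k :=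
  ∑ g, (SkewMonoidAlgebra.lsingle 𝕜 g).compMultilinearMapₗ 𝕜 ∘ₗ mapT1At (y g) k ∘ₗ
    LinearMap.proj g

/-- `T_1 : Γ(⨁_g ⋀^{•-l(g)} TV^g ⊗ ⋀^{l(g)} N^g)^G → C^•(Poly(V), Poly(V) ⋊ G)^G`. The average over
`G` is superfluous if `∑_g T_1^g(ξ_g) U_g` is already invariant, see `average_of_mem`. -/
def mapT1 : invariantSections 𝕜 V G k →ₗ[𝕜] invariantCochains 𝕜 V G k :=
  average k ∘ₗ mapT1Raw y k ∘ₗ Submodule.subtype _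

variable (𝕜 V G) in
/-- `T_2(Φ)(a₁U_{g₁}, …, a_kU_{g_k}) = Φ(a₁, g₁(a₂), …, g₁⋯g_{k-1}(a_k)) U_{g₁⋯g_k}`, extended
multilinearly. -/
def mapT2 : invariantCochains 𝕜 V G k →ₗ[𝕜] Cochain 𝕜 (Crossed 𝕜 V G) (Crossed 𝕜 V G) k :=
  (∑ γ : Fin k → G,
    (LinearMap.mulRight 𝕜 (U 𝕜 V (Fin.partialProd γ (Fin.last k)))).compMultilinearMapₗ 𝕜 ∘ₗ
      MultilinearMap.compLinearMapₗ (fun j =>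
        DistribSMul.toLinearMap 𝕜 (Poly 𝕜 V) (Fin.partialProd γ j.castSucc) ∘ₗ
          coeffAt 𝕜 V (γ j))) ∘ₗ Submodule.subtype _

/-- `T = T_2 ∘ T_1`. -/
def mapT : invariantSections 𝕜 V G k →ₗ[𝕜] Cochain 𝕜 (Crossed 𝕜 V G) (Crossed 𝕜 V G) k :=
  mapT2 𝕜 V G k ∘ₗ mapT1 y k

end

theorem mapT2_single {k : ℕ} (Φ : invariantCochains 𝕜 V G k) (a : Fin k → Poly 𝕜 V)
    (γ : Fin k → G) :
    mapT2 𝕜 V G k Φ (fun j => SkewMonoidAlgebra.single (γ j) (a j)) =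
      Φ.1 (fun j => Fin.partialProd γ j.castSucc • a j) *
        U 𝕜 V (Fin.partialProd γ (Fin.last k)) := by
  classical
  simp only [mapT2, LinearMap.comp_apply, LinearMap.sum_apply, _root_.sum_apply, LinearMap.compMultilinearMapₗ_apply,
    LinearMap.compMultilinearMap_apply, MultilinearMap.compLinearMapₗ_apply,
    MultilinearMap.compLinearMap_apply, LinearMap.mulRight_apply, Submodule.subtype_apply,
    DistribSMul.toLinearMap_apply]
  rw [Finset.sum_eq_single γ]
  · simp [coeffAt]
  · intro δ _ hδ
    obtain ⟨j, hj⟩ := Function.ne_iff.1 hδ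
    rw [MultilinearMap.map_coord_zero _ j, zero_mul]
    simp [coeffAt, SkewMonoidAlgebra.coeff_single, Finsupp.single_apply, hj.symm]
  · simp

variable (𝕜 V G) in
/-- `L_1(Ψ)(f₁, …, f_k) = |G|⁻¹ ∑_g (gΨ)(f₁, …, f_k)`. -/
def mapL1 (k : ℕ) :
    Cochain 𝕜 (Crossed 𝕜 V G) (Crossed 𝕜 V G) k →ₗ[𝕜] invariantCochains 𝕜 V G k :=
  average k ∘ₗ MultilinearMap.compLinearMapₗ (fun _ => SkewMonoidAlgebra.lsingle 𝕜 (1 : G))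

/-- For linear functionals `ℓ₁, …, ℓ_k`, the polynomial function
`x ↦ Ψ(ℓ₁ - ℓ₁(x), …, ℓ_k - ℓ_k(x))(x)`, see `eval_frozen`. -/
def frozen {k : ℕ} (Ψ : Cochain 𝕜 (Poly 𝕜 V) (Poly 𝕜 V) k) (ℓ : Fin k → Module.Dual 𝕜 V) :
    Poly 𝕜 V :=
  ∑ s : Finset (Fin k), (∏ j ∈ sᶜ, (-Poly.lin 𝕜 (ℓ j))) *
    Ψ (s.piecewise (fun j => Poly.lin 𝕜 (ℓ j)) (fun _ => 1))

theorem eval_frozen {k : ℕ} (Ψ : Cochain 𝕜 (Poly 𝕜 V) (Poly 𝕜 V) k)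
    (ℓ : Fin k → Module.Dual 𝕜 V) (v : V) :
    Poly.eval v (frozen Ψ ℓ) =
      Poly.eval v (Ψ (fun j => Poly.lin 𝕜 (ℓ j) - algebraMap 𝕜 _ (ℓ j v))) := by
  have h1 : (fun j => Poly.lin 𝕜 (ℓ j) - algebraMap 𝕜 (Poly 𝕜 V) (ℓ j v)) =
      (fun j => Poly.lin 𝕜 (ℓ j)) + (fun j => (-(ℓ j v)) • (1 : Poly 𝕜 V)) := by
    funext j
    simp [Algebra.algebraMap_eq_smul_one, sub_eq_add_neg]
  rw [h1, MultilinearMap.map_add_univ]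
  simp only [frozen, map_sum, map_mul, map_prod, map_neg]
  refine Finset.sum_congr rfl fun s _ => ?_
  have h2 : s.piecewise (fun j => Poly.lin 𝕜 (ℓ j)) (fun j => (-(ℓ j v)) • (1 : Poly 𝕜 V)) =
      sᶜ.piecewise (fun j => (-(ℓ j v)) •
        (s.piecewise (fun j => Poly.lin 𝕜 (ℓ j)) (fun _ => (1 : Poly 𝕜 V))) j)
        (s.piecewise (fun j => Poly.lin 𝕜 (ℓ j)) (fun _ => 1)) := by
    funext j
    by_cases hj : j ∈ s <;> simp [Finset.piecewise, hj]
  rw [h2, MultilinearMap.map_piecewise_smul]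
  simp [Poly.eval]

/-- `L_2^g(Ψ)(x) = ∑_{i₁, …, i_k} (k!)⁻¹ ∑_σ (-1)^σ Ψ((x_{σ(1)}^{i₁} - x^{i₁}) ⋯
(x_{σ(k)}^{i_k} - x^{i_k}))(x) ∂/∂x^{i₁} ∧ ⋯ ∧ ∂/∂x^{i_k}`, with values in the polynomial
`k`-vector fields `Poly(V) ⊗ ⋀^k V`. The basis `b` gives the coordinates `x^i`. -/
def mapL2At {n : ℕ} (b : Module.Basis (Fin n) 𝕜 V) (k : ℕ)
    (Ψ : Cochain 𝕜 (Poly 𝕜 V) (Poly 𝕜 V) k) : Poly 𝕜 V ⊗[𝕜] ⋀[𝕜]^k V :=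
  ∑ i : Fin k → Fin n,
    ((k.factorial : 𝕜)⁻¹ • ∑ σ : Equiv.Perm (Fin k),
      (Equiv.Perm.sign σ : ℤ) • frozen Ψ (fun m => b.coord (i (σ.symm m)))) ⊗ₜ[𝕜]
    exteriorPower.ιMulti 𝕜 k (fun j => b (i j))

/-- The projection `⋀^k V → ⋀^p V^g ⊗ ⋀^l N^g` coming from `V = V^g ⊕ N^g`, where `p + l = k`; on
`v₁ ∧ ⋯ ∧ v_k` it is a sum over shuffles. -/
def projWedge (g : G) {k l : ℕ} (p : Deg k l) :
    ⋀[𝕜]^k V →ₗ[𝕜] ⋀[𝕜]^(p.1 : ℕ) (fixedSpace 𝕜 V g) ⊗[𝕜] ⋀[𝕜]^l (normalSpace 𝕜 V g) :=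
  exteriorPower.alternatingMapLinearEquiv <| AlternatingMap.domDomCongr p.slots <|
    AlternatingMap.domCoprod
      ((exteriorPower.ιMulti 𝕜 (p.1 : ℕ)).compLinearMap (projFixed 𝕜 V g))
      ((exteriorPower.ιMulti 𝕜 l).compLinearMap (projNormal 𝕜 V g))

/-- `L_3^g(X) = pr^g(X|_{V^g})`. -/
def mapL3At (g : G) (k : ℕ) : Poly 𝕜 V ⊗[𝕜] ⋀[𝕜]^k V →ₗ[𝕜] SectionsAt 𝕜 V g k :=
  LinearMap.pi fun p => TensorProduct.map
    (Poly.comap (fixedSpace 𝕜 V g).subtype).toLinearMap (projWedge g p)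

/-- `L = L_3 ∘ L_2 ∘ L_1`. -/
def mapL {n : ℕ} (b : Module.Basis (Fin n) 𝕜 V) (k : ℕ)
    (Ψ : Cochain 𝕜 (Crossed 𝕜 V G) (Crossed 𝕜 V G) k) : (g : G) → SectionsAt 𝕜 V g k :=
  fun g => mapL3At g k (mapL2At b k ((coeffAt 𝕜 V g).compMultilinearMap (mapL1 𝕜 V G k Ψ).1))

end Maps

section SectionComplex
universe u v w
variable (𝕜 : Type u) [Field 𝕜] [CharZero 𝕜] (V : Type v) [AddCommGroup V] [Module 𝕜 V]
  (G : Type w) [Group G] [Finite G] [DistribMulAction G V] [SMulCommClass G 𝕜 V]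

/-- The complex `Γ(⨁_g ⋀^{•-l(g)} TV^g ⊗ ⋀^{l(g)} N^g)^G` with zero differential. -/
def sectionComplex : CochainComplex (ModuleCat.{max u v w} 𝕜) ℕ :=
  CochainComplex.of (fun k => ModuleCat.of 𝕜 (invariantSections 𝕜 V G k)) (fun _ => 0)
    (fun _ => by simp)

end SectionComplex

end TwistedHH

end

/-!
Write `A = Poly(V)` and `B = A ⋊ G`. The idea is that the cohomology of `B` is seen by a *symbol
map* from Hochschild cochains to a Koszul complex, where it can be computed by hand. For an
`A`-bimodule `M`, the operators `ad ℓ : m ↦ ℓ m - m ℓ`, for linear functionals `ℓ`, commute and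
define a Koszul differential on alternating forms on `V^*` with values in `M` (`koszulD`).
Evaluating a cochain on frozen arguments `ℓ - ℓ(x)` and antisymmetrizing is a morphism of complexes
(`Bimod.symbol_d`): the inner faces of the Hochschild differential are symmetric in two neighbouring
arguments and disappear, and the outer faces give commutators.

*The class map.* Restricting a cochain of `B` to `A`, averaging over `G`, and taking the symbol is
therefore a morphism of complexes as well (`Bimod.avgSymbol_d`). The `g`-component of the target is
the Koszul complex of `A U_g` (`twisted`), with differential built from multiplications by
`ℓ - g(ℓ)`. These functions vanish on `V^g`, so restriction to `V^g` kills all coboundaries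
(`comap_koszulD_twisted`). Hence `L` is a morphism of complexes (`mapL_hochschildD`).

*The cocycles.* Each term of `T_1^g(ξ_g)` is a product of derivations along `V^g` and of divided
differences in the directions of `N^g`. These are twisted derivations whose twists start at the
identity, fit together, and end at `g`. The Hochschild differential of such a product telescopes
(`d_prodCochain`, `d_mapT1At`), and an invariant cocycle on `A` extends to a cocycle on `B` by `T_2`
(`hochschildD_mapT2`). On a linear functional each factor is differentiation along a vector, so that
the symbol gives `ξ_g` back (`mapL3At_tensorOf_mapT1At`). Classes are equivariant
(`toMultivector_classAt`), whence averaging does not change them, and `L ∘ T = id` (`mapL_mapT`).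

*The quasi-isomorphism.* If `Ψ` is a cocycle, then `Ψ - T(L(Ψ))` is a cocycle with trivial class,
and it remains to see that such a cocycle is a coboundary (`exists_hochschildD_of_mapL_eq_zero`, and
`eq_zero_of_mapL_eq_zero` in degree zero). This is done in two steps.
* Its symbol is exact. The functions `y^i - ỹ^i` are coordinates transversal to `V^g`. Division by
  them is a homotopy on the Koszul complex of `A U_g`, which reduces every cocycle to one that is
  constant along `N^g` and contains all `dy^i`; such a form is determined by its class
  (`exists_koszulD_twisted`).
* A cocycle of `B`, with coefficients in any bimodule `M`, is exact if its averaged symbol is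
  (`Bimod.exists_d_of_avgSymbol_eq`). This goes by dimension shifting along
  `0 → M → Hom(B, M) → Hom(B, M) / M → 0`. Moving the last argument into the coefficients shows that
  a cocycle becomes a coboundary in `Hom(B, M)`, and so comes from a cocycle of lower degree with
  values in the quotient (`Bimod.d_curryRight`). Divided differences show that `Hom(B, M)` has no
  higher Koszul cohomology (`exists_koszulD_eq_coind`), so that the symbol shifts in the same way.
  In degree zero, an element commuting with all linear functionals commutes with `A`, and its
  average commutes with `B`.

No projective resolutions of `A` or `B` are needed.
-/

open CategoryTheory
open scoped TensorProduct

noncomputable section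

set_option linter.unusedSectionVars false

namespace TwistedHH

/-! ### Hochschild cochains with coefficients -/

section Bimodules

universe u

variable {𝕜 : Type*} [CommRing 𝕜] {B : Type*} [Ring B] [Algebra 𝕜 B]
  {M : Type*} [AddCommGroup M] [Module 𝕜 M]

variable (𝕜 B M) in
/-- A `B`-bimodule structure on the `𝕜`-module `M`, given by the left multiplication `l` and the
right multiplication `r`. It is data rather than an instance, because the same module carries
several such structures below. -/
structure Bimod where
  l : B →ₗ[𝕜] M →ₗ[𝕜] M
  r : B →ₗ[𝕜] M →ₗ[𝕜] M
  l_one : ∀ m, l 1 m = m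
  l_mul : ∀ a b m, l (a * b) m = l a (l b m)
  r_one : ∀ m, r 1 m = m
  r_mul : ∀ a b m, r (a * b) m = r b (r a m)
  comm : ∀ a b m, l a (r b m) = r b (l a m)

namespace Bimod

variable (𝕜 B) in
/-- The regular bimodule. -/
def self : Bimod 𝕜 B B where
  l := LinearMap.mul 𝕜 B
  r := (LinearMap.mul 𝕜 B).flip
  l_one := by simp
  l_mul := by simp [mul_assoc]
  r_one := by simp
  r_mul := by simp [mul_assoc]
  comm := by simp [mul_assoc]

@[simp] theorem self_l (a b : B) : (self 𝕜 B).l a b = a * b := rfl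

@[simp] theorem self_r (a b : B) : (self 𝕜 B).r a b = b * a := rfl

/-- Restriction of scalars along `f : A → B`. -/
def restrict {A : Type*} [Ring A] [Algebra 𝕜 A] (S : Bimod 𝕜 B M) (f : A →ₐ[𝕜] B) :
    Bimod 𝕜 A M where
  l := S.l ∘ₗ f.toLinearMap
  r := S.r ∘ₗ f.toLinearMap
  l_one := by simp [S.l_one]
  l_mul := by simp [S.l_mul]
  r_one := by simp [S.r_one]
  r_mul := by simp [S.r_mul]
  comm := by simp [S.comm]

@[simp] theorem restrict_l {A : Type*} [Ring A] [Algebra 𝕜 A] (S : Bimod 𝕜 B M) (f : A →ₐ[𝕜] B)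
    (a : A) : (S.restrict f).l a = S.l (f a) := rfl

@[simp] theorem restrict_r {A : Type*} [Ring A] [Algebra 𝕜 A] (S : Bimod 𝕜 B M) (f : A →ₐ[𝕜] B)
    (a : A) : (S.restrict f).r a = S.r (f a) := rfl

variable (S : Bimod 𝕜 B M)

/-- The coinduced bimodule `Hom(B, M)`, with `(b φ)(x) = b φ(x)` and `(φ b)(x) = φ(b x)`. -/
def coind : Bimod 𝕜 B (B →ₗ[𝕜] M) where
  l := LinearMap.llcomp 𝕜 B M M ∘ₗ S.l
  r := (LinearMap.llcomp 𝕜 B B M).flip ∘ₗ LinearMap.mul 𝕜 B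
  l_one φ := by ext; simp [S.l_one]
  l_mul a b φ := by ext; simp [S.l_mul]
  r_one φ := by ext; simp
  r_mul a b φ := by ext; simp [mul_assoc]
  comm a b φ := by ext; simp

@[simp] theorem coind_l (b : B) (φ : B →ₗ[𝕜] M) (x : B) : S.coind.l b φ x = S.l b (φ x) := rfl

@[simp] theorem coind_r (b : B) (φ : B →ₗ[𝕜] M) (x : B) : S.coind.r b φ x = φ (b * x) := rfl

/-- The embedding `m ↦ (x ↦ m x)` of `M` into `Hom(B, M)`. -/
def toCoind : M →ₗ[𝕜] B →ₗ[𝕜] M := S.r.flip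

@[simp] theorem toCoind_apply (m : M) (x : B) : S.toCoind m x = S.r x m := rfl

variable (𝕜 B M) in
/-- The linear maps vanishing at `1`. They form a complement of `M` in `Hom(B, M)`, and so
represent the quotient `Hom(B, M) / M`. -/
abbrev VanishAtOne : Submodule 𝕜 (B →ₗ[𝕜] M) := LinearMap.ker (LinearMap.applyₗ (1 : B))

theorem vanishAtOne_apply_one (φ : VanishAtOne 𝕜 B M) : (φ : B →ₗ[𝕜] M) 1 = 0 := φ.2

/-- The quotient map `Hom(B, M) → Hom(B, M) / M`. -/
def toQuot : (B →ₗ[𝕜] M) →ₗ[𝕜] VanishAtOne 𝕜 B M :=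
  LinearMap.codRestrict _ (LinearMap.id - S.toCoind ∘ₗ LinearMap.applyₗ (1 : B))
    (fun φ => by simp [S.r_one])

theorem toQuot_apply (φ : B →ₗ[𝕜] M) (x : B) :
    (S.toQuot φ : B →ₗ[𝕜] M) x = φ x - S.r x (φ 1) := rfl

/-- The bimodule structure of `Hom(B, M) / M`, in terms of representatives vanishing at `1`:
`(b φ)(x) = b φ(x)` and `(φ b)(x) = φ(b x) - φ(b) x`. -/
def quot : Bimod 𝕜 B (VanishAtOne 𝕜 B M) where
  l :=
    { toFun b := S.toQuot ∘ₗ S.coind.l b ∘ₗ Submodule.subtype _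
      map_add' a b := by ext; simp
      map_smul' c a := by ext; simp }
  r :=
    { toFun b := S.toQuot ∘ₗ S.coind.r b ∘ₗ Submodule.subtype _
      map_add' a b := by ext; simp
      map_smul' c a := by ext; simp }
  l_one φ := by ext; simp [toQuot_apply, vanishAtOne_apply_one, S.l_one]
  l_mul a b φ := by ext; simp [toQuot_apply, vanishAtOne_apply_one, S.l_mul]
  r_one φ := by ext; simp [toQuot_apply, vanishAtOne_apply_one]
  r_mul a b φ := by ext; simp [toQuot_apply, mul_assoc, S.r_mul]
  comm a b φ := by ext; simp [toQuot_apply, vanishAtOne_apply_one, S.comm]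

theorem toQuot_l (b : B) (φ : B →ₗ[𝕜] M) : S.toQuot (S.coind.l b φ) = S.quot.l b (S.toQuot φ) := by
  ext; simp [quot, toQuot_apply, S.comm, S.r_one]

theorem toQuot_r (b : B) (φ : B →ₗ[𝕜] M) : S.toQuot (S.coind.r b φ) = S.quot.r b (S.toQuot φ) := by
  ext; simp [quot, toQuot_apply, S.r_mul]

theorem toQuot_toCoind (m : M) : S.toQuot (S.toCoind m) = 0 := by
  ext; simp [toQuot_apply, S.r_one]

theorem toQuot_subtype (φ : VanishAtOne 𝕜 B M) : S.toQuot (φ : B →ₗ[𝕜] M) = φ := by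
  ext; simp [toQuot_apply, vanishAtOne_apply_one]

theorem eq_toCoind_of_toQuot_eq_zero {φ : B →ₗ[𝕜] M} (h : S.toQuot φ = 0) :
    φ = S.toCoind (φ 1) := by
  ext x
  have := LinearMap.congr_fun (congrArg Subtype.val h) x
  simpa [toQuot_apply, sub_eq_zero] using this

theorem toCoind_injective : Function.Injective S.toCoind := fun m m' h => by
  simpa [S.r_one] using LinearMap.congr_fun h 1

theorem toCoind_l (b : B) (m : M) : S.toCoind (S.l b m) = S.coind.l b (S.toCoind m) := by
  ext; simp [S.comm]

theorem toCoind_r (b : B) (m : M) : S.toCoind (S.r b m) = S.coind.r b (S.toCoind m) := by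
  ext; simp [S.r_mul]

/-! ### The Hochschild differential -/

/-- `(a₀, …, aₙ) ↦ ξ (a₀, …, aᵢ aᵢ₊₁, …, aₙ)`. -/
def midFace {n : ℕ} (i : Fin n) (ξ : Cochain 𝕜 B M n) : Cochain 𝕜 B M (n + 1) where
  toFun a := ξ (Fin.contractNth i.castSucc (· * ·) a)
  map_update_add' a j x y := by
    obtain ⟨k, φ, h⟩ := contractNth_update 𝕜 i a j
    simp only [h, map_add, MultilinearMap.map_update_add]
  map_update_smul' a j c x := by
    obtain ⟨k, φ, h⟩ := contractNth_update 𝕜 i a j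
    simp only [h, map_smul, MultilinearMap.map_update_smul]

/-- `(a₀, …, aₙ) ↦ a₀ ξ(a₁, …, aₙ)`. -/
def leftFace {n : ℕ} (ξ : Cochain 𝕜 B M n) : Cochain 𝕜 B M (n + 1) :=
  LinearMap.uncurryLeft
    { toFun b := (S.l b).compMultilinearMap ξ
      map_add' a b := by ext; simp
      map_smul' c a := by ext; simp }

/-- `(a₀, …, aₙ) ↦ ξ(a₀, …, aₙ₋₁) aₙ`. -/
def rightFace {n : ℕ} (ξ : Cochain 𝕜 B M n) : Cochain 𝕜 B M (n + 1) :=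
  MultilinearMap.uncurryRight (S.r.flip.compMultilinearMap ξ)

/-- The Hochschild differential with coefficients in the bimodule `M`. -/
def d (n : ℕ) : Cochain 𝕜 B M n →ₗ[𝕜] Cochain 𝕜 B M (n + 1) where
  toFun ξ := S.leftFace ξ + ∑ i : Fin n, (-1 : 𝕜) ^ ((i : ℕ) + 1) • midFace i ξ +
    (-1 : 𝕜) ^ (n + 1) • S.rightFace ξ
  map_add' ξ η := by
    ext a
    simp only [leftFace, midFace, rightFace, _root_.add_apply, _root_.smul_apply,
      MultilinearMap.coe_mk, _root_.sum_apply, smul_add, LinearMap.uncurryLeft_apply,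
      MultilinearMap.uncurryRight_apply, LinearMap.coe_mk, AddHom.coe_mk,
      LinearMap.compMultilinearMap_apply, LinearMap.flip_apply, map_add, LinearMap.add_apply,
      Finset.sum_add_distrib]
    abel
  map_smul' c ξ := by
    ext a
    simp only [leftFace, midFace, rightFace, _root_.add_apply, _root_.smul_apply,
      MultilinearMap.coe_mk, _root_.sum_apply, smul_add, LinearMap.uncurryLeft_apply,
      MultilinearMap.uncurryRight_apply, LinearMap.coe_mk, AddHom.coe_mk,
      LinearMap.compMultilinearMap_apply, LinearMap.flip_apply, map_smul, LinearMap.smul_apply,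
      Finset.smul_sum, RingHom.id_apply, smul_comm c]

theorem d_apply {n : ℕ} (ξ : Cochain 𝕜 B M n) (a : Fin (n + 1) → B) :
    S.d n ξ a = S.l (a 0) (ξ (Fin.tail a)) +
      ∑ i : Fin n, (-1 : 𝕜) ^ ((i : ℕ) + 1) • ξ (Fin.contractNth i.castSucc (· * ·) a) +
      (-1 : 𝕜) ^ (n + 1) • S.r (a (Fin.last n)) (ξ (Fin.init a)) := by
  simp [d, leftFace, midFace, rightFace]

theorem d_self {n : ℕ} (ξ : Cochain 𝕜 B B n) : (self 𝕜 B).d n ξ = hochschildD 𝕜 n ξ := by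
  ext a
  simp [d_apply, hochschildD_apply]

theorem contractNth_comp {A : Type*} [Ring A] {n : ℕ} (f : A →+* B) (i : Fin (n + 1))
    (a : Fin (n + 1) → A) :
    (fun j => f (Fin.contractNth i (· * ·) a j)) =
      Fin.contractNth i (· * ·) (fun j => f (a j)) := by
  funext j
  simp only [Fin.contractNth]
  split_ifs <;> simp

/-- Transport of cochains along an algebra homomorphism `f : A → B` of arguments and a linear map
`t` of coefficients. -/
def transport {A M' : Type*} [Ring A] [Algebra 𝕜 A] [AddCommGroup M'] [Module 𝕜 M'] (f : A →ₐ[𝕜] B)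
    (t : M →ₗ[𝕜] M') (n : ℕ) : Cochain 𝕜 B M n →ₗ[𝕜] Cochain 𝕜 A M' n :=
  t.compMultilinearMapₗ 𝕜 ∘ₗ MultilinearMap.compLinearMapₗ (fun _ => f.toLinearMap)

@[simp] theorem transport_apply {A M' : Type*} [Ring A] [Algebra 𝕜 A] [AddCommGroup M']
    [Module 𝕜 M'] (f : A →ₐ[𝕜] B) (t : M →ₗ[𝕜] M') {n : ℕ} (ξ : Cochain 𝕜 B M n) (a : Fin n → A) :
    transport f t n ξ a = t (ξ fun j => f (a j)) := by
  simp [transport]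

theorem d_transport {A M' : Type*} [Ring A] [Algebra 𝕜 A] [AddCommGroup M'] [Module 𝕜 M']
    (f : A →ₐ[𝕜] B) (t : M →ₗ[𝕜] M') (S' : Bimod 𝕜 A M')
    (hl : ∀ a m, t (S.l (f a) m) = S'.l a (t m)) (hr : ∀ a m, t (S.r (f a) m) = S'.r a (t m))
    {n : ℕ} (ξ : Cochain 𝕜 B M n) :
    S'.d n (transport f t n ξ) = transport f t (n + 1) (S.d n ξ) := by
  ext a
  have h := fun i => contractNth_comp (f : A →+* B) (n := n) i a
  simp only [RingHom.coe_coe] at h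
  simp only [d_apply, transport_apply, h, map_add, map_sum, map_smul, hl, hr]
  rfl

theorem d_comp {M' : Type*} [AddCommGroup M'] [Module 𝕜 M'] (t : M →ₗ[𝕜] M') (S' : Bimod 𝕜 B M')
    (hl : ∀ a m, t (S.l a m) = S'.l a (t m)) (hr : ∀ a m, t (S.r a m) = S'.r a (t m))
    {n : ℕ} (ξ : Cochain 𝕜 B M n) :
    S'.d n (t.compMultilinearMap ξ) = t.compMultilinearMap (S.d n ξ) :=
  S.d_transport (AlgHom.id 𝕜 B) t S' hl hr ξ

/-- Moving the last argument of a cochain into the coefficients. -/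
theorem d_curryRight {n : ℕ} (X : Cochain 𝕜 B M (n + 1)) :
    S.coind.d n (MultilinearMap.curryRight X) = MultilinearMap.curryRight (S.d (n + 1) X) +
      (-1 : 𝕜) ^ (n + 1) • S.toCoind.compMultilinearMap X := by
  ext a x
  have h1 : Fin.tail (Fin.snoc a x : Fin (n + 2) → B) = Fin.snoc (Fin.tail a) x := by
    funext j
    refine Fin.lastCases ?_ (fun j => ?_) j
    · simp [Fin.tail]
    · simp [Fin.tail, ← Fin.castSucc_succ]
  have h2 : ∀ i : Fin n,
      Fin.contractNth i.castSucc.castSucc (· * ·) (Fin.snoc a x : Fin (n + 2) → B) =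
      Fin.snoc (Fin.contractNth i.castSucc (· * ·) a) x := by
    intro i
    funext j
    refine Fin.lastCases ?_ (fun j => ?_) j
    · have : ¬ (n < (i : ℕ)) := by omega
      have h' : ¬ (n = (i : ℕ)) := by omega
      simp [Fin.contractNth, this, h']
    · simp [Fin.contractNth, ← Fin.castSucc_succ]
  have h3 : Fin.contractNth (Fin.last n).castSucc (· * ·) (Fin.snoc a x : Fin (n + 2) → B) =
      Fin.snoc (Fin.init a) (a (Fin.last n) * x) := by
    funext j
    refine Fin.lastCases ?_ (fun j => ?_) j
    · simp [Fin.contractNth]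
    · simp [Fin.contractNth, Fin.init]
  simp only [d_apply, MultilinearMap.curryRight_apply, _root_.add_apply, _root_.smul_apply,
    LinearMap.add_apply, LinearMap.smul_apply, LinearMap.compMultilinearMap_apply, toCoind_apply,
    Fin.sum_univ_castSucc (n := n), h1, h2, h3, coind_l, coind_r, LinearMap.sum_apply]
  simp only [Fin.snoc_last, Fin.init_snoc, Fin.val_castSucc, Fin.val_last]
  rw [show (Fin.snoc a x : Fin (n + 2) → B) 0 = a 0 from Fin.snoc_castSucc (α := fun _ => B) x a 0]
  rw [pow_succ (-1 : 𝕜) (n + 1)]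
  simp
  abel

/-- The square of the differential vanishes: by induction on the degree, moving the last argument
into the coefficients. -/
theorem d_d {B M : Type u} [Ring B] [Algebra 𝕜 B] [AddCommGroup M] [Module 𝕜 M]
    (S : Bimod 𝕜 B M) {n : ℕ} (X : Cochain 𝕜 B M n) : S.d (n + 1) (S.d n X) = 0 := by
  induction n generalizing M with
  | zero =>
    ext a
    simp only [d_apply]
    have h1 : Fin.tail a 0 = a 1 := rfl
    have h2 : Fin.contractNth (0 : Fin 2) (· * ·) a 0 = a 0 * a 1 := rfl
    have h3 : Fin.init a 0 = a 0 := rfl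
    simp [h1, h2, h3, S.l_mul, S.r_mul, S.comm, Subsingleton.elim _ (default : Fin 0 → B)]
    abel
  | succ n ih =>
    have h0 := ih S.coind X.curryRight
    have h1 := S.d_curryRight (S.d (n + 1) X)
    have h2 : ∀ Z : Cochain 𝕜 B (B →ₗ[𝕜] M) (n + 2),
        (-1 : 𝕜) ^ (n + 1 + 1) • Z + (-1 : 𝕜) ^ (n + 1) • Z = 0 := fun Z => by
      ext; simp [pow_succ]
    rw [S.d_curryRight, map_add, map_smul, h1,
      S.d_comp S.toCoind S.coind S.toCoind_l S.toCoind_r,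
      add_assoc (MultilinearMap.curryRight _), h2, add_zero] at h0
    rw [← MultilinearMap.uncurry_curryRight (S.d (n + 1 + 1) (S.d (n + 1) X)), h0]
    ext; simp

end Bimod
end Bimodules

/-! ### Koszul cochains -/

section Koszul

variable {𝕜 : Type*} [CommRing 𝕜] {W M : Type*} [AddCommGroup W] [Module 𝕜 W]
  [AddCommGroup M] [Module 𝕜 M]

/-- For a linear family of operators `D_ℓ` on `M`, the Koszul differential
`(dω)(ℓ₀, …, ℓₙ) = ∑_i (-1)^i D_{ℓ_i} ω(…, ℓ̂_i, …)` on alternating maps with values in `M`. -/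
def koszulD (D : W →ₗ[𝕜] M →ₗ[𝕜] M) (n : ℕ) :
    W [⋀^Fin n]→ₗ[𝕜] M →ₗ[𝕜] W [⋀^Fin (n + 1)]→ₗ[𝕜] M where
  toFun ω := AlternatingMap.alternatizeUncurryFin
    { toFun ℓ := (D ℓ).compAlternatingMap ω
      map_add' ℓ ℓ' := by ext; simp
      map_smul' c ℓ := by ext; simp }
  map_add' ω η := by
    ext v; simp [AlternatingMap.alternatizeUncurryFin_apply, Finset.sum_add_distrib]
  map_smul' c ω := by
    ext v
    simp only [AlternatingMap.alternatizeUncurryFin_apply, Finset.smul_sum, RingHom.id_apply,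
      AlternatingMap.smul_apply, LinearMap.coe_mk, AddHom.coe_mk, map_smul,
      LinearMap.compAlternatingMap_apply]
    simp only [smul_comm c]

theorem koszulD_apply (D : W →ₗ[𝕜] M →ₗ[𝕜] M) {n : ℕ} (ω : W [⋀^Fin n]→ₗ[𝕜] M)
    (v : Fin (n + 1) → W) :
    koszulD D n ω v = ∑ i : Fin (n + 1), (-1 : ℤ) ^ (i : ℕ) • D (v i) (ω (i.removeNth v)) := by
  simp [koszulD, AlternatingMap.alternatizeUncurryFin_apply]

/-- The exterior product `c ∧ ω` with a linear form `c`. -/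
def wedgeForm (c : Module.Dual 𝕜 W) (n : ℕ) : W [⋀^Fin n]→ₗ[𝕜] M →ₗ[𝕜] W [⋀^Fin (n + 1)]→ₗ[𝕜] M :=
  koszulD (c.smulRight LinearMap.id) n

theorem wedgeForm_apply (c : Module.Dual 𝕜 W) {n : ℕ} (ω : W [⋀^Fin n]→ₗ[𝕜] M)
    (v : Fin (n + 1) → W) :
    wedgeForm c n ω v = ∑ i : Fin (n + 1), (-1 : ℤ) ^ (i : ℕ) • c (v i) • ω (i.removeNth v) := by
  simp [wedgeForm, koszulD_apply]

variable (D : W →ₗ[𝕜] M →ₗ[𝕜] M)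

theorem koszulD_koszulD (hD : ∀ ℓ ℓ' m, D ℓ (D ℓ' m) = D ℓ' (D ℓ m)) {n : ℕ}
    (ω : W [⋀^Fin n]→ₗ[𝕜] M) : koszulD D (n + 1) (koszulD D n ω) = 0 := by
  let f : W →ₗ[𝕜] W →ₗ[𝕜] W [⋀^Fin n]→ₗ[𝕜] M :=
    LinearMap.mk₂ 𝕜 (fun ℓ ℓ' => (D ℓ ∘ₗ D ℓ').compAlternatingMap ω)
      (fun _ _ _ => by ext; simp) (fun _ _ _ => by ext; simp)
      (fun _ _ _ => by ext; simp) (fun _ _ _ => by ext; simp)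
  rw [← AlternatingMap.alternatizeUncurryFin_alternatizeUncurryFinLM_comp_of_symmetric
    (f := f) (fun x y => by ext v; simp [f, hD x y])]
  ext v
  simp [f, koszulD_apply, AlternatingMap.alternatizeUncurryFin_apply]

theorem koszulD_comp {M' : Type*} [AddCommGroup M'] [Module 𝕜 M'] (D' : W →ₗ[𝕜] M' →ₗ[𝕜] M')
    (t : M →ₗ[𝕜] M') (h : ∀ ℓ m, t (D ℓ m) = D' ℓ (t m)) {n : ℕ} (ω : W [⋀^Fin n]→ₗ[𝕜] M) :
    koszulD D' n (t.compAlternatingMap ω) = t.compAlternatingMap (koszulD D n ω) := by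
  ext v
  simp only [koszulD_apply, LinearMap.compAlternatingMap_apply, map_sum, map_zsmul, h]

/-- Cartan's formula for the contraction with `w`. -/
theorem curryLeft_koszulD {n : ℕ} (ω : W [⋀^Fin (n + 1)]→ₗ[𝕜] M) (w : W) :
    (koszulD D (n + 1) ω).curryLeft w =
      (D w).compAlternatingMap ω - koszulD D n (ω.curryLeft w) := by
  ext v
  have h : ∀ i : Fin (n + 1), i.succ.removeNth (Matrix.vecCons w v) =
      Matrix.vecCons w (i.removeNth v) := by
    intro i
    funext j
    refine Fin.cases ?_ (fun j => ?_) j <;> simp [Fin.removeNth]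
  have h0 : (0 : Fin (n + 2)).removeNth (Matrix.vecCons w v) = v := by
    funext j; simp [Fin.removeNth]
  simp only [AlternatingMap.curryLeft_apply_apply, koszulD_apply, AlternatingMap.sub_apply,
    LinearMap.compAlternatingMap_apply]
  rw [Fin.sum_univ_succ, sub_eq_add_neg, ← Finset.sum_neg_distrib, h0]
  congr 1
  · simp
  · refine Finset.sum_congr rfl fun i _ => ?_
    rw [h]
    simp [pow_succ]

theorem koszulD_comp_of_commutator (S C : M →ₗ[𝕜] M) (c : Module.Dual 𝕜 W)
    (h : ∀ ℓ m, D ℓ (S m) = S (D ℓ m) + c ℓ • C m) {n : ℕ} (ω : W [⋀^Fin n]→ₗ[𝕜] M) :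
    koszulD D n (S.compAlternatingMap ω) = S.compAlternatingMap (koszulD D n ω) +
      C.compAlternatingMap (wedgeForm c n ω) := by
  ext v
  simp only [koszulD_apply, wedgeForm_apply, LinearMap.compAlternatingMap_apply,
    AlternatingMap.add_apply, map_sum, map_zsmul, h, map_smul, ← Finset.sum_add_distrib, smul_add]

/-- If `S` commutes with the `D_ℓ` up to `[D_ℓ, S] = c(ℓ) C`, then `S` composed with the contraction
with `w` is a homotopy from `S D_w + C (c ∧ i_w)` to zero. -/
theorem koszulD_homotopy (S C : M →ₗ[𝕜] M) (c : Module.Dual 𝕜 W)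
    (h : ∀ ℓ m, D ℓ (S m) = S (D ℓ m) + c ℓ • C m) {n : ℕ} (ω : W [⋀^Fin (n + 1)]→ₗ[𝕜] M)
    (hω : koszulD D (n + 1) ω = 0) (w : W) :
    koszulD D n (S.compAlternatingMap (ω.curryLeft w)) =
      (S ∘ₗ D w).compAlternatingMap ω + C.compAlternatingMap (wedgeForm c n (ω.curryLeft w)) := by
  have h1 := curryLeft_koszulD D ω w
  rw [hω] at h1
  have h2 : koszulD D n (ω.curryLeft w) = (D w).compAlternatingMap ω := by
    rw [eq_comm, ← sub_eq_zero, ← h1]; ext; simp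
  rw [koszulD_comp_of_commutator D S C c h, h2]
  rfl

theorem curryLeft_wedgeForm {n : ℕ} (c : Module.Dual 𝕜 W) (ω : W [⋀^Fin (n + 1)]→ₗ[𝕜] M) (w : W) :
    (wedgeForm c (n + 1) ω).curryLeft w = c w • ω - wedgeForm c n (ω.curryLeft w) := by
  rw [wedgeForm, curryLeft_koszulD]
  rfl

theorem curryLeft_wedgeForm_zero (c : Module.Dual 𝕜 W) (ω : W [⋀^Fin 0]→ₗ[𝕜] M) (w : W) :
    (wedgeForm c 0 ω).curryLeft w = c w • ω := by
  ext v
  simp [wedgeForm_apply]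

theorem curryLeft_curryLeft_comm {n : ℕ} (ω : W [⋀^Fin (n + 2)]→ₗ[𝕜] M) (w w' : W) :
    (ω.curryLeft w).curryLeft w' = -(ω.curryLeft w').curryLeft w := by
  ext v
  simp only [AlternatingMap.curryLeft_apply_apply, AlternatingMap.neg_apply]
  rw [← ω.map_swap _ (show (0 : Fin (n + 2)) ≠ 1 by simp)]
  congr 1
  funext j
  refine Fin.cases ?_ (fun j => ?_) j
  · simp
  · refine Fin.cases ?_ (fun j => ?_) j
    · simp
    · rw [Function.comp_apply, Equiv.swap_apply_of_ne_of_ne]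
      · simp
      · simp
      · simp [Fin.ext_iff]

theorem curryLeft_sub_wedgeForm {n : ℕ} (ω : W [⋀^Fin (n + 1)]→ₗ[𝕜] M) (c : Module.Dual 𝕜 W)
    (w w' : W) (h : c w' = 1 ∧ w' = w ∨ c w' = 0 ∧ ω.curryLeft w' = 0) :
    (ω - wedgeForm c n (ω.curryLeft w)).curryLeft w' = 0 := by
  rw [sub_eq_add_neg, AlternatingMap.curryLeft_add, LinearMap.add_apply,
    show ∀ η : W [⋀^Fin (n + 1)]→ₗ[𝕜] M, (-η).curryLeft w' = -η.curryLeft w' from fun _ => rfl]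
  cases n with
  | zero =>
    rw [curryLeft_wedgeForm_zero]
    rcases h with ⟨h, rfl⟩ | ⟨h, h'⟩ <;> simp [*]
  | succ n =>
    rw [curryLeft_wedgeForm]
    rcases h with ⟨h, rfl⟩ | ⟨h, h'⟩
    · simp [h]
    · rw [curryLeft_curryLeft_comm, h', h]; simp

/-- If the operators `D_{x^i}` have right inverses `S_i` commuting with the other `D_{x^j}`, then
the Koszul complex is acyclic in positive degrees. -/
theorem exists_koszulD_eq_of_rightInverse {ι : Type*} [Fintype ι] [DecidableEq ι]
    (hD : ∀ ℓ ℓ' m, D ℓ (D ℓ' m) = D ℓ' (D ℓ m)) (x : Module.Basis ι 𝕜 W) (S : ι → M →ₗ[𝕜] M)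
    (h1 : ∀ i m, D (x i) (S i m) = m) (h2 : ∀ i j m, j ≠ i → D (x j) (S i m) = S i (D (x j) m))
    {n : ℕ} (ω : W [⋀^Fin (n + 1)]→ₗ[𝕜] M) (hω : koszulD D (n + 1) ω = 0) :
    ∃ θ, ω = koszulD D n θ := by
  -- The homotopy `S_i` after contraction with `x^i` makes the contraction with `x^i` vanish, and
  -- keeps those that vanish already.
  have key : ∀ J : Finset ι, ∃ θ, ∀ j ∈ J, (ω - koszulD D n θ).curryLeft (x j) = 0 := by
    intro J
    induction J using Finset.induction with
    | empty => exact ⟨0, by simp⟩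
    | insert i J hi ih =>
      obtain ⟨θ, hθ⟩ := ih
      set ω' := ω - koszulD D n θ with hω'
      have hω'0 : koszulD D (n + 1) ω' = 0 := by
        rw [hω', map_sub, hω, koszulD_koszulD D hD, sub_zero]
      -- The defect in `[D_ℓ, S_i] = x_i(ℓ) C`; it is the projection to the kernel of `D_{x^i}`.
      let C : M →ₗ[𝕜] M := LinearMap.id - S i ∘ₗ D (x i)
      have hS : ∀ ℓ m, D ℓ (S i m) = S i (D ℓ m) + x.coord i ℓ • C m := by
        intro ℓ m
        have : D.flip (S i m) = S i ∘ₗ D.flip m + (x.coord i).smulRight (C m) := by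
          refine x.ext fun j => ?_
          by_cases hj : j = i
          · subst hj; simp [C, h1]
          · simp [h2 i j m hj, hj]
        exact LinearMap.congr_fun this ℓ
      have hh := koszulD_homotopy D (S i) C (x.coord i) hS ω' hω'0 (x i)
      refine ⟨θ + (S i).compAlternatingMap (ω'.curryLeft (x i)), fun j hj => ?_⟩
      have h3 : ω - koszulD D n (θ + (S i).compAlternatingMap (ω'.curryLeft (x i))) =
          C.compAlternatingMap (ω' - wedgeForm (x.coord i) n (ω'.curryLeft (x i))) := by
        rw [map_add, hh, ← sub_sub, ← hω']
        ext v
        simp [C]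
        abel
      have h4 : (ω' - wedgeForm (x.coord i) n (ω'.curryLeft (x i))).curryLeft (x j) = 0 := by
        apply curryLeft_sub_wedgeForm
        by_cases hji : j = i
        · exact Or.inl (by simp [hji])
        · exact Or.inr ⟨by simp [hji], hθ j (by simpa [hji] using hj)⟩
      rw [h3]
      ext v
      have := congrArg (fun F => C (F v)) h4
      simpa using this
  obtain ⟨θ, hθ⟩ := key Finset.univ
  refine ⟨θ, sub_eq_zero.1 ?_⟩
  have : (ω - koszulD D n θ).curryLeft = 0 := x.ext fun j => by simp [hθ j]
  ext v
  have h := congrArg (fun F => F (v 0) (Fin.tail v)) this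
  simpa [Matrix.vecCons] using h

/-- If the operators `D_{w_i}` have left inverses `S_i` with `D_ℓ S_i = S_i D_ℓ - c_i(ℓ) R_i`, for
commuting idempotents `R_i`, then every cocycle is cohomologous to one with values in the images of
all `R_i`, and divisible by all `c_i`. -/
theorem exists_koszulD_of_leftInverse {ι : Type*} [Fintype ι] [DecidableEq ι]
    (hD : ∀ ℓ ℓ' m, D ℓ (D ℓ' m) = D ℓ' (D ℓ m)) (w : ι → W) (c : ι → Module.Dual 𝕜 W)
    (hc : ∀ i j, i ≠ j → c j (w i) = 0) (S R : ι → M →ₗ[𝕜] M)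
    (h1 : ∀ i m, S i (D (w i) m) = m)
    (h2 : ∀ i ℓ m, D ℓ (S i m) = S i (D ℓ m) - c i ℓ • R i m)
    (hR : ∀ i m, R i (R i m) = R i m) (hR' : ∀ i j m, R i (R j m) = R j (R i m))
    {n : ℕ} (ω : W [⋀^Fin (n + 1)]→ₗ[𝕜] M) (hω : koszulD D (n + 1) ω = 0) :
    ∃ θ, ∀ j, (∀ v, R j ((ω - koszulD D n θ) v) = (ω - koszulD D n θ) v) ∧
      ∀ v, (∀ a, c j (v a) = 0) → (ω - koszulD D n θ) v = 0 := by
  -- One index at a time: as `S_i D_{w_i} = 1`, the homotopy leaves `R_i (c_i ∧ i_{w_i} ω)`.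
  have key : ∀ J : Finset ι, ∃ θ, ∀ j ∈ J,
      (∀ v, R j ((ω - koszulD D n θ) v) = (ω - koszulD D n θ) v) ∧
      ∀ v, (∀ a, c j (v a) = 0) → (ω - koszulD D n θ) v = 0 := by
    intro J
    induction J using Finset.induction with
    | empty => exact ⟨0, by simp⟩
    | insert i J hi ih =>
      obtain ⟨θ, hθ⟩ := ih
      set ω' := ω - koszulD D n θ with hω'
      have hω'0 : koszulD D (n + 1) ω' = 0 := by
        rw [hω', map_sub, hω, koszulD_koszulD D hD, sub_zero]
      have hh := koszulD_homotopy D (S i) (-R i) (c i)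
        (fun ℓ m => by rw [h2, sub_eq_add_neg, LinearMap.neg_apply, smul_neg]) ω' hω'0 (w i)
      refine ⟨θ + (S i).compAlternatingMap (ω'.curryLeft (w i)), ?_⟩
      have h3 : ω - koszulD D n (θ + (S i).compAlternatingMap (ω'.curryLeft (w i))) =
          (R i).compAlternatingMap (wedgeForm (c i) n (ω'.curryLeft (w i))) := by
        rw [map_add, hh, ← sub_sub, ← hω']
        ext v
        simp [h1]
      rw [h3]
      intro j hj
      rcases Finset.mem_insert.1 hj with rfl | hj
      · exact ⟨fun v => by simp [hR], fun v hv => by simp [wedgeForm_apply, hv]⟩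
      · have hji : i ≠ j := fun h => hi (h ▸ hj)
        refine ⟨fun v => ?_, fun v hv => ?_⟩
        · simp only [LinearMap.compAlternatingMap_apply, wedgeForm_apply, map_sum, map_zsmul,
            map_smul, hR' j i, AlternatingMap.curryLeft_apply_apply, (hθ j hj).1]
        · simp only [LinearMap.compAlternatingMap_apply, wedgeForm_apply,
            AlternatingMap.curryLeft_apply_apply]
          rw [Finset.sum_eq_zero, map_zero]
          intro a _
          rw [(hθ j hj).2, smul_zero, smul_zero]
          intro b
          refine Fin.cases ?_ (fun b => ?_) b
          · simpa using hc i j hji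
          · exact hv _
  obtain ⟨θ, hθ⟩ := key Finset.univ
  exact ⟨θ, fun j => hθ j (Finset.mem_univ j)⟩

end Koszul

/-! ### Symbols of Hochschild cochains -/

section Alternatization

variable {𝕜 : Type*} [CommRing 𝕜] {W M : Type*} [AddCommGroup W] [Module 𝕜 W]
  [AddCommGroup M] [Module 𝕜 M]

/-- The permutations of `Fin (n + 1)`, decomposed according to the image of `0`. -/
theorem bijective_cycleRange_mul (n : ℕ) : Function.Bijective
    (fun p : Fin (n + 1) × Equiv.Perm (Fin n) =>
      p.1.cycleRange.symm * Equiv.Perm.decomposeFin.symm (0, p.2)) := by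
  rw [Fintype.bijective_iff_injective_and_card]
  refine ⟨?_, ?_⟩
  · rintro ⟨i, e⟩ ⟨j, e'⟩ h
    have hij : i = j := by
      have := Equiv.congr_fun h 0
      simpa using this
    subst hij
    have := mul_left_cancel h
    simpa using this
  · rw [Fintype.card_prod, Fintype.card_perm, Fintype.card_perm]
    simp [Nat.factorial_succ]

/-- Expansion of an antisymmetrization with respect to the first argument. -/
theorem alternatization_curryLeft {n : ℕ} (F : MultilinearMap 𝕜 (fun _ : Fin (n + 1) => W) M)
    (v : Fin (n + 1) → W) :
    MultilinearMap.alternatization F v = ∑ i : Fin (n + 1), (-1 : ℤ) ^ (i : ℕ) •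
      MultilinearMap.alternatization (F.curryLeft (v i)) (i.removeNth v) := by
  simp only [MultilinearMap.alternatization_apply, Finset.smul_sum]
  rw [← Finset.sum_product', Finset.univ_product_univ]
  symm
  refine Fintype.sum_bijective _ (bijective_cycleRange_mul n) _ _ ?_
  rintro ⟨i, e⟩
  have h1 : Equiv.Perm.sign (i.cycleRange.symm * Equiv.Perm.decomposeFin.symm (0, e)) =
      (-1) ^ (i : ℕ) * Equiv.Perm.sign e := by
    simp [Fin.sign_cycleRange]
  have h2 : (Fin.cons (v i) (fun j => i.removeNth v (e j)) : Fin (n + 1) → W) =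
      fun j => v ((i.cycleRange.symm * Equiv.Perm.decomposeFin.symm (0, e)) j) := by
    funext j
    refine Fin.cases ?_ (fun j => ?_) j
    · simp
    · simp [Fin.removeNth]
  simp only [h1, MultilinearMap.domDomCongr_apply, MultilinearMap.curryLeft_apply]
  rw [h2]
  simp [Units.smul_def, mul_smul]

theorem alternatization_eq_zero_of_swap {n : ℕ} [IsDomain 𝕜] [CharZero 𝕜] [Module.IsTorsionFree 𝕜 M]
    (F : MultilinearMap 𝕜 (fun _ : Fin n => W) M) {i j : Fin n} (hij : i ≠ j)
    (h : ∀ v, F (v ∘ Equiv.swap i j) = F v) (v : Fin n → W) :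
    MultilinearMap.alternatization F v = 0 := by
  simp only [MultilinearMap.alternatization_apply]
  refine Finset.sum_involution (fun σ _ => σ * Equiv.swap i j) ?_ ?_ ?_ ?_
  · intro σ _
    have := h (fun k => v (σ k))
    simp only [MultilinearMap.domDomCongr_apply, Equiv.Perm.sign_mul, Equiv.Perm.sign_swap hij]
    simp only [Function.comp_def] at this
    simp [this]
  · intro σ _ _ h
    exact hij (by simpa [Equiv.swap_eq_refl_iff] using h)
  · simp
  · intro σ _
    simp [mul_assoc]

end Alternatization

namespace Bimod

section Symbol

variable {𝕜 : Type*} [CommRing 𝕜] {A : Type*} [CommRing A] [Algebra 𝕜 A]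
  {M : Type*} [AddCommGroup M] [Module 𝕜 M] {W : Type*} [AddCommGroup W] [Module 𝕜 W]
  (ι : W →ₗ[𝕜] A) (S : Bimod 𝕜 A M)

/-- The two parts of the frozen argument `ℓ - ℓ(x)`: the argument is `ℓ` with coefficient `1`, or it
is `1` with coefficient `-ℓ`. This is the coefficient. -/
def frozenCoeff (c : Bool) (ℓ : W) : A := if c then 1 else -ι ℓ

/-- The argument belonging to `frozenCoeff`. -/
def frozenArg (c : Bool) (ℓ : W) : A := if c then ι ℓ else 1

/-- `ξ(ℓ₁ - ℓ₁(x), …, ℓ_k - ℓ_k(x))`, where the frozen scalars `ℓ_j(x)` act from the left. -/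
def freeze {n : ℕ} (ξ : Cochain 𝕜 A M n) : MultilinearMap 𝕜 (fun _ : Fin n => W) M :=
  ∑ c : Fin n → Bool,
    { toFun ℓ := S.l (∏ j, frozenCoeff ι (c j) (ℓ j)) (ξ fun j => frozenArg ι (c j) (ℓ j))
      map_update_add' := by
        intro inst ℓ i x y
        obtain rfl := Subsingleton.elim inst (instDecidableEqFin _)
        simp only [fun z k => Function.apply_update (fun k => frozenCoeff ι (c k)) ℓ i z k,
          fun z k => Function.apply_update (fun k => frozenArg ι (c k)) ℓ i z k,
          Finset.prod_update_of_mem (Finset.mem_univ i)]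
        cases h : c i
        · simp [frozenCoeff, frozenArg, add_mul]
          abel
        · simp [frozenCoeff, frozenArg]
      map_update_smul' := by
        intro inst ℓ i r x
        obtain rfl := Subsingleton.elim inst (instDecidableEqFin _)
        simp only [fun z k => Function.apply_update (fun k => frozenCoeff ι (c k)) ℓ i z k,
          fun z k => Function.apply_update (fun k => frozenArg ι (c k)) ℓ i z k,
          Finset.prod_update_of_mem (Finset.mem_univ i)]
        cases h : c i
        · simp [frozenCoeff, frozenArg]
        · simp [frozenCoeff, frozenArg] }

theorem freeze_apply {n : ℕ} (ξ : Cochain 𝕜 A M n) (ℓ : Fin n → W) :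
    S.freeze ι ξ ℓ = ∑ c : Fin n → Bool,
      S.l (∏ j, frozenCoeff ι (c j) (ℓ j)) (ξ fun j => frozenArg ι (c j) (ℓ j)) := by
  simp [freeze]

/-- The antisymmetrization of `freeze`. -/
def symbol (n : ℕ) : Cochain 𝕜 A M n →ₗ[𝕜] W [⋀^Fin n]→ₗ[𝕜] M where
  toFun ξ := MultilinearMap.alternatization (S.freeze ι ξ)
  map_add' ξ η := by
    rw [← map_add]
    congr 1
    ext ℓ
    simp [freeze_apply, Finset.sum_add_distrib]
  map_smul' c ξ := by
    ext ℓ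
    simp [MultilinearMap.alternatization_apply, freeze_apply, Finset.smul_sum, smul_comm c]

theorem symbol_apply {n : ℕ} (ξ : Cochain 𝕜 A M n) (ℓ : Fin n → W) :
    S.symbol ι n ξ ℓ = ∑ σ : Equiv.Perm (Fin n), Equiv.Perm.sign σ •
      S.freeze ι ξ (fun j => ℓ (σ j)) := by
  simp [symbol, MultilinearMap.alternatization_apply]

/-- The commutators `m ↦ ℓ m - m ℓ`. -/
def ad : W →ₗ[𝕜] M →ₗ[𝕜] M := (S.l - S.r) ∘ₗ ι

theorem ad_apply (ℓ : W) (m : M) : S.ad ι ℓ m = S.l (ι ℓ) m - S.r (ι ℓ) m := rfl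

theorem ad_comm (ℓ ℓ' : W) (m : M) : S.ad ι ℓ (S.ad ι ℓ' m) = S.ad ι ℓ' (S.ad ι ℓ m) := by
  simp only [ad_apply, map_sub, ← S.l_mul, ← S.r_mul, mul_comm (ι ℓ), S.comm]
  abel

theorem freeze_map {M' : Type*} [AddCommGroup M'] [Module 𝕜 M'] (S' : Bimod 𝕜 A M')
    (t : M →ₗ[𝕜] M') (ht : ∀ a m, t (S.l a m) = S'.l a (t m)) {n : ℕ} (ξ : Cochain 𝕜 A M n)
    (ℓ : Fin n → W) : S'.freeze ι (t.compMultilinearMap ξ) ℓ = t (S.freeze ι ξ ℓ) := by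
  simp [freeze_apply, ht]

theorem symbol_map {M' : Type*} [AddCommGroup M'] [Module 𝕜 M'] (S' : Bimod 𝕜 A M')
    (t : M →ₗ[𝕜] M') (ht : ∀ a m, t (S.l a m) = S'.l a (t m)) {n : ℕ} (ξ : Cochain 𝕜 A M n) :
    S'.symbol ι n (t.compMultilinearMap ξ) = t.compAlternatingMap (S.symbol ι n ξ) := by
  ext ℓ
  simp only [symbol_apply, LinearMap.compAlternatingMap_apply, S.freeze_map ι S' t ht, map_sum]
  refine Finset.sum_congr rfl fun σ _ => ?_
  simp [Units.smul_def]

/-- Freezing the arguments of a coboundary: the first face cancels, the last face turns into a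
commutator. -/
theorem freeze_d {n : ℕ} (ξ : Cochain 𝕜 A M n) (ℓ : Fin (n + 1) → W) :
    S.freeze ι (S.d n ξ) ℓ =
      ∑ i : Fin n, (-1 : 𝕜) ^ ((i : ℕ) + 1) • S.freeze ι (midFace i ξ) ℓ +
      (-1 : 𝕜) ^ n • S.ad ι (ℓ (Fin.last n)) (S.freeze ι ξ (Fin.init ℓ)) := by
  -- In the first face both choices for the first argument give the product `ℓ_0`, with opposite
  -- signs.
  have h0 : ∑ c : Fin (n + 1) → Bool, S.l (∏ j, frozenCoeff ι (c j) (ℓ j))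
      (S.l (frozenArg ι (c 0) (ℓ 0)) (ξ (Fin.tail fun j => frozenArg ι (c j) (ℓ j)))) = 0 := by
    rw [← (Fin.consEquiv (fun _ => Bool)).sum_comp, Fintype.sum_prod_type, Fintype.sum_bool,
      ← Finset.sum_add_distrib]
    refine Finset.sum_eq_zero fun c _ => ?_
    have : ∀ b : Bool,
        (Fin.tail fun j => frozenArg ι ((Fin.consEquiv (fun _ => Bool)) (b, c) j) (ℓ j)) =
        fun j => frozenArg ι (c j) (ℓ j.succ) := by
      intro b; funext j; simp [Fin.tail, Fin.consEquiv]
    simp only [this, ← S.l_mul]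
    rw [← LinearMap.add_apply, ← map_add]
    simp [Fin.consEquiv, Fin.prod_univ_succ, frozenCoeff, frozenArg, mul_comm]
  -- In the last face the two choices for the last argument act from the right and from the left.
  have h1 : ∑ c : Fin (n + 1) → Bool, S.l (∏ j, frozenCoeff ι (c j) (ℓ j))
      (S.r (frozenArg ι (c (Fin.last n)) (ℓ (Fin.last n)))
        (ξ (Fin.init fun j => frozenArg ι (c j) (ℓ j)))) =
      -S.ad ι (ℓ (Fin.last n)) (S.freeze ι ξ (Fin.init ℓ)) := by
    rw [← (Fin.snocEquiv (fun _ => Bool)).sum_comp, Fintype.sum_prod_type, Fintype.sum_bool,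
      freeze_apply, map_sum, ← Finset.sum_neg_distrib, ← Finset.sum_add_distrib]
    refine Finset.sum_congr rfl fun c _ => ?_
    have : ∀ b : Bool,
        (Fin.init fun j => frozenArg ι ((Fin.snocEquiv (fun _ => Bool)) (b, c) j) (ℓ j)) =
        fun j => frozenArg ι (c j) (Fin.init ℓ j) := by
      intro b; funext j; simp [Fin.init, Fin.snocEquiv]
    simp only [this]
    simp [Fin.snocEquiv, Fin.prod_univ_castSucc, frozenCoeff, frozenArg, ad_apply, S.l_mul, S.r_one,
      Fin.init, S.comm, mul_comm]
    abel
  have h2 : ∀ i : Fin n, S.freeze ι (midFace i ξ) ℓ = ∑ c : Fin (n + 1) → Bool,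
      S.l (∏ j, frozenCoeff ι (c j) (ℓ j))
        (ξ (Fin.contractNth i.castSucc (· * ·) fun j => frozenArg ι (c j) (ℓ j))) :=
    fun i => freeze_apply _ _ _ _
  rw [freeze_apply]
  simp only [d_apply, map_add, map_sum, map_smul, Finset.sum_add_distrib, h0, h2, zero_add,
    ← Finset.smul_sum, h1]
  rw [Finset.sum_comm]
  simp only [Finset.smul_sum]
  congr 1
  simp [pow_succ]

/-- As `A` is commutative, an inner face is symmetric in the two arguments that it multiplies, also
after freezing. -/
theorem freeze_midFace_swap {n : ℕ} (ξ : Cochain 𝕜 A M n) (i : Fin n) (ℓ : Fin (n + 1) → W) :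
    S.freeze ι (midFace i ξ) (ℓ ∘ Equiv.swap i.castSucc i.succ) = S.freeze ι (midFace i ξ) ℓ := by
  rw [freeze_apply, freeze_apply]
  refine Fintype.sum_equiv (Equiv.arrowCongr (Equiv.swap i.castSucc i.succ) (Equiv.refl Bool)) _ _
    fun c => ?_
  have h1 : ∏ j, frozenCoeff ι (c j) ((ℓ ∘ Equiv.swap i.castSucc i.succ) j) =
      ∏ j, frozenCoeff ι (c (Equiv.swap i.castSucc i.succ j)) (ℓ j) := by
    refine Fintype.prod_equiv (Equiv.swap i.castSucc i.succ) _ _ fun j => ?_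
    simp
  have h2 : ∀ a : Fin (n + 1) → A, Fin.contractNth i.castSucc (· * ·)
      (fun j => a (Equiv.swap i.castSucc i.succ j)) = Fin.contractNth i.castSucc (· * ·) a := by
    intro a
    funext j
    simp only [Fin.contractNth, Fin.val_castSucc]
    split_ifs with h h'
    · rw [Equiv.swap_apply_of_ne_of_ne] <;> simp [Fin.ext_iff] <;> omega
    · obtain rfl : j = i := Fin.ext h'
      simp [mul_comm]
    · rw [Equiv.swap_apply_of_ne_of_ne] <;> simp [Fin.ext_iff] <;> omega
  have h3 := h2 (fun j => frozenArg ι (c (Equiv.swap i.castSucc i.succ j)) (ℓ j))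
  simp only [Equiv.swap_apply_self] at h3
  rw [h1]
  simp only [midFace, MultilinearMap.coe_mk, Function.comp_apply, h3, Equiv.arrowCongr_apply,
    Equiv.coe_refl, Equiv.symm_swap, id]

/-- The symbol is a morphism from the Hochschild complex to the Koszul complex: antisymmetrization
kills the inner faces, which are symmetric under a transposition. -/
theorem symbol_d [IsDomain 𝕜] [CharZero 𝕜] [Module.IsTorsionFree 𝕜 M] {n : ℕ}
    (ξ : Cochain 𝕜 A M n) :
    S.symbol ι (n + 1) (S.d n ξ) = koszulD (S.ad ι) n (S.symbol ι n ξ) := by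
  ext v
  -- The part that survives, with the argument of the commutator moved to the front.
  let F : MultilinearMap 𝕜 (fun _ : Fin (n + 1) => W) M := LinearMap.uncurryLeft
    { toFun b := (S.ad ι b).compMultilinearMap (S.freeze ι ξ)
      map_add' a b := by ext; simp
      map_smul' c a := by ext; simp }
  have h1 : ∀ ℓ : Fin (n + 1) → W, S.freeze ι (S.d n ξ) ℓ =
      (∑ i : Fin n, (-1 : 𝕜) ^ ((i : ℕ) + 1) • S.freeze ι (midFace i ξ)) ℓ +
      (-1 : 𝕜) ^ n • F (ℓ ∘ (finRotate (n + 1)).symm) := by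
    intro ℓ
    have h2 : (finRotate (n + 1)).symm 0 = Fin.last n := by
      rw [Equiv.symm_apply_eq, finRotate_last]
    have h3 : ∀ k : Fin n, (finRotate (n + 1)).symm k.succ = k.castSucc := fun k => by
      rw [Equiv.symm_apply_eq, finRotate_apply, Fin.coeSucc_eq_succ]
    rw [freeze_d, _root_.sum_apply]
    simp [F, Fin.tail_def, Fin.init_def, h2, h3]
  have h2 : MultilinearMap.alternatization
      (∑ i : Fin n, (-1 : 𝕜) ^ ((i : ℕ) + 1) • S.freeze ι (midFace i ξ)) v = 0 := by
    rw [map_sum, Finset.sum_eq_zero, AlternatingMap.zero_apply]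
    intro i _
    ext v
    refine alternatization_eq_zero_of_swap _ (Fin.castSucc_lt_succ (i := i)).ne (fun v => ?_) v
    simp only [_root_.smul_apply, freeze_midFace_swap]
  calc S.symbol ι (n + 1) (S.d n ξ) v
      = MultilinearMap.alternatization
          (∑ i : Fin n, (-1 : 𝕜) ^ ((i : ℕ) + 1) • S.freeze ι (midFace i ξ)) v +
        ∑ σ : Equiv.Perm (Fin (n + 1)), Equiv.Perm.sign σ • (-1 : 𝕜) ^ n •
          F ((v ∘ σ) ∘ (finRotate (n + 1)).symm) := by
        rw [symbol_apply, MultilinearMap.alternatization_apply, ← Finset.sum_add_distrib]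
        refine Finset.sum_congr rfl fun σ _ => ?_
        rw [h1, smul_add]
        rfl
    _ = MultilinearMap.alternatization F v := by
        rw [h2, zero_add, MultilinearMap.alternatization_apply]
        refine Fintype.sum_equiv (Equiv.mulRight (finRotate (n + 1)).symm) _ _ fun σ => ?_
        rcases Nat.even_or_odd n with hn | hn
        · simp [Equiv.Perm.sign_mul, hn.neg_one_pow, sign_finRotate, Function.comp_def]
        · simp [Equiv.Perm.sign_mul, hn.neg_one_pow, sign_finRotate, Function.comp_def]
    _ = koszulD (S.ad ι) n (S.symbol ι n ξ) v := by
        rw [alternatization_curryLeft, koszulD_apply]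
        refine Finset.sum_congr rfl fun i _ => ?_
        simp only [F, MultilinearMap.alternatization_apply, symbol_apply, map_sum]
        congr 1
        refine Finset.sum_congr rfl fun σ _ => ?_
        simp [Units.smul_def]

end Symbol
end Bimod

/-! ### Division of polynomial functions by linear functionals -/

section Division

variable {𝕜 : Type*} [Field 𝕜] [CharZero 𝕜] {V : Type*} [AddCommGroup V] [Module 𝕜 V]

/-- If two algebra homomorphisms out of `Poly 𝕜 V` agree modulo `d` on linear functionals, then the
quotient of their difference by `d` is a linear map. -/
theorem exists_linear_quotient {R : Type*} [CommRing R] [IsDomain R] [Algebra 𝕜 R]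
    (F F' : Poly 𝕜 V →ₐ[𝕜] R) (d : R) (hd : d ≠ 0)
    (h : ∀ ℓ, d ∣ F (Poly.lin 𝕜 ℓ) - F' (Poly.lin 𝕜 ℓ)) :
    ∃ q : Poly 𝕜 V →ₗ[𝕜] R, ∀ f, d * q f = F f - F' f := by
  choose q hq using fun f => dvd_sub_of_dvd_lin F F' d h f
  refine ⟨{ toFun := q, map_add' := fun f f' => ?_, map_smul' := fun c f => ?_ },
    fun f => (hq f).symm⟩
  · apply mul_left_cancel₀ hd
    rw [mul_add, ← hq, ← hq, ← hq, map_add, map_add]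
    ring
  · apply mul_left_cancel₀ hd
    rw [RingHom.id_apply, mul_smul_comm, ← hq, ← hq, map_smul, map_smul, smul_sub]

/-- The pull back along the projection with kernel `𝕜 e` onto the zeros of `u`, for `u(e) = 1`. -/
def restrictZero (u : Module.Dual 𝕜 V) (e : V) : Poly 𝕜 V →ₐ[𝕜] Poly 𝕜 V :=
  Poly.comap (LinearMap.id - u.smulRight e)

theorem restrictZero_lin (u : Module.Dual 𝕜 V) (e : V) (ℓ : Module.Dual 𝕜 V) :
    restrictZero u e (Poly.lin 𝕜 ℓ) = Poly.lin 𝕜 ℓ - ℓ e • Poly.lin 𝕜 u := by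
  rw [restrictZero, Poly.comap_lin, ← map_smul, ← map_sub]
  congr 1
  ext v
  simp [mul_comm]

theorem lin_ne_zero_of_ne_zero {u : Module.Dual 𝕜 V} (hu : u ≠ 0) : Poly.lin 𝕜 u ≠ 0 := fun h =>
  hu (Poly.lin_injective (by simpa using h))

/-- Division with remainder by a linear functional `u`. -/
theorem exists_division (u : Module.Dual 𝕜 V) (e : V) (hu : u e = 1) :
    ∃ q : Poly 𝕜 V →ₗ[𝕜] Poly 𝕜 V, (∀ f, Poly.lin 𝕜 u * q f = f - restrictZero u e f) ∧
      (∀ f, q (Poly.lin 𝕜 u * f) = f) ∧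
      ∀ ℓ f, ℓ e = 0 → q (Poly.lin 𝕜 ℓ * f) = Poly.lin 𝕜 ℓ * q f := by
  have hu0 : Poly.lin 𝕜 u ≠ 0 := lin_ne_zero_of_ne_zero (by rintro rfl; simp at hu)
  obtain ⟨q, hq⟩ := exists_linear_quotient (AlgHom.id 𝕜 _) (restrictZero u e) (Poly.lin 𝕜 u) hu0
    (fun ℓ => by
      rw [restrictZero_lin, AlgHom.id_apply, sub_sub_cancel]
      exact Dvd.intro_left _ (smul_one_mul _ _))
  simp only [AlgHom.id_apply] at hq
  refine ⟨q, hq, fun f => ?_, fun ℓ f hℓ => ?_⟩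
  · apply mul_left_cancel₀ hu0
    rw [hq, map_mul, restrictZero_lin, hu]
    simp
  · apply mul_left_cancel₀ hu0
    rw [hq, map_mul, restrictZero_lin, hℓ, mul_left_comm, hq]
    simp [mul_sub]

/-- The divided difference in the direction `e`, for `u(e) = 1`: replace `u` in `f` by a new
variable `X`, subtract `f`, and divide by `X - u`. -/
theorem exists_dividedDifference (u : Module.Dual 𝕜 V) (e : V) (hu : u e = 1) :
    ∃ q : Poly 𝕜 V →ₗ[𝕜] Polynomial (Poly 𝕜 V),
      (∀ f, q (Poly.lin 𝕜 u * f) = Polynomial.X * q f + Polynomial.C f) ∧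
      ∀ ℓ f, ℓ e = 0 → q (Poly.lin 𝕜 ℓ * f) = Polynomial.C (Poly.lin 𝕜 ℓ) * q f := by
  let F : Poly 𝕜 V →ₐ[𝕜] Polynomial (Poly 𝕜 V) := Poly.lift
    (Polynomial.CAlgHom.toLinearMap ∘ₗ Poly.lin 𝕜 +
      (Module.Dual.eval 𝕜 V e).smulRight (Polynomial.X - Polynomial.C (Poly.lin 𝕜 u)))
  have hF : ∀ ℓ, F (Poly.lin 𝕜 ℓ) = Polynomial.C (Poly.lin 𝕜 ℓ) +
      ℓ e • (Polynomial.X - Polynomial.C (Poly.lin 𝕜 u)) := fun ℓ => by simp [F]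
  have hd : (Polynomial.X - Polynomial.C (Poly.lin 𝕜 u)) ≠ 0 := Polynomial.X_sub_C_ne_zero _
  obtain ⟨q, hq⟩ := exists_linear_quotient F Polynomial.CAlgHom _ hd (fun ℓ => by
      rw [hF, Polynomial.CAlgHom_apply, add_sub_cancel_left]
      exact Dvd.intro_left _ (smul_one_mul _ _))
  simp only [Polynomial.CAlgHom_apply] at hq
  refine ⟨q, fun f => ?_, fun ℓ f hℓ => ?_⟩
  · apply mul_left_cancel₀ hd
    rw [hq, map_mul, hF, hu, mul_add, mul_left_comm, hq, map_mul]
    simp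
    ring
  · apply mul_left_cancel₀ hd
    rw [hq, map_mul, hF, hℓ, mul_left_comm, hq, map_mul]
    simp [mul_sub]

/-- Evaluation `∑ X^n a_n ↦ ∑ T^n φ(a_n)` of polynomials by an operator `T`. -/
def evalOperator {A M : Type*} [CommRing A] [Algebra 𝕜 A] [AddCommGroup M] [Module 𝕜 M]
    (T : Module.End 𝕜 M) : (A →ₗ[𝕜] M) →ₗ[𝕜] Polynomial A →ₗ[𝕜] M where
  toFun φ := Polynomial.lsum fun n => (T ^ n) ∘ₗ φ
  map_add' φ ψ := by
    ext p; simp [Polynomial.lsum_apply, Polynomial.sum_def, Finset.sum_add_distrib]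
  map_smul' c φ := by
    ext p; simp [Polynomial.lsum_apply, Polynomial.sum_def, Finset.smul_sum]

section

variable {A M : Type*} [CommRing A] [Algebra 𝕜 A] [AddCommGroup M] [Module 𝕜 M]
  (T : Module.End 𝕜 M) (φ : A →ₗ[𝕜] M)

theorem evalOperator_monomial (n : ℕ) (a : A) :
    evalOperator T φ (Polynomial.monomial n a) = (T ^ n) (φ a) := by
  simp [evalOperator, Polynomial.lsum_apply, Polynomial.sum_monomial_index]

theorem evalOperator_C (a : A) : evalOperator T φ (Polynomial.C a) = φ a := by
  rw [← Polynomial.monomial_zero_left, evalOperator_monomial]; simp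

theorem evalOperator_X_mul (p : Polynomial A) :
    evalOperator T φ (Polynomial.X * p) = T (evalOperator T φ p) := by
  induction p using Polynomial.induction_on' with
  | add p q hp hq => simp [mul_add, hp, hq]
  | monomial n a =>
    rw [Polynomial.X_mul_monomial, evalOperator_monomial, evalOperator_monomial, pow_succ']
    rfl

theorem evalOperator_C_mul (b : A) (p : Polynomial A) :
    evalOperator T φ (Polynomial.C b * p) = evalOperator T (φ ∘ₗ LinearMap.mulLeft 𝕜 b) p := by
  induction p using Polynomial.induction_on' with
  | add p q hp hq => simp [mul_add, hp, hq]
  | monomial n a => simp [Polynomial.C_mul_monomial, evalOperator_monomial]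

theorem evalOperator_comp (T' : Module.End 𝕜 M) (h : ∀ m, T' (T m) = T (T' m)) (p : Polynomial A) :
    evalOperator T (T' ∘ₗ φ) p = T' (evalOperator T φ p) := by
  induction p using Polynomial.induction_on' with
  | add p q hp hq => simp [hp, hq]
  | monomial n a =>
    simp only [evalOperator_monomial, LinearMap.comp_apply]
    have : Commute T' (T ^ n) := Commute.pow_right (LinearMap.ext h) n
    exact (LinearMap.congr_fun this.eq (φ a)).symm

end

end Division

/-! ### Koszul complexes of coinduced bimodules -/

section Coinduced

variable {𝕜 : Type*} [Field 𝕜] [CharZero 𝕜] {V : Type*} [AddCommGroup V] [Module 𝕜 V]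
  {G : Type*} [Group G] [Fintype G] [DistribMulAction G V] [SMulCommClass G 𝕜 V]

variable (𝕜 V G) in
/-- The inclusion `a ↦ a U_1` of `Poly(V)` into the crossed product. -/
def ofPoly : Poly 𝕜 V →ₐ[𝕜] Crossed 𝕜 V G where
  toFun := SkewMonoidAlgebra.single 1
  map_one' := rfl
  map_mul' a b := by simp [SkewMonoidAlgebra.single_mul_single]
  map_zero' := by simp
  map_add' a b := SkewMonoidAlgebra.single_add _ _ _
  commutes' r := by
    rw [Algebra.algebraMap_eq_smul_one, Algebra.algebraMap_eq_smul_one,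
      SkewMonoidAlgebra.one_def, SkewMonoidAlgebra.smul_single]

theorem ofPoly_apply (a : Poly 𝕜 V) : ofPoly 𝕜 V G a = SkewMonoidAlgebra.single 1 a := rfl

theorem coeffAt_ofPoly_mul (g : G) (a : Poly 𝕜 V) (b : Crossed 𝕜 V G) :
    coeffAt 𝕜 V g (ofPoly 𝕜 V G a * b) = a * coeffAt 𝕜 V g b :=
  SkewMonoidAlgebra.coeff_single_one_mul b a g

theorem crossed_eq_sum (b : Crossed 𝕜 V G) :
    b = ∑ g, SkewMonoidAlgebra.single g (coeffAt 𝕜 V g b) := by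
  classical
  refine SkewMonoidAlgebra.ext fun h => ?_
  have : ∀ (s : Finset G), (∑ g ∈ s, SkewMonoidAlgebra.single g (coeffAt 𝕜 V g b)).coeff h =
      ∑ g ∈ s, (SkewMonoidAlgebra.single g (coeffAt 𝕜 V g b)).coeff h := fun s =>
    map_sum (coeffAt 𝕜 V h) _ s
  rw [this, Finset.sum_eq_single h]
  · simp [coeffAt]
  · intro g _ hg
    simp [hg]
  · simp

/-- `φ ↦ (∑ a_g U_g ↦ -∑_g E_g(q(a_g)))`, where `E_g` evaluates polynomials with coefficients in
`Poly(V)` by `a X^n ↦ T^n φ(a U_g)`. -/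
def coindInverse {M : Type*} [AddCommGroup M] [Module 𝕜 M] (T : Module.End 𝕜 M)
    (q : Poly 𝕜 V →ₗ[𝕜] Polynomial (Poly 𝕜 V)) :
    (Crossed 𝕜 V G →ₗ[𝕜] M) →ₗ[𝕜] (Crossed 𝕜 V G →ₗ[𝕜] M) :=
  -∑ g : G, LinearMap.lcomp 𝕜 M (q ∘ₗ coeffAt 𝕜 V g) ∘ₗ evalOperator T ∘ₗ
    LinearMap.lcomp 𝕜 M (SkewMonoidAlgebra.lsingle 𝕜 g)

theorem coindInverse_apply {M : Type*} [AddCommGroup M] [Module 𝕜 M] (T : Module.End 𝕜 M)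
    (q : Poly 𝕜 V →ₗ[𝕜] Polynomial (Poly 𝕜 V)) (φ : Crossed 𝕜 V G →ₗ[𝕜] M) (b : Crossed 𝕜 V G) :
    coindInverse T q φ b = -∑ g : G, evalOperator T (φ ∘ₗ SkewMonoidAlgebra.lsingle 𝕜 g)
      (q (coeffAt 𝕜 V g b)) := by
  simp only [coindInverse, LinearMap.neg_apply, LinearMap.sum_apply]
  rfl

theorem ad_coind_apply {M : Type*} [AddCommGroup M] [Module 𝕜 M] (S : Bimod 𝕜 (Crossed 𝕜 V G) M)
    (ℓ : Module.Dual 𝕜 V) (φ : Crossed 𝕜 V G →ₗ[𝕜] M) (b : Crossed 𝕜 V G) :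
    (S.coind.restrict (ofPoly 𝕜 V G)).ad (Poly.lin 𝕜) ℓ φ b =
      S.l (ofPoly 𝕜 V G (Poly.lin 𝕜 ℓ)) (φ b) - φ (ofPoly 𝕜 V G (Poly.lin 𝕜 ℓ) * b) := rfl

/-- For the divided difference `q` in the direction dual to `u`, the operator `coindInverse` is a
right inverse of the commutator with `u`. -/
theorem ad_coind_coindInverse {M : Type*} [AddCommGroup M] [Module 𝕜 M]
    (S : Bimod 𝕜 (Crossed 𝕜 V G) M) (u : Module.Dual 𝕜 V)
    (q : Poly 𝕜 V →ₗ[𝕜] Polynomial (Poly 𝕜 V))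
    (hq : ∀ f, q (Poly.lin 𝕜 u * f) = Polynomial.X * q f + Polynomial.C f)
    (φ : Crossed 𝕜 V G →ₗ[𝕜] M) :
    (S.coind.restrict (ofPoly 𝕜 V G)).ad (Poly.lin 𝕜) u
      (coindInverse (S.l (ofPoly 𝕜 V G (Poly.lin 𝕜 u))) q φ) = φ := by
  refine LinearMap.ext fun b => ?_
  rw [ad_coind_apply, coindInverse_apply, coindInverse_apply]
  simp only [coeffAt_ofPoly_mul, hq, map_add, map_neg, map_sum,
    evalOperator_X_mul, evalOperator_C, Finset.sum_add_distrib]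
  rw [neg_sub_neg, add_sub_cancel_left]
  conv_rhs => rw [crossed_eq_sum b, map_sum]
  rfl

theorem ad_coind_coindInverse_comm {M : Type*} [AddCommGroup M] [Module 𝕜 M]
    (S : Bimod 𝕜 (Crossed 𝕜 V G) M) (u w : Module.Dual 𝕜 V)
    (q : Poly 𝕜 V →ₗ[𝕜] Polynomial (Poly 𝕜 V))
    (hq : ∀ f, q (Poly.lin 𝕜 w * f) = Polynomial.C (Poly.lin 𝕜 w) * q f)
    (φ : Crossed 𝕜 V G →ₗ[𝕜] M) :
    (S.coind.restrict (ofPoly 𝕜 V G)).ad (Poly.lin 𝕜) w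
      (coindInverse (S.l (ofPoly 𝕜 V G (Poly.lin 𝕜 u))) q φ) =
    coindInverse (S.l (ofPoly 𝕜 V G (Poly.lin 𝕜 u))) q
      ((S.coind.restrict (ofPoly 𝕜 V G)).ad (Poly.lin 𝕜) w φ) := by
  have hT : ∀ m, S.l (ofPoly 𝕜 V G (Poly.lin 𝕜 w)) (S.l (ofPoly 𝕜 V G (Poly.lin 𝕜 u)) m) =
      S.l (ofPoly 𝕜 V G (Poly.lin 𝕜 u)) (S.l (ofPoly 𝕜 V G (Poly.lin 𝕜 w)) m) := fun m => by
    simp only [← S.l_mul, ← map_mul, mul_comm (Poly.lin 𝕜 u)]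
  have h1 : ∀ g : G, ((S.coind.restrict (ofPoly 𝕜 V G)).ad (Poly.lin 𝕜) w φ) ∘ₗ
      SkewMonoidAlgebra.lsingle 𝕜 g = S.l (ofPoly 𝕜 V G (Poly.lin 𝕜 w)) ∘ₗ φ ∘ₗ
        SkewMonoidAlgebra.lsingle 𝕜 g -
        (φ ∘ₗ SkewMonoidAlgebra.lsingle 𝕜 g) ∘ₗ LinearMap.mulLeft 𝕜 (Poly.lin 𝕜 w) := by
    intro g
    refine LinearMap.ext fun a => ?_
    rw [LinearMap.comp_apply, ad_coind_apply]
    simp only [LinearMap.comp_apply, LinearMap.sub_apply, LinearMap.mulLeft_apply, ofPoly_apply]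
    congr 2
    exact (SkewMonoidAlgebra.single_mul_single).trans (by simp; rfl)
  refine LinearMap.ext fun b => ?_
  rw [ad_coind_apply, coindInverse_apply, coindInverse_apply, coindInverse_apply]
  simp only [h1, coeffAt_ofPoly_mul, hq, evalOperator_C_mul, map_sub, LinearMap.sub_apply,
    fun φ p => evalOperator_comp (S.l (ofPoly 𝕜 V G (Poly.lin 𝕜 u))) φ _ hT p, map_neg, map_sum,
    Finset.sum_sub_distrib, neg_sub]
  abel

/-- The Koszul complex of a coinduced bimodule over the crossed product is acyclic in positive
degrees: divided differences provide right inverses of the commutators. -/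
theorem exists_koszulD_eq_coind {M : Type*} [AddCommGroup M] [Module 𝕜 M]
    (S : Bimod 𝕜 (Crossed 𝕜 V G) M) {r : ℕ} (x : Module.Basis (Fin r) 𝕜 V) {n : ℕ}
    (ω : Module.Dual 𝕜 V [⋀^Fin (n + 1)]→ₗ[𝕜] (Crossed 𝕜 V G →ₗ[𝕜] M))
    (hω : koszulD ((S.coind.restrict (ofPoly 𝕜 V G)).ad (Poly.lin 𝕜)) (n + 1) ω = 0) :
    ∃ θ, ω = koszulD ((S.coind.restrict (ofPoly 𝕜 V G)).ad (Poly.lin 𝕜)) n θ := by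
  choose q hq hq' using fun i => exists_dividedDifference (x.coord i) (x i) (by simp)
  refine exists_koszulD_eq_of_rightInverse _ (Bimod.ad_comm _ _) x.dualBasis
    (fun i => coindInverse (S.l (ofPoly 𝕜 V G (Poly.lin 𝕜 (x.coord i)))) (q i)) ?_ ?_ ω hω
  · intro i φ
    rw [Module.Basis.coe_dualBasis]
    exact ad_coind_coindInverse S _ _ (hq i) φ
  · intro i j φ hji
    rw [Module.Basis.coe_dualBasis]
    exact ad_coind_coindInverse_comm S _ _ _ (fun f => hq' i _ f (by simp [hji.symm])) φ

end Coinduced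

/-! ### Cohomology of the crossed product is detected by symbols -/

namespace Bimod

section Averaging

variable {𝕜 : Type*} [Field 𝕜] [CharZero 𝕜] {V : Type*} [AddCommGroup V] [Module 𝕜 V]
  {G : Type*} [Group G] [Fintype G] [DistribMulAction G V] [SMulCommClass G 𝕜 V]
  {M : Type*} [AddCommGroup M] [Module 𝕜 M] (S : Bimod 𝕜 (Crossed 𝕜 V G) M)

theorem U_mul_ofPoly (h : G) (a : Poly 𝕜 V) :
    U 𝕜 V h * ofPoly 𝕜 V G a = ofPoly 𝕜 V G (h • a) * U 𝕜 V h := by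
  simp [U, ofPoly_apply, SkewMonoidAlgebra.single_mul_single]

/-- The conjugation `m ↦ U_{h⁻¹} m U_h`. -/
def conjU (h : G) : M →ₗ[𝕜] M := S.r (U 𝕜 V h) ∘ₗ S.l (U 𝕜 V h⁻¹)

theorem conjU_apply (h : G) (m : M) : S.conjU h m = S.r (U 𝕜 V h) (S.l (U 𝕜 V h⁻¹) m) := rfl

/-- The action of `h` on `Poly(V)`, followed by the inclusion into the crossed product. -/
def ofPolySmul (h : G) : Poly 𝕜 V →ₐ[𝕜] Crossed 𝕜 V G :=
  (ofPoly 𝕜 V G).comp (MulSemiringAction.toAlgHom 𝕜 (Poly 𝕜 V) h)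

theorem ofPolySmul_apply (h : G) (a : Poly 𝕜 V) : ofPolySmul h a = ofPoly 𝕜 V G (h • a) := rfl

theorem conjU_l (h : G) (a : Poly 𝕜 V) (m : M) :
    S.conjU h (S.l (ofPolySmul h a) m) = S.l (ofPoly 𝕜 V G a) (S.conjU h m) := by
  rw [conjU_apply, conjU_apply, ← S.l_mul, S.comm, ← S.l_mul, ofPolySmul_apply, U_mul_ofPoly,
    inv_smul_smul]

theorem conjU_r (h : G) (a : Poly 𝕜 V) (m : M) :
    S.conjU h (S.r (ofPolySmul h a) m) = S.r (ofPoly 𝕜 V G a) (S.conjU h m) := by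
  rw [conjU_apply, conjU_apply, S.comm, ← S.r_mul, ← S.r_mul, ofPolySmul_apply, U_mul_ofPoly]

/-- The restriction of a cochain to `Poly(V)`, averaged over `G`. -/
def avgRes (n : ℕ) : Cochain 𝕜 (Crossed 𝕜 V G) M n →ₗ[𝕜] Cochain 𝕜 (Poly 𝕜 V) M n :=
  (Fintype.card G : 𝕜)⁻¹ • ∑ h : G, transport (ofPolySmul h) (S.conjU h) n

theorem avgRes_apply {n : ℕ} (ξ : Cochain 𝕜 (Crossed 𝕜 V G) M n) (a : Fin n → Poly 𝕜 V) :
    S.avgRes n ξ a = (Fintype.card G : 𝕜)⁻¹ • ∑ h : G,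
      S.conjU h (ξ fun j => ofPoly 𝕜 V G (h • a j)) := by
  simp [avgRes, LinearMap.sum_apply, _root_.sum_apply, ofPolySmul_apply]

theorem d_avgRes {n : ℕ} (ξ : Cochain 𝕜 (Crossed 𝕜 V G) M n) :
    (S.restrict (ofPoly 𝕜 V G)).d n (S.avgRes n ξ) = S.avgRes (n + 1) (S.d n ξ) := by
  simp only [avgRes, LinearMap.smul_apply, LinearMap.sum_apply, map_smul, map_sum]
  congr 1
  refine Finset.sum_congr rfl fun h _ => ?_
  exact S.d_transport _ _ _ (S.conjU_l h) (S.conjU_r h) ξ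

theorem avgRes_map {M' : Type*} [AddCommGroup M'] [Module 𝕜 M'] (S' : Bimod 𝕜 (Crossed 𝕜 V G) M')
    (t : M →ₗ[𝕜] M') (hl : ∀ a m, t (S.l a m) = S'.l a (t m))
    (hr : ∀ a m, t (S.r a m) = S'.r a (t m)) {n : ℕ} (ξ : Cochain 𝕜 (Crossed 𝕜 V G) M n) :
    S'.avgRes n (t.compMultilinearMap ξ) = t.compMultilinearMap (S.avgRes n ξ) := by
  ext a
  simp [avgRes_apply, conjU_apply, hl, hr]

/-- The symbol of the averaged restriction to `Poly(V)`. -/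
def avgSymbol (n : ℕ) :
    Cochain 𝕜 (Crossed 𝕜 V G) M n →ₗ[𝕜] Module.Dual 𝕜 V [⋀^Fin n]→ₗ[𝕜] M :=
  (S.restrict (ofPoly 𝕜 V G)).symbol (Poly.lin 𝕜) n ∘ₗ S.avgRes n

/-- The commutators with linear functionals. -/
abbrev adPoly : Module.Dual 𝕜 V →ₗ[𝕜] M →ₗ[𝕜] M := (S.restrict (ofPoly 𝕜 V G)).ad (Poly.lin 𝕜)

theorem avgSymbol_d {n : ℕ} (ξ : Cochain 𝕜 (Crossed 𝕜 V G) M n) :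
    S.avgSymbol (n + 1) (S.d n ξ) = koszulD S.adPoly n (S.avgSymbol n ξ) := by
  simp only [avgSymbol, LinearMap.comp_apply, ← d_avgRes, symbol_d]

theorem avgSymbol_map {M' : Type*} [AddCommGroup M'] [Module 𝕜 M']
    (S' : Bimod 𝕜 (Crossed 𝕜 V G) M') (t : M →ₗ[𝕜] M') (hl : ∀ a m, t (S.l a m) = S'.l a (t m))
    (hr : ∀ a m, t (S.r a m) = S'.r a (t m)) {n : ℕ} (ξ : Cochain 𝕜 (Crossed 𝕜 V G) M n) :
    S'.avgSymbol n (t.compMultilinearMap ξ) = t.compAlternatingMap (S.avgSymbol n ξ) := by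
  rw [avgSymbol, LinearMap.comp_apply, S.avgRes_map S' t hl hr]
  exact (S.restrict (ofPoly 𝕜 V G)).symbol_map _ _ t (fun a m => hl _ m) _

theorem adPoly_map {M' : Type*} [AddCommGroup M'] [Module 𝕜 M'] (S' : Bimod 𝕜 (Crossed 𝕜 V G) M')
    (t : M →ₗ[𝕜] M') (hl : ∀ a m, t (S.l a m) = S'.l a (t m))
    (hr : ∀ a m, t (S.r a m) = S'.r a (t m)) (ℓ : Module.Dual 𝕜 V) (m : M) :
    t (S.adPoly ℓ m) = S'.adPoly ℓ (t m) := by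
  simp [ad_apply, hl, hr]

theorem avgSymbol_zero_apply (ξ : Cochain 𝕜 (Crossed 𝕜 V G) M 0) (ℓ : Fin 0 → Module.Dual 𝕜 V) :
    S.avgSymbol 0 ξ ℓ = (Fintype.card G : 𝕜)⁻¹ • ∑ h : G, S.conjU h (ξ default) := by
  simp only [avgSymbol, LinearMap.comp_apply, symbol_apply, freeze_apply, avgRes_apply,
    Finset.univ_unique, Finset.sum_singleton, Finset.univ_eq_empty, Finset.prod_empty]
  rw [(S.restrict (ofPoly 𝕜 V G)).l_one, Equiv.Perm.default_eq, Equiv.Perm.sign_one, one_smul]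
  refine congrArg _ (Finset.sum_congr rfl fun h _ => ?_)
  congr 2
  exact Subsingleton.elim _ _

theorem conjU_of_central (m : M) (hm : ∀ b, S.l b m = S.r b m) (h : G) : S.conjU h m = m := by
  rw [conjU_apply, hm, ← S.r_mul, U_mul_U, inv_mul_cancel]
  exact S.r_one m

theorem central_of_adPoly_eq_zero (m : M) (hm : ∀ ℓ, S.adPoly ℓ m = 0) (a : Poly 𝕜 V) :
    S.l (ofPoly 𝕜 V G a) m = S.r (ofPoly 𝕜 V G a) m := by
  induction a using Poly.induction with
  | hC r => simp [Algebra.algebraMap_eq_smul_one, S.l_one, S.r_one]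
  | hl ℓ => exact sub_eq_zero.1 (hm ℓ)
  | hm a b ha hb =>
    rw [map_mul, S.l_mul, hb, S.comm, ha, ← S.r_mul]
  | ha a b ha hb => simp [ha, hb]

/-- The average over `G` of an element that commutes with `Poly(V)` commutes with the crossed
product. -/
theorem central_average (m : M) (hm : ∀ a, S.l (ofPoly 𝕜 V G a) m = S.r (ofPoly 𝕜 V G a) m)
    (b : Crossed 𝕜 V G) :
    S.l b ((Fintype.card G : 𝕜)⁻¹ • ∑ h : G, S.conjU h m) =
      S.r b ((Fintype.card G : 𝕜)⁻¹ • ∑ h : G, S.conjU h m) := by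
  set m' := (Fintype.card G : 𝕜)⁻¹ • ∑ h : G, S.conjU h m with hm'
  have h1 : ∀ a, S.l (ofPoly 𝕜 V G a) m' = S.r (ofPoly 𝕜 V G a) m' := by
    intro a
    simp only [hm', map_smul, map_sum, ← conjU_l, ← conjU_r, ofPolySmul_apply, hm]
  have h2 : ∀ g : G, S.l (U 𝕜 V g) m' = S.r (U 𝕜 V g) m' := by
    intro g
    simp only [hm', map_smul, map_sum]
    congr 1
    refine Fintype.sum_equiv (Equiv.mulRight g⁻¹) _ _ fun h => ?_
    rw [conjU_apply, conjU_apply, S.comm, ← S.l_mul, ← S.r_mul, U_mul_U, U_mul_U]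
    simp
  have h3 : ∀ g a, (SkewMonoidAlgebra.single g a : Crossed 𝕜 V G) = ofPoly 𝕜 V G a * U 𝕜 V g := by
    intro g a
    simp [U, ofPoly_apply, SkewMonoidAlgebra.single_mul_single]
  rw [crossed_eq_sum b]
  simp only [map_sum, LinearMap.sum_apply]
  refine Finset.sum_congr rfl fun g _ => ?_
  rw [h3, S.l_mul, S.r_mul, h2, S.comm, h1]

theorem average_const {F : G → M →ₗ[𝕜] M} {m : M} (h : ∀ g, F g m = m) :
    (Fintype.card G : 𝕜)⁻¹ • ∑ g : G, F g m = m := by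
  have : (Fintype.card G : 𝕜) ≠ 0 := by simp
  simp only [h, Finset.sum_const, Finset.card_univ]
  rw [← Nat.cast_smul_eq_nsmul 𝕜, smul_smul, inv_mul_cancel₀ this, one_smul]

end Averaging

section Main

universe u v w z

variable {𝕜 : Type u} [Field 𝕜] [CharZero 𝕜] {V : Type v} [AddCommGroup V] [Module 𝕜 V]
  {G : Type w} [Group G] [Fintype G] [DistribMulAction G V] [SMulCommClass G 𝕜 V]

/-- Dimension shifting: move the last argument of a cocycle `ξ` into the coefficients `Hom(B, M)`.
If the result agrees modulo `M` with a cocycle `Θ`, then `ξ` is a coboundary, as the difference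
takes values in `M`. -/
theorem exists_d_of_toQuot_curryRight {B M : Type z} [Ring B] [Algebra 𝕜 B] [AddCommGroup M]
    [Module 𝕜 M] (S : Bimod 𝕜 B M) {n : ℕ} (ξ : Cochain 𝕜 B M (n + 1)) (hξ : S.d (n + 1) ξ = 0)
    (Θ : Cochain 𝕜 B (B →ₗ[𝕜] M) n) (hΘ : S.coind.d n Θ = 0)
    (h : S.toQuot.compMultilinearMap ξ.curryRight = S.toQuot.compMultilinearMap Θ) :
    ∃ χ, ξ = S.d n χ := by
  let χ : Cochain 𝕜 B M n := (LinearMap.applyₗ (1 : B)).compMultilinearMap (ξ.curryRight - Θ)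
  have h1 : ξ.curryRight - Θ = S.toCoind.compMultilinearMap χ := by
    ext1 a
    refine S.eq_toCoind_of_toQuot_eq_zero ?_
    have := congrArg (fun F => F a) h
    simpa [sub_eq_zero] using this
  have h2 := S.d_curryRight ξ
  rw [hξ] at h2
  have h3 : S.toCoind.compMultilinearMap (S.d n χ) =
      (-1 : 𝕜) ^ (n + 1) • S.toCoind.compMultilinearMap ξ := by
    rw [← S.d_comp S.toCoind S.coind S.toCoind_l S.toCoind_r, ← h1, map_sub, hΘ, h2]
    ext
    simp
  refine ⟨(-1 : 𝕜) ^ (n + 1) • χ, ?_⟩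
  ext a
  apply S.toCoind_injective
  have h4 := congrArg (fun F => F a) h3
  simp only [LinearMap.compMultilinearMap_apply, _root_.smul_apply] at h4
  rw [map_smul, _root_.smul_apply, map_smul, h4, smul_smul, ← mul_pow]
  simp

/-- If the symbol of the averaged restriction of a cocycle is exact, then the cocycle is exact. The
proof is by dimension shifting along `0 → M → Hom(B, M) → Hom(B, M) / M → 0`: the middle term has no
higher cohomology on either side. -/
theorem exists_d_of_avgSymbol_eq {r : ℕ} (x : Module.Basis (Fin r) 𝕜 V) (n : ℕ)
    {M : Type (max u v w)} [AddCommGroup M] [Module 𝕜 M] (S : Bimod 𝕜 (Crossed 𝕜 V G) M)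
    (ξ : Cochain 𝕜 (Crossed 𝕜 V G) M (n + 1)) (hξ : S.d (n + 1) ξ = 0)
    (θ : Module.Dual 𝕜 V [⋀^Fin n]→ₗ[𝕜] M) (hθ : S.avgSymbol (n + 1) ξ = koszulD S.adPoly n θ) :
    ∃ χ, ξ = S.d n χ := by
  have step : ∀ (n : ℕ) {M : Type (max u v w)} [AddCommGroup M] [Module 𝕜 M]
      (S : Bimod 𝕜 (Crossed 𝕜 V G) M) (ξ : Cochain 𝕜 (Crossed 𝕜 V G) M (n + 1))
      (_ : S.d (n + 1) ξ = 0) (θ : Module.Dual 𝕜 V [⋀^Fin n]→ₗ[𝕜] M)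
      (_ : S.avgSymbol (n + 1) ξ = koszulD S.adPoly n θ),
      koszulD S.coind.adPoly n (S.coind.avgSymbol n ξ.curryRight -
        (-1 : 𝕜) ^ (n + 1) • S.toCoind.compAlternatingMap θ) = 0 ∧
      S.quot.d n (S.toQuot.compMultilinearMap ξ.curryRight) = 0 := by
    intro n M _ _ S ξ hξ θ hθ
    have h2 := S.d_curryRight ξ
    rw [hξ] at h2
    have h3 : S.coind.d n ξ.curryRight = (-1 : 𝕜) ^ (n + 1) • S.toCoind.compMultilinearMap ξ := by
      rw [h2]; ext; simp
    constructor
    · rw [map_sub, map_smul, koszulD_comp S.adPoly S.coind.adPoly S.toCoind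
        (S.adPoly_map S.coind _ S.toCoind_l S.toCoind_r), ← avgSymbol_d, h3, map_smul,
        S.avgSymbol_map S.coind _ S.toCoind_l S.toCoind_r, hθ, sub_self]
    · rw [S.coind.d_comp S.toQuot S.quot S.toQuot_l S.toQuot_r, h3]
      ext a : 1
      simp [toQuot_toCoind]
  induction n generalizing M with
  | zero =>
    -- The class in the quotient is invariant, and lifts to an element commuting with linear
    -- functionals; its average commutes with the crossed product and is a lift as well.
    obtain ⟨h1, h2⟩ := step 0 S ξ hξ θ hθ
    set z := S.coind.avgSymbol 0 ξ.curryRight -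
        (-1 : 𝕜) ^ (0 + 1) • S.toCoind.compAlternatingMap θ with hz
    have hz0 : ∀ ℓ, S.coind.adPoly ℓ (z default) = 0 := by
      intro ℓ
      have := congrArg (fun F => F fun _ => ℓ) h1
      rw [koszulD_apply, Fin.sum_univ_one, AlternatingMap.zero_apply, Fin.val_zero, pow_zero,
        one_smul] at this
      rw [← this]
      exact congrArg (fun v => S.coind.adPoly ℓ (z v)) (Subsingleton.elim _ _)
    have hc := S.coind.central_average _ (S.coind.central_of_adPoly_eq_zero _ hz0)
    set m := (Fintype.card G : 𝕜)⁻¹ • ∑ h : G, S.coind.conjU h (z default) with hm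
    let φ := S.toQuot (ξ.curryRight default)
    have hφ : ∀ b, S.quot.l b φ = S.quot.r b φ := by
      intro b
      have := congrArg (fun F => F fun _ => b) h2
      simp only [d_apply, Finset.univ_eq_empty, Finset.sum_empty, add_zero, zero_add, pow_one,
        neg_smul, one_smul, _root_.zero_apply, ← sub_eq_add_neg, sub_eq_zero] at this
      refine Eq.trans ?_ (this.trans ?_)
      · exact congrArg (fun a => S.quot.l b (S.toQuot (ξ.curryRight a))) (Subsingleton.elim _ _)
      · exact congrArg (fun a => S.quot.r b (S.toQuot (ξ.curryRight a))) (Subsingleton.elim _ _)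
    refine exists_d_of_toQuot_curryRight S ξ hξ (MultilinearMap.constOfIsEmpty 𝕜 _ m) ?_ ?_
    · ext1 a
      simp [d_apply, hc]
    · have h3 : ∀ h, S.quot.conjU h φ = φ := S.quot.conjU_of_central φ hφ
      have h4 : S.toQuot (z default) = φ := by
        have h5 := congrArg (fun F => F default) (S.coind.avgSymbol_map S.quot S.toQuot S.toQuot_l
          S.toQuot_r ξ.curryRight)
        rw [hz, AlternatingMap.sub_apply, map_sub, AlternatingMap.smul_apply, map_smul,
          LinearMap.compAlternatingMap_apply, toQuot_toCoind, smul_zero, sub_zero]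
        refine h5.symm.trans ?_
        rw [avgSymbol_zero_apply]
        exact average_const h3
      ext1 a
      obtain rfl := Subsingleton.elim a default
      refine Eq.symm ?_
      have h6 : ∀ h m, S.toQuot (S.coind.conjU h m) = S.quot.conjU h (S.toQuot m) := fun h m => by
        rw [conjU_apply, conjU_apply, S.toQuot_r, S.toQuot_l]
      rw [LinearMap.compMultilinearMap_apply, MultilinearMap.constOfIsEmpty_apply,
        Function.const_apply, hm, map_smul, map_sum]
      simp only [h6, h4]
      exact average_const h3
  | succ n ih =>
    obtain ⟨h1, h2⟩ := step (n + 1) S ξ hξ θ hθ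
    -- The averaged symbol in the quotient is exact, as it lifts to a Koszul cocycle of `Hom(B, M)`.
    obtain ⟨κ, hκ⟩ := exists_koszulD_eq_coind S x _ h1
    obtain ⟨τ, hτ⟩ := ih S.quot (S.toQuot.compMultilinearMap ξ.curryRight) h2
      (S.toQuot.compAlternatingMap κ) (by
        rw [koszulD_comp S.coind.adPoly S.quot.adPoly S.toQuot
          (S.coind.adPoly_map S.quot _ S.toQuot_l S.toQuot_r), ← hκ,
          S.coind.avgSymbol_map S.quot _ S.toQuot_l S.toQuot_r]
        ext v : 1
        simp [toQuot_toCoind])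
    refine exists_d_of_toQuot_curryRight S ξ hξ
      (S.coind.d n ((Submodule.subtype _).compMultilinearMap τ)) (S.coind.d_d _) ?_
    rw [← S.coind.d_comp S.toQuot S.quot S.toQuot_l S.toQuot_r, hτ]
    congr 1
    ext a : 1
    exact (S.toQuot_subtype _).symm

end Main
end Bimod

/-! ### Koszul cohomology of the twisted bimodules -/

section Decomposition

variable {𝕜 : Type*} [Field 𝕜] [CharZero 𝕜] {V : Type*} [AddCommGroup V] [Module 𝕜 V]
  {G : Type*} [Group G] [Finite G] [DistribMulAction G V] [SMulCommClass G 𝕜 V] {g : G}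

theorem Poly.comap_comap {W W' W'' : Type*} [AddCommGroup W] [Module 𝕜 W] [AddCommGroup W']
    [Module 𝕜 W'] [AddCommGroup W''] [Module 𝕜 W''] (φ : W →ₗ[𝕜] W') (ψ : W' →ₗ[𝕜] W'')
    (f : Poly 𝕜 W'') : Poly.comap φ (Poly.comap ψ f) = Poly.comap (ψ ∘ₗ φ) f := by
  have : (Poly.comap φ).comp (Poly.comap ψ) = Poly.comap (ψ ∘ₗ φ) :=
    Poly.algHom_ext fun ℓ => by simp [LinearMap.comp_assoc]
  exact DFunLike.congr_fun this f

theorem Poly.comap_id {W : Type*} [AddCommGroup W] [Module 𝕜 W] (f : Poly 𝕜 W) :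
    Poly.comap LinearMap.id f = f := by
  have : Poly.comap LinearMap.id = AlgHom.id 𝕜 (Poly 𝕜 W) :=
    Poly.algHom_ext fun ℓ => by simp
  exact DFunLike.congr_fun this f

theorem mem_fixedSpace {v : V} : v ∈ fixedSpace 𝕜 V g ↔ g • v = v := by
  simp only [fixedSpace, LinearMap.mem_ker, LinearMap.sub_apply, LinearMap.id_apply, sub_eq_zero,
    DistribSMul.toLinearMap_apply]
  exact eq_comm

theorem inv_smul_of_mem_fixedSpace {v : V} (hv : v ∈ fixedSpace 𝕜 V g) : g⁻¹ • v = v := by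
  rw [inv_smul_eq_iff, mem_fixedSpace.1 hv]

theorem sub_inv_smul_mem_normalSpace (v : V) : v - g⁻¹ • v ∈ normalSpace 𝕜 V g :=
  ⟨-(g⁻¹ • v), by simp [sub_eq_add_neg, add_comm]⟩

@[simp] theorem projFixed_coe (v : fixedSpace 𝕜 V g) : projFixed 𝕜 V g (v : V) = v := by
  simp [projFixed]

@[simp] theorem projNormal_coe (v : normalSpace 𝕜 V g) : projNormal 𝕜 V g (v : V) = v := by
  simp [projNormal]

@[simp] theorem projFixed_coe_normal (v : normalSpace 𝕜 V g) : projFixed 𝕜 V g (v : V) = 0 := by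
  simp [projFixed]

@[simp] theorem projNormal_coe_fixed (v : fixedSpace 𝕜 V g) : projNormal 𝕜 V g (v : V) = 0 := by
  simp [projNormal]

theorem projFixed_add_projNormal (v : V) :
    (projFixed 𝕜 V g v : V) + (projNormal 𝕜 V g v : V) = v :=
  Submodule.projection_add_projection_eq_self (isCompl_fixed_normal 𝕜 V g) v

theorem projFixed_inv_smul (v : V) : projFixed 𝕜 V g (g⁻¹ • v) = projFixed 𝕜 V g v := by
  have h := projFixed_coe_normal (⟨_, sub_inv_smul_mem_normalSpace v⟩ : normalSpace 𝕜 V g)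
  simp only [map_sub, sub_eq_zero] at h
  exact h.symm

variable (g) in
/-- The map `ℓ ↦ ℓ - g(ℓ)` on linear functionals. -/
def oneSub : Module.Dual 𝕜 V →ₗ[𝕜] Module.Dual 𝕜 V := LinearMap.id - (act 𝕜 g⁻¹).dualMap

theorem oneSub_apply (ℓ : Module.Dual 𝕜 V) (v : V) : oneSub g ℓ v = ℓ (v - g⁻¹ • v) := by
  simp [oneSub]

variable (e : Module.Basis (Fin (codim 𝕜 V g)) 𝕜 (normalSpace 𝕜 V g))

theorem yCoord_apply_basis (i j : Fin (codim 𝕜 V g)) :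
    yCoord e i (e j : V) = if j = i then 1 else 0 := by
  simp [yCoord, Finsupp.single_apply]

theorem sum_yCoord_smul (v : V) : ∑ i, yCoord e i v • (e i : V) = projNormal 𝕜 V g v := by
  conv_rhs => rw [← e.sum_repr (projNormal 𝕜 V g v), AddSubmonoidClass.coe_finsetSum]
  rfl

theorem sum_yCoord_smul_of_mem {v : V} (hv : v ∈ normalSpace 𝕜 V g) :
    ∑ i, yCoord e i v • (e i : V) = v := by
  rw [sum_yCoord_smul]
  exact congrArg Subtype.val (projNormal_coe (⟨v, hv⟩ : normalSpace 𝕜 V g))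

theorem oneSub_apply_of_mem (ℓ : Module.Dual 𝕜 V) {v : V} (hv : v ∈ fixedSpace 𝕜 V g) :
    oneSub g ℓ v = 0 := by
  rw [oneSub_apply, inv_smul_of_mem_fixedSpace hv, sub_self, map_zero]

/-- Such vectors `w_i` are dual to the functionals `y^i - ỹ^i`, by `oneSub_apply`. -/
theorem exists_sub_inv_smul_eq (i : Fin (codim 𝕜 V g)) : ∃ w : V, w - g⁻¹ • w = (e i : V) := by
  obtain ⟨w, hw⟩ := (e i).2
  refine ⟨-(g • w), ?_⟩
  rw [← hw]
  simp [sub_eq_add_neg, add_comm]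

/-- The basis of `V = V^g ⊕ N^g` made up of bases of the summands. -/
def adaptedBasis {q : ℕ} (z : Module.Basis (Fin q) 𝕜 (fixedSpace 𝕜 V g)) :
    Module.Basis (Fin q ⊕ Fin (codim 𝕜 V g)) 𝕜 V :=
  (z.prod e).map (Submodule.prodEquivOfIsCompl _ _ (isCompl_fixed_normal 𝕜 V g))

variable {q : ℕ} (z : Module.Basis (Fin q) 𝕜 (fixedSpace 𝕜 V g))

@[simp] theorem adaptedBasis_inl (a : Fin q) : adaptedBasis e z (Sum.inl a) = (z a : V) := by
  simp [adaptedBasis]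

@[simp] theorem adaptedBasis_inr (i : Fin (codim 𝕜 V g)) :
    adaptedBasis e z (Sum.inr i) = (e i : V) := by
  simp [adaptedBasis]

theorem adaptedBasis_coord_inl (a : Fin q) :
    (adaptedBasis e z).coord (Sum.inl a) = z.coord a ∘ₗ projFixed 𝕜 V g := by
  refine (adaptedBasis e z).ext fun j => ?_
  rw [Module.Basis.coord_apply, Module.Basis.repr_self]
  rcases j with j | j <;> simp [Finsupp.single_apply]

theorem adaptedBasis_coord_inr (i : Fin (codim 𝕜 V g)) :
    (adaptedBasis e z).coord (Sum.inr i) = yCoord e i := by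
  refine (adaptedBasis e z).ext fun j => ?_
  rw [Module.Basis.coord_apply, Module.Basis.repr_self]
  rcases j with j | j <;> simp [Finsupp.single_apply, yCoord]

end Decomposition

section Twisted

variable {𝕜 : Type*} [Field 𝕜] [CharZero 𝕜] {V : Type*} [AddCommGroup V] [Module 𝕜 V]
  {G : Type*} [Group G] [Finite G] [DistribMulAction G V] [SMulCommClass G 𝕜 V]

variable (𝕜 V) in
/-- The bimodule `Poly(V) U_g`: the algebra `Poly(V)`, with right multiplication twisted by `g`. -/
def twisted (g : G) : Bimod 𝕜 (Poly 𝕜 V) (Poly 𝕜 V) where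
  l := LinearMap.mul 𝕜 _
  r := LinearMap.mul 𝕜 _ ∘ₗ DistribSMul.toLinearMap 𝕜 (Poly 𝕜 V) g
  l_one := by simp
  l_mul := by simp [mul_assoc]
  r_one := by simp
  r_mul a b m := by simp [mul_assoc, mul_left_comm]
  comm a b m := by simp [mul_left_comm]

theorem twisted_l (g : G) (a f : Poly 𝕜 V) : (twisted 𝕜 V g).l a f = a * f := rfl

theorem twisted_r (g : G) (a f : Poly 𝕜 V) : (twisted 𝕜 V g).r a f = (g • a) * f := rfl

theorem ad_twisted (g : G) (ℓ : Module.Dual 𝕜 V) (f : Poly 𝕜 V) :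
    (twisted 𝕜 V g).ad (Poly.lin 𝕜) ℓ f = Poly.lin 𝕜 (oneSub g ℓ) * f := by
  rw [Bimod.ad_apply, twisted_l, twisted_r, ← sub_mul, smul_poly_def, Poly.comap_lin, ← map_sub]
  rfl

/-- Commutators vanish on `V^g`. -/
theorem comap_ad_twisted (g : G) (ℓ : Module.Dual 𝕜 V) (f : Poly 𝕜 V) :
    Poly.comap (fixedSpace 𝕜 V g).subtype ((twisted 𝕜 V g).ad (Poly.lin 𝕜) ℓ f) = 0 := by
  rw [ad_twisted, map_mul, Poly.comap_lin]
  have : oneSub g ℓ ∘ₗ (fixedSpace 𝕜 V g).subtype = 0 := by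
    ext v; exact oneSub_apply_of_mem ℓ v.2
  rw [this, map_zero, zero_mul]

theorem comap_koszulD_twisted (g : G) {n : ℕ} (θ : Module.Dual 𝕜 V [⋀^Fin n]→ₗ[𝕜] Poly 𝕜 V)
    (v : Fin (n + 1) → Module.Dual 𝕜 V) : Poly.comap (fixedSpace 𝕜 V g).subtype
      (koszulD ((twisted 𝕜 V g).ad (Poly.lin 𝕜)) n θ v) = 0 := by
  rw [koszulD_apply, map_sum]
  refine Finset.sum_eq_zero fun i _ => ?_
  rw [map_zsmul, comap_ad_twisted, smul_zero]

/-- The linear functionals `x_1, …, x_p` on `V^g` and `y_1, …, y_l` on `N^g`, seen as functionals on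
`V = V^g ⊕ N^g`. -/
def splitForms {g : G} {k l : ℕ} (p : Deg k l) (x : Fin p.1 → Module.Dual 𝕜 (fixedSpace 𝕜 V g))
    (y : Fin l → Module.Dual 𝕜 (normalSpace 𝕜 V g)) (j : Fin k) : Module.Dual 𝕜 V :=
  Sum.elim (fun a => x a ∘ₗ projFixed 𝕜 V g) (fun i => y i ∘ₗ projNormal 𝕜 V g) (p.slots.symm j)

variable {g : G} (e : Module.Basis (Fin (codim 𝕜 V g)) 𝕜 (normalSpace 𝕜 V g))

/-- A polynomial function which does not change under the projections to the zeros of the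
functionals `y^i - ỹ^i` is constant along `N^g`. Hence it vanishes if it vanishes on `V^g`. -/
theorem eq_zero_of_restrictZero {w : Fin (codim 𝕜 V g) → V} (hw : ∀ i, w i - g⁻¹ • w i = (e i : V))
    (f : Poly 𝕜 V) (hf : ∀ i, restrictZero (oneSub g (yCoord e i)) (w i) f = f)
    (h : Poly.comap (fixedSpace 𝕜 V g).subtype f = 0) : f = 0 := by
  have h1 : ∀ J : Finset (Fin (codim 𝕜 V g)), Poly.comap
      (LinearMap.id - ∑ i ∈ J, (oneSub g (yCoord e i)).smulRight (w i)) f = f := by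
    intro J
    induction J using Finset.induction with
    | empty => simp [Poly.comap_id]
    | insert i J hi ih =>
      have : LinearMap.id - ∑ i ∈ insert i J, (oneSub g (yCoord e i)).smulRight (w i) =
          (LinearMap.id - (oneSub g (yCoord e i)).smulRight (w i)) ∘ₗ
            (LinearMap.id - ∑ i ∈ J, (oneSub g (yCoord e i)).smulRight (w i)) := by
        ext v
        have : ∀ j ∈ J, oneSub g (yCoord e i) (w j) = 0 := fun j hj => by
          rw [oneSub_apply, hw, yCoord_apply_basis, if_neg]
          rintro rfl; exact hi hj
        simp only [Finset.sum_insert hi, LinearMap.sub_apply, LinearMap.add_apply,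
          LinearMap.comp_apply, LinearMap.id_apply, LinearMap.sum_apply, LinearMap.smulRight_apply,
          map_sub, map_sum, map_smul]
        have h2 : ∀ j ∈ J, oneSub g (yCoord e j) v • (w j - oneSub g (yCoord e i) (w j) • w i) =
            oneSub g (yCoord e j) v • w j := fun j hj => by rw [this j hj, zero_smul, sub_zero]
        rw [Finset.sum_congr rfl h2]
        abel
      rw [this, ← Poly.comap_comap]
      have := hf i
      rw [restrictZero] at this
      rw [this, ih]
  have h2 : ∀ v, (LinearMap.id - ∑ i, (oneSub g (yCoord e i)).smulRight (w i) : V →ₗ[𝕜] V) v ∈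
      fixedSpace 𝕜 V g := by
    intro v
    have h3 := sum_yCoord_smul_of_mem e (sub_inv_smul_mem_normalSpace v)
    rw [mem_fixedSpace, eq_comm, ← inv_smul_eq_iff, eq_comm, ← sub_eq_zero]
    simp only [LinearMap.sub_apply, LinearMap.id_apply, LinearMap.sum_apply,
      LinearMap.smulRight_apply, smul_sub, Finset.smul_sum, smul_comm g⁻¹]
    rw [sub_sub_sub_comm, ← Finset.sum_sub_distrib]
    simp only [← smul_sub, hw, oneSub_apply, h3, sub_self]
  have h3 := h1 Finset.univ
  rw [show (LinearMap.id - ∑ i, (oneSub g (yCoord e i)).smulRight (w i) : V →ₗ[𝕜] V) =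
    (fixedSpace 𝕜 V g).subtype ∘ₗ LinearMap.codRestrict _ _ h2 by ext; rfl, ← Poly.comap_comap, h,
    map_zero] at h3
  exact h3.symm

/-- An injective sequence in `Fin q ⊕ Fin l` hitting all of `Fin l` can be sorted. -/
theorem exists_perm_slots {k l q : ℕ} (v : Fin k → Fin q ⊕ Fin l) (hv : Function.Injective v)
    (h : ∀ i, ∃ a, v a = Sum.inr i) :
    ∃ (p : Deg k l) (σ : Equiv.Perm (Fin k)) (s : Fin p.1 → Fin q), ∀ j,
      v (σ j) = Sum.map s id (p.slots.symm j) := by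
  choose t ht using h
  let E' : Fin l ≃ {a // ¬ (v a).isLeft} := Equiv.ofBijective
    (fun i => ⟨t i, by simp [ht]⟩) ⟨fun i j hij => by
      have := congrArg v (congrArg Subtype.val hij)
      simpa [ht] using this, fun ⟨a, ha⟩ => by
      obtain ⟨i, hi⟩ := Sum.isRight_iff.1 (by simpa using ha)
      exact ⟨i, Subtype.ext (hv (by rw [hi]; exact ht i))⟩⟩
  let E := E'.symm
  let F := Fintype.equivFin {a // (v a).isLeft}
  have hE : ∀ i, v (E.symm i).1 = Sum.inr i := fun i => ht i
  have hc : Fintype.card {a // (v a).isLeft} + l = k := by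
    have := Fintype.card_congr (Equiv.sumCompl fun a => (v a).isLeft = true)
    rw [Fintype.card_sum, Fintype.card_congr E, Fintype.card_fin, Fintype.card_fin] at this
    exact this
  let p : Deg k l := ⟨⟨Fintype.card {a // (v a).isLeft}, by omega⟩, hc⟩
  let σ : Equiv.Perm (Fin k) := p.slots.symm.trans
    ((Equiv.sumCongr F.symm E.symm).trans (Equiv.sumCompl fun a => (v a).isLeft = true))
  refine ⟨p, σ, fun a => (v (F.symm a).1).getLeft (F.symm a).2, fun j => ?_⟩
  simp only [σ, Equiv.trans_apply]
  rcases p.slots.symm j with a | i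
  · simp
  · simpa using hE i

/-- A Koszul cocycle of `Poly(V) U_g` is exact if its components in
`⋀^p V^g ⊗ ⋀^{l(g)} N^g` vanish on `V^g`. -/
theorem exists_koszulD_twisted [Module.Finite 𝕜 V] {n : ℕ}
    (ω : Module.Dual 𝕜 V [⋀^Fin (n + 1)]→ₗ[𝕜] Poly 𝕜 V)
    (hω : koszulD ((twisted 𝕜 V g).ad (Poly.lin 𝕜)) (n + 1) ω = 0)
    (h : ∀ (p : Deg (n + 1) (codim 𝕜 V g)) (x : Fin p.1 → Module.Dual 𝕜 (fixedSpace 𝕜 V g))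
      (y : Fin (codim 𝕜 V g) → Module.Dual 𝕜 (normalSpace 𝕜 V g)),
      Poly.comap (fixedSpace 𝕜 V g).subtype (ω (splitForms p x y)) = 0) :
    ∃ θ, ω = koszulD ((twisted 𝕜 V g).ad (Poly.lin 𝕜)) n θ := by
  let e : Module.Basis (Fin (codim 𝕜 V g)) 𝕜 (normalSpace 𝕜 V g) := Module.finBasis _ _
  let z := Module.finBasis 𝕜 (fixedSpace 𝕜 V g)
  choose w hw using exists_sub_inv_smul_eq e
  have huw : ∀ i j, oneSub g (yCoord e i) (w j) = if j = i then 1 else 0 := fun i j => by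
    rw [oneSub_apply, hw, yCoord_apply_basis]
  choose q hq1 hq2 hq3 using fun i => exists_division (oneSub g (yCoord e i)) (w i) (by simp [huw])
  -- The commutator of division by `y^i - ỹ^i` with multiplication by a linear functional.
  have hlin : ∀ i (ℓ : Module.Dual 𝕜 V) f, q i (Poly.lin 𝕜 ℓ * f) =
      Poly.lin 𝕜 ℓ * q i f + ℓ (w i) • restrictZero (oneSub g (yCoord e i)) (w i) f := by
    intro i ℓ f
    have h0 := hq3 i (ℓ - ℓ (w i) • oneSub g (yCoord e i)) f (by simp [huw])
    simp only [map_sub, map_smul, sub_mul, smul_mul_assoc, hq1, hq2, smul_sub] at h0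
    rw [sub_eq_iff_eq_add] at h0
    rw [h0]; abel
  obtain ⟨θ, hθ⟩ := exists_koszulD_of_leftInverse ((twisted 𝕜 V g).ad (Poly.lin 𝕜))
    (Bimod.ad_comm _ _) (yCoord e) (fun i => Module.Dual.eval 𝕜 V (e i : V))
    (fun i j hij => by simp [yCoord_apply_basis, hij.symm]) q
    (fun i => (restrictZero (oneSub g (yCoord e i)) (w i)).toLinearMap)
    (fun i m => by rw [ad_twisted, hq2])
    (fun i ℓ m => by
      rw [ad_twisted, ad_twisted, hlin, oneSub_apply, hw, Module.Dual.eval_apply]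
      simp)
    (fun i m => by
      simp only [AlgHom.toLinearMap_apply, restrictZero, Poly.comap_comap]
      congr 2
      ext v
      simp [huw])
    (fun i j m => by
      simp only [AlgHom.toLinearMap_apply, restrictZero, Poly.comap_comap]
      congr 2
      ext v
      by_cases hij : i = j
      · subst hij; rfl
      · simp [huw, hij, Ne.symm hij]; abel) ω hω
  refine ⟨θ, sub_eq_zero.1 ?_⟩
  set ω' := ω - koszulD ((twisted 𝕜 V g).ad (Poly.lin 𝕜)) n θ with hω'
  -- A tuple of dual basis vectors that contains all `y^i` can be sorted, and then the component is
  -- zero on `V^g` and constant along `N^g`; other tuples do not see a form containing `dy^i`.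
  refine Module.Basis.ext_alternating (adaptedBasis e z).dualBasis fun v hv => ?_
  rw [AlternatingMap.zero_apply]
  by_cases hall : ∀ i, ∃ a, v a = Sum.inr i
  · obtain ⟨p, σ, s, hs⟩ := exists_perm_slots v hv hall
    have h1 : ((fun a => (adaptedBasis e z).dualBasis (v a)) ∘ σ) =
        splitForms p (fun a => z.coord (s a)) (fun i => e.coord i) := by
      funext j
      rw [Function.comp_apply, hs, Module.Basis.coe_dualBasis, splitForms]
      rcases p.slots.symm j with a | i
      · exact adaptedBasis_coord_inl e z _
      · exact adaptedBasis_coord_inr e z _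
    have h2 : ω' (splitForms p (fun a => z.coord (s a)) (fun i => e.coord i)) = 0 := by
      refine eq_zero_of_restrictZero e hw _ (fun i => (hθ i).1 _) ?_
      rw [hω', AlternatingMap.sub_apply, map_sub, h, comap_koszulD_twisted, sub_zero]
    rw [← h1, AlternatingMap.map_perm] at h2
    exact (smul_eq_zero_iff_eq _).1 h2
  · push Not at hall
    obtain ⟨i, hi⟩ := hall
    refine (hθ i).2 _ fun a => ?_
    rw [Module.Dual.eval_apply, Module.Basis.coe_dualBasis]
    rcases hva : v a with b | j
    · rw [adaptedBasis_coord_inl]; simp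
    · rw [adaptedBasis_coord_inr, yCoord_apply_basis, if_neg]
      rintro rfl; exact hi a hva

/-- In degree zero, a cocycle of `Poly(V) U_g` is zero if `g` moves some vector, since `Poly(V)` is
a domain, and is a function on `V^g` otherwise. -/
theorem eq_zero_of_ad_twisted_eq_zero [Module.Finite 𝕜 V]
    (ω : Module.Dual 𝕜 V [⋀^Fin 0]→ₗ[𝕜] Poly 𝕜 V)
    (hω : koszulD ((twisted 𝕜 V g).ad (Poly.lin 𝕜)) 0 ω = 0)
    (h : ∀ (p : Deg 0 (codim 𝕜 V g)) (x : Fin p.1 → Module.Dual 𝕜 (fixedSpace 𝕜 V g))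
      (y : Fin (codim 𝕜 V g) → Module.Dual 𝕜 (normalSpace 𝕜 V g)),
      Poly.comap (fixedSpace 𝕜 V g).subtype (ω (splitForms p x y)) = 0) : ω = 0 := by
  let e : Module.Basis (Fin (codim 𝕜 V g)) 𝕜 (normalSpace 𝕜 V g) := Module.finBasis _ _
  ext v
  rw [AlternatingMap.zero_apply]
  by_cases hl : codim 𝕜 V g = 0
  · choose w hw using exists_sub_inv_smul_eq e
    refine eq_zero_of_restrictZero e hw _ (fun i => (Fin.cast hl i).elim0) ?_
    rw [Subsingleton.elim v
      (splitForms (g := g) (⟨0, by simpa using hl⟩ : Deg 0 (codim 𝕜 V g)) 0 0)]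
    exact h _ _ _
  · let i : Fin (codim 𝕜 V g) := ⟨0, Nat.pos_of_ne_zero hl⟩
    have h1 := congrArg (fun F => F fun _ => yCoord e i) hω
    rw [koszulD_apply, Fin.sum_univ_one, AlternatingMap.zero_apply, Fin.val_zero, pow_zero,
      one_smul, ad_twisted, mul_eq_zero] at h1
    rw [Subsingleton.elim v]
    exact h1.resolve_left (lin_ne_zero e i)

end Twisted

/-! ### Exterior products of alternating maps -/

section DomCoprod

variable {R M M' N₁ N₂ N₁' N₂' ιa ιb : Type*} [CommRing R] [AddCommGroup M] [Module R M]
  [AddCommGroup M'] [Module R M'] [AddCommGroup N₁] [Module R N₁] [AddCommGroup N₂] [Module R N₂]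
  [AddCommGroup N₁'] [Module R N₁'] [AddCommGroup N₂'] [Module R N₂']
  [Fintype ιa] [Fintype ιb] [DecidableEq ιa] [DecidableEq ιb]

theorem domCoprod_eq_sum (a : M [⋀^ιa]→ₗ[R] N₁) (b : M [⋀^ιb]→ₗ[R] N₂) (v : ιa ⊕ ιb → M) :
    a.domCoprod b v =
      ∑ σ : Equiv.Perm.ModSumCongr ιa ιb, AlternatingMap.domCoprod.summand a b σ v := by
  rw [AlternatingMap.domCoprod_apply, _root_.sum_apply]

theorem summand_mk_apply (a : M [⋀^ιa]→ₗ[R] N₁) (b : M [⋀^ιb]→ₗ[R] N₂) (v : ιa ⊕ ιb → M)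
    (σ : Equiv.Perm (ιa ⊕ ιb)) : AlternatingMap.domCoprod.summand a b (Quotient.mk'' σ) v =
      (Equiv.Perm.sign σ : ℤ) •
        (a (fun i => v (σ (Sum.inl i))) ⊗ₜ[R] b (fun j => v (σ (Sum.inr j)))) := rfl

theorem map_domCoprod (f₁ : N₁ →ₗ[R] N₁') (f₂ : N₂ →ₗ[R] N₂') (a : M [⋀^ιa]→ₗ[R] N₁)
    (b : M [⋀^ιb]→ₗ[R] N₂) (v : ιa ⊕ ιb → M) :
    TensorProduct.map f₁ f₂ (a.domCoprod b v) =
      (f₁.compAlternatingMap a).domCoprod (f₂.compAlternatingMap b) v := by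
  rw [domCoprod_eq_sum, domCoprod_eq_sum, map_sum]
  refine Finset.sum_congr rfl fun σ _ => ?_
  induction σ using Quotient.inductionOn' with
  | h σ =>
    rw [summand_mk_apply, summand_mk_apply, map_zsmul]
    rfl

theorem domCoprod_compLinearMap (h : M' →ₗ[R] M) (a : M [⋀^ιa]→ₗ[R] N₁) (b : M [⋀^ιb]→ₗ[R] N₂)
    (v : ιa ⊕ ιb → M') :
    (a.compLinearMap h).domCoprod (b.compLinearMap h) v = a.domCoprod b (fun i => h (v i)) := by
  rw [domCoprod_eq_sum, domCoprod_eq_sum]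
  refine Finset.sum_congr rfl fun σ _ => ?_
  induction σ using Quotient.inductionOn' with
  | h σ => rfl

/-- If `a` vanishes on the second half of the arguments, then only the trivial shuffle
contributes. -/
theorem domCoprod_apply_of_vanish (a : M [⋀^ιa]→ₗ[R] N₁) (b : M [⋀^ιb]→ₗ[R] N₂) (v : ιa ⊕ ιb → M)
    (hv : ∀ (w : ιa → M) i j, w i = v (Sum.inr j) → a w = 0) :
    a.domCoprod b v = a (fun i => v (Sum.inl i)) ⊗ₜ b (fun j => v (Sum.inr j)) := by
  rw [domCoprod_eq_sum]
  refine (Finset.sum_eq_single (s := Finset.univ)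
    (f := fun σ : Equiv.Perm.ModSumCongr ιa ιb => AlternatingMap.domCoprod.summand a b σ v)
    (Quotient.mk'' 1 : Equiv.Perm.ModSumCongr ιa ιb) ?_ ?_).trans ?_
  · intro σ _ hσ
    induction σ using Quotient.inductionOn' with
    | h σ =>
      rw [summand_mk_apply]
      have : ∃ i j, σ (Sum.inl i) = Sum.inr j := by
        by_contra! hc
        refine hσ (Quotient.sound' ?_)
        rw [QuotientGroup.leftRel_apply, mul_one, inv_mem_iff]
        refine Equiv.Perm.mem_sumCongrHom_range_of_perm_mapsTo_inl ?_
        rintro _ ⟨i, rfl⟩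
        rcases h : σ (Sum.inl i) with j | j
        · exact ⟨j, rfl⟩
        · exact absurd h (hc i j)
      obtain ⟨i, j, hij⟩ := this
      have := hv (fun i => v (σ (Sum.inl i))) i j (by rw [hij])
      simp [this]
  · simp
  · rw [summand_mk_apply]
    simp

end DomCoprod

/-! ### Restriction and projection of multivector fields -/

section Projection

variable {𝕜 : Type*} [Field 𝕜] [CharZero 𝕜] {V : Type*} [AddCommGroup V] [Module 𝕜 V]
  {G : Type*} [Group G] [Fintype G] [DistribMulAction G V] [SMulCommClass G 𝕜 V] (g : G)

/-- The vectors `u_1, …, u_p` of `V^g`, followed by the vectors `w_1, …, w_l` of `N^g`. -/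
def splitVectors {g : G} {k l : ℕ} (p : Deg k l) (u : Fin p.1 → fixedSpace 𝕜 V g)
    (w : Fin l → normalSpace 𝕜 V g) (j : Fin k) : V :=
  Sum.elim (fun a => (u a : V)) (fun i => (w i : V)) (p.slots.symm j)

theorem projWedge_ιMulti {k l : ℕ} (p : Deg k l) (v : Fin k → V) :
    projWedge (𝕜 := 𝕜) g p (exteriorPower.ιMulti 𝕜 k v) =
      AlternatingMap.domCoprod
        ((exteriorPower.ιMulti 𝕜 (p.1 : ℕ)).compLinearMap (projFixed 𝕜 V g))
        ((exteriorPower.ιMulti 𝕜 l).compLinearMap (projNormal 𝕜 V g)) (fun i => v (p.slots i)) := by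
  rw [projWedge, exteriorPower.alternatingMapLinearEquiv_apply_ιMulti]
  rfl

variable {g}

theorem projWedge_splitVectors {k l : ℕ} (p : Deg k l) (u : Fin p.1 → fixedSpace 𝕜 V g)
    (w : Fin l → normalSpace 𝕜 V g) :
    projWedge g p (exteriorPower.ιMulti 𝕜 k (splitVectors p u w)) =
      exteriorPower.ιMulti 𝕜 (p.1 : ℕ) u ⊗ₜ[𝕜] exteriorPower.ιMulti 𝕜 l w := by
  rw [projWedge_ιMulti, domCoprod_apply_of_vanish]
  · simp [splitVectors]
  · intro v i j h
    rw [AlternatingMap.compLinearMap_apply]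
    refine AlternatingMap.map_coord_zero _ i ?_
    rw [h]
    simp [splitVectors]

theorem wedge_ιMulti {k l : ℕ} (p : Deg k l) (u : Fin p.1 → fixedSpace 𝕜 V g)
    (w : Fin l → normalSpace 𝕜 V g) :
    wedge 𝕜 V g p.1 l (exteriorPower.ιMulti 𝕜 (p.1 : ℕ) u ⊗ₜ[𝕜] exteriorPower.ιMulti 𝕜 l w) =
      (exteriorPower.ιMulti 𝕜 k (splitVectors p u w) : ExteriorAlgebra 𝕜 V) := by
  obtain ⟨⟨p, hp⟩, h⟩ := p
  change p + l = k at h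
  subst h
  simp only [wedge, LinearMap.comp_apply, TensorProduct.map_tmul, LinearMap.mul'_apply,
    Submodule.subtype_apply, AlgHom.toLinearMap_apply, exteriorPower.ιMulti_apply_coe,
    ExteriorAlgebra.map_apply_ιMulti, ExteriorAlgebra.ιMulti_mul_ιMulti]
  congr 1
  funext j
  refine Fin.addCases (fun a => ?_) (fun i => ?_) j
  · simp [splitVectors, Deg.slots]
  · simp [splitVectors, Deg.slots]

theorem wedgeTensor_ext {p l : ℕ} {N : Type*} [AddCommGroup N] [Module 𝕜 N]
    {F F' : ⋀[𝕜]^p (fixedSpace 𝕜 V g) ⊗[𝕜] ⋀[𝕜]^l (normalSpace 𝕜 V g) →ₗ[𝕜] N}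
    (h : ∀ u w, F (exteriorPower.ιMulti 𝕜 p u ⊗ₜ exteriorPower.ιMulti 𝕜 l w) =
      F' (exteriorPower.ιMulti 𝕜 p u ⊗ₜ exteriorPower.ιMulti 𝕜 l w)) : F = F' := by
  refine TensorProduct.ext ?_
  refine exteriorPower.linearMap_ext (AlternatingMap.ext fun u => exteriorPower.linearMap_ext
    (AlternatingMap.ext fun w => ?_))
  exact h u w

/-- Two linear maps on `W ⊗ (⋀^p V^g ⊗ ⋀^l N^g)` agree if they do so on decomposable elements. -/
theorem sectionTensor_ext {p l : ℕ} {W N : Type*} [AddCommGroup W] [Module 𝕜 W] [AddCommGroup N]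
    [Module 𝕜 N] {F F' : W ⊗[𝕜] (⋀[𝕜]^p (fixedSpace 𝕜 V g) ⊗[𝕜]
      ⋀[𝕜]^l (normalSpace 𝕜 V g)) →ₗ[𝕜] N}
    (h : ∀ f u w, F (f ⊗ₜ (exteriorPower.ιMulti 𝕜 p u ⊗ₜ exteriorPower.ιMulti 𝕜 l w)) =
      F' (f ⊗ₜ (exteriorPower.ιMulti 𝕜 p u ⊗ₜ exteriorPower.ιMulti 𝕜 l w))) : F = F' :=
  TensorProduct.ext (LinearMap.ext fun f => wedgeTensor_ext (h f))

/-- There is only the degree `p = k - l`, and none if `k < l`. -/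
instance Deg.subsingleton {k l : ℕ} : Subsingleton (Deg k l) :=
  ⟨fun p q => by
    have := p.2; have := q.2
    exact Subtype.ext (Fin.ext (by omega))⟩

theorem toMultivector_apply {k : ℕ} (ξ : SectionsAt 𝕜 V g k) (p : Deg k (codim 𝕜 V g)) :
    toMultivector 𝕜 V g k ξ =
      TensorProduct.map (Poly.comap (projFixed 𝕜 V g)).toLinearMap (wedge 𝕜 V g _ _) (ξ p) := by
  rw [toMultivector, LinearMap.sum_apply, Finset.sum_eq_single p]
  · rfl
  · intro q _ hq
    exact absurd (Subsingleton.elim q p) hq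
  · simp

theorem toMultivector_injective (k : ℕ) : Function.Injective (toMultivector 𝕜 V g k) := by
  intro ξ η h
  funext p
  rw [toMultivector_apply ξ p, toMultivector_apply η p] at h
  -- A left inverse: retract the exterior algebra to `⋀^k V`, restrict to `V^g` and project.
  obtain ⟨ρ, hρ⟩ := LinearMap.exists_leftInverse_of_injective (Submodule.subtype (⋀[𝕜]^k V))
    (Submodule.ker_subtype _)
  have h1 : (projWedge g p ∘ₗ ρ) ∘ₗ wedge 𝕜 V g p.1 _ = LinearMap.id := by
    refine wedgeTensor_ext (N := ⋀[𝕜]^(p.1 : ℕ) (fixedSpace 𝕜 V g) ⊗[𝕜]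
      ⋀[𝕜]^(codim 𝕜 V g) (normalSpace 𝕜 V g)) fun u w => ?_
    have h2 : ∀ w : ⋀[𝕜]^k V, ρ (w : ExteriorAlgebra 𝕜 V) = w := LinearMap.congr_fun hρ
    change projWedge g p (ρ (wedge 𝕜 V g p.1 _ (exteriorPower.ιMulti 𝕜 (p.1 : ℕ) u ⊗ₜ
      exteriorPower.ιMulti 𝕜 _ w))) = exteriorPower.ιMulti 𝕜 (p.1 : ℕ) u ⊗ₜ
      exteriorPower.ιMulti 𝕜 _ w
    rw [wedge_ιMulti, h2, projWedge_splitVectors]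
  have h2 : (Poly.comap (fixedSpace 𝕜 V g).subtype).toLinearMap ∘ₗ
      (Poly.comap (projFixed 𝕜 V g)).toLinearMap = LinearMap.id := by
    refine LinearMap.ext fun f => ?_
    rw [LinearMap.comp_apply, AlgHom.toLinearMap_apply, AlgHom.toLinearMap_apply, Poly.comap_comap,
      show projFixed 𝕜 V g ∘ₗ (fixedSpace 𝕜 V g).subtype = LinearMap.id by ext; simp, Poly.comap_id]
    rfl
  have key := TensorProduct.map_comp (Poly.comap (fixedSpace 𝕜 V g).subtype).toLinearMap
    (projWedge g p ∘ₗ ρ)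
    (Poly.comap (projFixed 𝕜 V g)).toLinearMap (wedge 𝕜 V g p.1 (codim 𝕜 V g))
  rw [h1, h2, TensorProduct.map_id] at key
  have h3 := congrArg (TensorProduct.map (Poly.comap (fixedSpace 𝕜 V g).subtype).toLinearMap
      (projWedge g p ∘ₗ ρ)) h
  have h4 := fun X => LinearMap.congr_fun key X
  simp only [LinearMap.id_apply, LinearMap.comp_apply] at h4
  rwa [← h4, ← h4] at h3

/-- The component in `⋀^{k-l} A(V) ⊗ ⋀^l B(V)` of `v_1 ∧ ⋯ ∧ v_k`, for projections `A` and `B`. -/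
def splitWedge (A B : V →ₗ[𝕜] V) (l k : ℕ) (v : Fin k → V) : ExteriorAlgebra 𝕜 V :=
  ∑ p : Deg k l, LinearMap.mul' 𝕜 _
    (((ExteriorAlgebra.ιMulti 𝕜 (p.1 : ℕ)).compLinearMap A).domCoprod
      ((ExteriorAlgebra.ιMulti 𝕜 l).compLinearMap B) fun i => v (p.slots i))

theorem map_splitWedge (φ A B A' B' : V →ₗ[𝕜] V) (hA : φ ∘ₗ A = A' ∘ₗ φ) (hB : φ ∘ₗ B = B' ∘ₗ φ)
    (l k : ℕ) (v : Fin k → V) : ExteriorAlgebra.map φ (splitWedge A B l k v) =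
      splitWedge A' B' l k (fun i => φ (v i)) := by
  have h1 : (ExteriorAlgebra.map φ).toLinearMap ∘ₗ LinearMap.mul' 𝕜 (ExteriorAlgebra 𝕜 V) =
      LinearMap.mul' 𝕜 (ExteriorAlgebra 𝕜 V) ∘ₗ TensorProduct.map
        (ExteriorAlgebra.map φ).toLinearMap (ExteriorAlgebra.map φ).toLinearMap :=
    TensorProduct.ext' fun a b => by simp
  have h2 : ∀ (n : ℕ) (A A' : V →ₗ[𝕜] V), φ ∘ₗ A = A' ∘ₗ φ →
      (ExteriorAlgebra.map φ).toLinearMap.compAlternatingMap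
        ((ExteriorAlgebra.ιMulti 𝕜 n).compLinearMap A) =
      ((ExteriorAlgebra.ιMulti 𝕜 n).compLinearMap A').compLinearMap φ := by
    intro n A A' h
    ext w
    have : ∀ w, φ (A w) = A' (φ w) := LinearMap.congr_fun h
    simp [ExteriorAlgebra.map_apply_ιMulti, Function.comp_def, this]
  simp only [splitWedge, map_sum]
  refine Finset.sum_congr rfl fun p _ => ?_
  refine (LinearMap.congr_fun h1 _).trans ?_
  rw [LinearMap.comp_apply, map_domCoprod, h2 _ _ _ hA, h2 _ _ _ hB, domCoprod_compLinearMap]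

/-- The polynomial multivector field on `V` given by `mapL3At`. -/
theorem toMultivector_mapL3At {k : ℕ} (f : Poly 𝕜 V) (v : Fin k → V) :
    toMultivector 𝕜 V g k (mapL3At g k (f ⊗ₜ exteriorPower.ιMulti 𝕜 k v)) =
      Poly.comap ((fixedSpace 𝕜 V g).subtype ∘ₗ projFixed 𝕜 V g) f ⊗ₜ
        splitWedge ((fixedSpace 𝕜 V g).subtype ∘ₗ projFixed 𝕜 V g)
          ((normalSpace 𝕜 V g).subtype ∘ₗ projNormal 𝕜 V g) (codim 𝕜 V g) k v := by
  simp only [toMultivector, splitWedge, LinearMap.sum_apply, TensorProduct.tmul_sum]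
  refine Finset.sum_congr rfl fun p _ => ?_
  rw [LinearMap.comp_apply, LinearMap.proj_apply, mapL3At, LinearMap.pi_apply,
    TensorProduct.map_tmul, TensorProduct.map_tmul, AlgHom.toLinearMap_apply,
    AlgHom.toLinearMap_apply, Poly.comap_comap, projWedge_ιMulti, wedge, LinearMap.comp_apply,
    map_domCoprod]
  congr 4
  · ext w
    simp [ExteriorAlgebra.map_apply_ιMulti, Function.comp_def]
  · ext w
    simp [ExteriorAlgebra.map_apply_ιMulti, Function.comp_def]

theorem smul_mem_fixedSpace_conj (h : G) {v : V} (hv : v ∈ fixedSpace 𝕜 V g) :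
    h • v ∈ fixedSpace 𝕜 V (h * g * h⁻¹) := by
  rw [mem_fixedSpace] at *
  simp [mul_smul, hv]

theorem smul_mem_normalSpace_conj (h : G) {v : V} (hv : v ∈ normalSpace 𝕜 V g) :
    h • v ∈ normalSpace 𝕜 V (h * g * h⁻¹) := by
  obtain ⟨w, rfl⟩ := hv
  exact ⟨h • w, by simp [mul_smul, smul_sub]⟩

theorem projFixed_conj (h : G) (v : V) :
    (projFixed 𝕜 V (h * g * h⁻¹) (h • v) : V) = h • (projFixed 𝕜 V g v : V) := by
  conv_lhs => rw [← projFixed_add_projNormal (𝕜 := 𝕜) (g := g) v, smul_add, map_add]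
  have h1 := projFixed_coe (⟨_, smul_mem_fixedSpace_conj h (projFixed 𝕜 V g v).2⟩ :
    fixedSpace 𝕜 V (h * g * h⁻¹))
  have h2 := projFixed_coe_normal (⟨_, smul_mem_normalSpace_conj h (projNormal 𝕜 V g v).2⟩ :
    normalSpace 𝕜 V (h * g * h⁻¹))
  simp only at h1 h2
  rw [h1, h2, add_zero]

theorem projNormal_conj (h : G) (v : V) :
    (projNormal 𝕜 V (h * g * h⁻¹) (h • v) : V) = h • (projNormal 𝕜 V g v : V) := by
  have h1 := projFixed_add_projNormal (𝕜 := 𝕜) (g := h * g * h⁻¹) (h • v)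
  have h2 := congrArg (h • ·) (projFixed_add_projNormal (𝕜 := 𝕜) (g := g) v)
  simp only [smul_add] at h2
  rw [projFixed_conj] at h1
  replace h1 := h1.trans h2.symm
  exact add_left_cancel h1

theorem codim_conj (h : G) : codim 𝕜 V (h * g * h⁻¹) = codim 𝕜 V g := by
  refine (LinearEquiv.finrank_eq (LinearEquiv.ofLinearMap
    ((act 𝕜 h).restrict fun v hv => smul_mem_normalSpace_conj h hv)
    ((act 𝕜 h⁻¹).restrict fun v hv => ?_) ?_ ?_)).symm
  · have := smul_mem_normalSpace_conj h⁻¹ hv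
    simpa [mul_assoc] using this
  · ext v; exact smul_inv_smul h (v : V)
  · ext v; exact inv_smul_smul h (v : V)

/-- Restricting and projecting is equivariant. -/
theorem toMultivector_mapL3At_push (h : G) {k : ℕ} (f : Poly 𝕜 V) (v : Fin k → V) :
    toMultivector 𝕜 V (h * g * h⁻¹) k (mapL3At (h * g * h⁻¹) k
      ((h • f) ⊗ₜ exteriorPower.ιMulti 𝕜 k (fun i => h • v i))) =
    pushMultivector 𝕜 V h (toMultivector 𝕜 V g k (mapL3At g k
      (f ⊗ₜ exteriorPower.ιMulti 𝕜 k v))) := by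
  rw [toMultivector_mapL3At, toMultivector_mapL3At, pushMultivector, TensorProduct.map_tmul,
    AlgHom.toLinearMap_apply, map_splitWedge (act 𝕜 h) _ _
      ((fixedSpace 𝕜 V (h * g * h⁻¹)).subtype ∘ₗ projFixed 𝕜 V (h * g * h⁻¹))
      ((normalSpace 𝕜 V (h * g * h⁻¹)).subtype ∘ₗ projNormal 𝕜 V (h * g * h⁻¹))
      (by ext v; simp [projFixed_conj]) (by ext v; simp [projNormal_conj]), codim_conj]
  congr 1
  rw [DistribSMul.toLinearMap_apply, smul_poly_def, smul_poly_def, Poly.comap_comap,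
    Poly.comap_comap]
  congr 2
  ext v
  have := projFixed_conj (𝕜 := 𝕜) (g := g) h (h⁻¹ • v)
  rw [smul_inv_smul] at this
  simp [this]

theorem pushMultivector_injective (h : G) : Function.Injective (pushMultivector 𝕜 V h) := by
  refine Function.LeftInverse.injective (g := pushMultivector 𝕜 V h⁻¹) fun X => ?_
  rw [pushMultivector, pushMultivector, ← LinearMap.comp_apply, ← TensorProduct.map_comp,
    ← AlgHom.comp_toLinearMap, ExteriorAlgebra.map_comp_map]
  have h1 : act 𝕜 h⁻¹ ∘ₗ act 𝕜 h = (LinearMap.id : V →ₗ[𝕜] V) := by ext v; simp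
  have h2 : DistribSMul.toLinearMap 𝕜 (Poly 𝕜 V) h⁻¹ ∘ₗ DistribSMul.toLinearMap 𝕜 (Poly 𝕜 V) h =
    LinearMap.id := by ext v; simp
  rw [h1, h2, ExteriorAlgebra.map_id, AlgHom.toLinearMap_id, TensorProduct.map_id]
  rfl

end Projection

/-! ### Alternating forms as multivector fields -/

section Contraction

variable {𝕜 : Type*} [Field 𝕜] {V : Type*} [AddCommGroup V] [Module 𝕜 V]
  {A N : Type*} [AddCommGroup A] [Module 𝕜 A] [AddCommGroup N] [Module 𝕜 N]
  {n n' : ℕ} (b : Module.Basis (Fin n) 𝕜 V) (b' : Module.Basis (Fin n') 𝕜 V) {k : ℕ}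

theorem multilinear_expand_coord (F : MultilinearMap 𝕜 (fun _ : Fin k => Module.Dual 𝕜 V) A)
    (ℓ : Fin k → Module.Dual 𝕜 V) :
    F ℓ = ∑ i : Fin k → Fin n, (∏ j, ℓ j (b (i j))) • F (fun j => b.coord (i j)) := by
  have : ℓ = fun j => ∑ i, ℓ j (b i) • b.coord i := by
    funext j
    refine b.ext fun i => ?_
    simp
  conv_lhs => rw [this, MultilinearMap.map_sum]
  simp only [MultilinearMap.map_smul_univ]

theorem multilinear_expand (m : MultilinearMap 𝕜 (fun _ : Fin k => V) N) (v : Fin k → V) :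
    m v = ∑ i : Fin k → Fin n, (∏ j, b.coord (i j) (v j)) • m (fun j => b (i j)) := by
  have : v = fun j => ∑ i, b.coord i (v j) • b i := by
    funext j
    simp [b.sum_repr]
  conv_lhs => rw [this, MultilinearMap.map_sum]
  simp only [MultilinearMap.map_smul_univ]

theorem sum_tmul_basis_independent (F : MultilinearMap 𝕜 (fun _ : Fin k => Module.Dual 𝕜 V) A)
    (m : MultilinearMap 𝕜 (fun _ : Fin k => V) N) :
    ∑ i : Fin k → Fin n', F (fun j => b'.coord (i j)) ⊗ₜ[𝕜] m (fun j => b' (i j)) =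
      ∑ i : Fin k → Fin n, F (fun j => b.coord (i j)) ⊗ₜ[𝕜] m (fun j => b (i j)) := by
  simp only [fun i : Fin k → Fin n' => multilinear_expand b m (fun j => b' (i j)),
    TensorProduct.tmul_sum, TensorProduct.tmul_smul, TensorProduct.smul_tmul']
  rw [Finset.sum_comm]
  refine Finset.sum_congr rfl fun a _ => ?_
  rw [← TensorProduct.sum_tmul, multilinear_expand_coord b' F]

variable [CharZero 𝕜]

/-- The alternating form `ω` as the multivector field
`(k!)⁻¹ ∑ ω(x^{i_1}, …, x^{i_k}) ∂/∂x^{i_1} ∧ ⋯ ∧ ∂/∂x^{i_k}`. -/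
def tensorOf (k : ℕ) : Module.Dual 𝕜 V [⋀^Fin k]→ₗ[𝕜] A →ₗ[𝕜] A ⊗[𝕜] ⋀[𝕜]^k V where
  toFun ω := (k.factorial : 𝕜)⁻¹ • ∑ i : Fin k → Fin n,
    ω (fun j => b.coord (i j)) ⊗ₜ exteriorPower.ιMulti 𝕜 k (fun j => b (i j))
  map_add' ω η := by
    simp only [AlternatingMap.add_apply, TensorProduct.add_tmul, Finset.sum_add_distrib, smul_add]
  map_smul' c ω := by
    simp only [AlternatingMap.smul_apply, ← TensorProduct.smul_tmul', ← Finset.smul_sum,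
      RingHom.id_apply, smul_comm c]

theorem tensorOf_apply (ω : Module.Dual 𝕜 V [⋀^Fin k]→ₗ[𝕜] A) :
    tensorOf b k ω = (k.factorial : 𝕜)⁻¹ • ∑ i : Fin k → Fin n,
      ω (fun j => b.coord (i j)) ⊗ₜ exteriorPower.ιMulti 𝕜 k (fun j => b (i j)) := rfl

theorem tensorOf_basis_independent (ω : Module.Dual 𝕜 V [⋀^Fin k]→ₗ[𝕜] A) :
    tensorOf b' k ω = tensorOf b k ω := by
  rw [tensorOf_apply, tensorOf_apply]
  exact congrArg _ (sum_tmul_basis_independent b b' ω.toMultilinearMap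
    (exteriorPower.ιMulti 𝕜 k).toMultilinearMap)

theorem factorial_inv_smul_sum_perm (k : ℕ) {x : N} {F : Equiv.Perm (Fin k) → N}
    (h : ∀ σ, F σ = x) : (k.factorial : 𝕜)⁻¹ • ∑ σ, F σ = x := by
  simp only [h, Finset.sum_const, Finset.card_univ, Fintype.card_perm, Fintype.card_fin]
  rw [← Nat.cast_smul_eq_nsmul 𝕜, smul_smul, inv_mul_cancel₀
    (by exact_mod_cast Nat.factorial_ne_zero k), one_smul]

/-- The form `ℓ ↦ det(ℓ_i(w_j)) f` belongs to the multivector field `f ⊗ w_1 ∧ ⋯ ∧ w_k`. -/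
theorem tensorOf_eq_tmul (ω : Module.Dual 𝕜 V [⋀^Fin k]→ₗ[𝕜] A) (f : A) (w : Fin k → V)
    (hω : ∀ ℓ, ω ℓ = ∑ σ : Equiv.Perm (Fin k), Equiv.Perm.sign σ • (∏ j, ℓ (σ j) (w j)) • f) :
    tensorOf b k ω = f ⊗ₜ exteriorPower.ιMulti 𝕜 k w := by
  rw [tensorOf_apply]
  simp only [hω, TensorProduct.sum_tmul]
  rw [Finset.sum_comm]
  refine factorial_inv_smul_sum_perm k fun σ => ?_
  have h1 : ∀ i : Fin k → Fin n, ∏ j, b.coord (i (σ j)) (w j) =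
      ∏ j, b.coord (i j) (w (σ⁻¹ j)) := fun i => by
    rw [← Equiv.prod_comp σ (fun j => b.coord (i j) (w (σ⁻¹ j)))]
    simp
  have h2 := multilinear_expand b (exteriorPower.ιMulti 𝕜 k).toMultilinearMap (w ∘ ⇑σ⁻¹)
  have h3 := (exteriorPower.ιMulti 𝕜 k).map_perm w σ⁻¹
  simp only [AlternatingMap.coe_multilinearMap, h3, Function.comp_apply] at h2
  have h4 : ∀ z : A ⊗[𝕜] ⋀[𝕜]^k V,
      Equiv.Perm.sign σ • Equiv.Perm.sign (σ⁻¹) • z = z := fun z => by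
    rw [smul_smul, Equiv.Perm.sign_inv, Int.units_mul_self, one_smul]
  simp only [Units.smul_def] at h4 h2 ⊢
  simp only [h1, ← TensorProduct.smul_tmul', ← Finset.smul_sum]
  rw [← h4 (f ⊗ₜ _), ← TensorProduct.tmul_smul, h2, TensorProduct.tmul_sum]
  simp only [TensorProduct.tmul_smul]

/-- The values of a form are recovered by pairing its multivector field with determinants. -/
theorem pairing_tensorOf (ω : Module.Dual 𝕜 V [⋀^Fin k]→ₗ[𝕜] A) (r : A →ₗ[𝕜] N)
    (x : Fin k → Module.Dual 𝕜 V) (φ : ⋀[𝕜]^k V →ₗ[𝕜] 𝕜)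
    (hφ : ∀ v, φ (exteriorPower.ιMulti 𝕜 k v) =
      ∑ σ : Equiv.Perm (Fin k), Equiv.Perm.sign σ • ∏ j, x j (v (σ j))) :
    TensorProduct.rid 𝕜 N (TensorProduct.map r φ (tensorOf b k ω)) = r (ω x) := by
  rw [tensorOf_apply]
  simp only [map_smul, map_sum, TensorProduct.map_tmul, TensorProduct.rid_tmul, hφ, Finset.sum_smul]
  rw [Finset.sum_comm]
  refine factorial_inv_smul_sum_perm k fun σ => ?_
  have h1 : ∀ i : Fin k → Fin n, ∏ j, x j (b (i (σ j))) = ∏ j, x (σ⁻¹ j) (b (i j)) := fun i => by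
    rw [← Equiv.prod_comp σ (fun j => x (σ⁻¹ j) (b (i j)))]
    simp
  have h2 := multilinear_expand_coord b ω.toMultilinearMap (x ∘ ⇑σ⁻¹)
  have h3 := ω.map_perm x σ⁻¹
  simp only [AlternatingMap.coe_multilinearMap, h3, Function.comp_apply] at h2
  have h4 : ∀ z : N, Equiv.Perm.sign σ • Equiv.Perm.sign (σ⁻¹) • z = z := fun z => by
    rw [smul_smul, Equiv.Perm.sign_inv, Int.units_mul_self, one_smul]
  simp only [Units.smul_def] at h4 h2 ⊢
  simp only [h1, smul_assoc, ← Finset.smul_sum]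
  rw [← h4 (r (ω x)), ← map_zsmul, h2, map_sum]
  simp only [map_smul]

end Contraction

section Classes

variable {𝕜 : Type*} [Field 𝕜] [CharZero 𝕜] {V : Type*} [AddCommGroup V] [Module 𝕜 V]
  {G : Type*} [Group G] [Fintype G] [DistribMulAction G V] [SMulCommClass G 𝕜 V]
  {n : ℕ} (b : Module.Basis (Fin n) 𝕜 V) {k : ℕ}

theorem freeze_twisted (g : G) (Ψ : Cochain 𝕜 (Poly 𝕜 V) (Poly 𝕜 V) k)
    (ℓ : Fin k → Module.Dual 𝕜 V) :
    (twisted 𝕜 V g).freeze (Poly.lin 𝕜) Ψ ℓ = frozen Ψ ℓ := by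
  classical
  rw [Bimod.freeze_apply, frozen]
  refine Finset.sum_nbij' (fun c => Finset.univ.filter fun j => c j = true)
    (fun s j => decide (j ∈ s)) (by simp) (by simp) (fun c _ => by ext; simp)
    (fun s _ => by ext; simp) (fun c _ => ?_)
  rw [twisted_l]
  congr 1
  · rw [← Finset.prod_subset (Finset.subset_univ ((Finset.univ.filter fun j => c j = true)ᶜ))]
    · refine Finset.prod_congr rfl fun j hj => ?_
      have : c j = false := by simpa using hj
      simp [Bimod.frozenCoeff, this]
    · intro j _ hj
      have : c j = true := by simpa using hj
      simp [Bimod.frozenCoeff, this]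
  · congr 1
    funext j
    by_cases h : c j = true <;> simp [Bimod.frozenArg, Finset.piecewise, h]

theorem mapL2At_eq (g : G) (Ψ : Cochain 𝕜 (Poly 𝕜 V) (Poly 𝕜 V) k) :
    mapL2At b k Ψ = tensorOf b k ((twisted 𝕜 V g).symbol (Poly.lin 𝕜) k Ψ) := by
  rw [mapL2At, tensorOf_apply, Finset.smul_sum]
  refine Finset.sum_congr rfl fun i _ => ?_
  rw [TensorProduct.smul_tmul', Bimod.symbol_apply]
  congr 2
  refine Fintype.sum_equiv (Equiv.inv _) _ _ fun σ => ?_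
  rw [freeze_twisted, Equiv.inv_apply, Equiv.Perm.sign_inv, Units.smul_def]
  rfl

/-- The class of a cochain of `Poly(V)` with values in the crossed product: its `g`-component in
`Γ(⋀^{k-l(g)} TV^g ⊗ ⋀^{l(g)} N^g)`. -/
def classAt (g : G) (k : ℕ) :
    Cochain 𝕜 (Poly 𝕜 V) (Crossed 𝕜 V G) k →ₗ[𝕜] SectionsAt 𝕜 V g k :=
  mapL3At g k ∘ₗ tensorOf b k ∘ₗ (twisted 𝕜 V g).symbol (Poly.lin 𝕜) k ∘ₗ
    (coeffAt 𝕜 V g).compMultilinearMapₗ 𝕜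

theorem classAt_apply (g : G) (Φ : Cochain 𝕜 (Poly 𝕜 V) (Crossed 𝕜 V G) k) :
    classAt b g k Φ = mapL3At g k (tensorOf b k
      ((twisted 𝕜 V g).symbol (Poly.lin 𝕜) k ((coeffAt 𝕜 V g).compMultilinearMap Φ))) := rfl

theorem mapL_apply (g : G) (Ψ : Cochain 𝕜 (Crossed 𝕜 V G) (Crossed 𝕜 V G) k) :
    mapL b k Ψ g = classAt b g k (mapL1 𝕜 V G k Ψ).1 := by
  rw [mapL, classAt_apply, mapL2At_eq b g]

theorem smul_lin (h : G) (ℓ : Module.Dual 𝕜 V) :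
    h • Poly.lin 𝕜 ℓ = Poly.lin 𝕜 (ℓ ∘ₗ act 𝕜 h⁻¹) := by
  rw [smul_poly_def, Poly.comap_lin]

theorem coeffAt_conj (h g : G) (c : Crossed 𝕜 V G) :
    h • coeffAt 𝕜 V g (U 𝕜 V h⁻¹ * c * U 𝕜 V h) = coeffAt 𝕜 V (h * g * h⁻¹) c := by
  classical
  induction c using SkewMonoidAlgebra.induction_on with
  | zero => simp
  | single g' a =>
    simp only [U, SkewMonoidAlgebra.single_mul_single, one_mul, smul_one, mul_one]
    by_cases hg : h⁻¹ * g' * h = g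
    · have : h * g * h⁻¹ = g' := by rw [← hg]; group
      simp [coeffAt, hg, this]
    · have : ¬ (g' = h * g * h⁻¹) := fun h' => hg (by rw [h']; group)
      simp [coeffAt, SkewMonoidAlgebra.coeff_single, hg, this]
  | add a b ha hb => simp only [mul_add, add_mul, map_add, smul_add, ha, hb]

/-- Conjugating a cochain by `h` carries the component at `hgh⁻¹` to the component at `g`; so it
does for the symbols. -/
theorem symbol_conj (h g : G) (Φ : Cochain 𝕜 (Poly 𝕜 V) (Crossed 𝕜 V G) k)
    (ℓ : Fin k → Module.Dual 𝕜 V) :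
    (twisted 𝕜 V (h * g * h⁻¹)).symbol (Poly.lin 𝕜) k
      ((coeffAt 𝕜 V (h * g * h⁻¹)).compMultilinearMap Φ) (fun j => ℓ j ∘ₗ act 𝕜 h⁻¹) =
    h • (twisted 𝕜 V g).symbol (Poly.lin 𝕜) k ((coeffAt 𝕜 V g).compMultilinearMap
      (conj h k Φ)) ℓ := by
  rw [Bimod.symbol_apply, Bimod.symbol_apply, Finset.smul_sum]
  refine Finset.sum_congr rfl fun σ _ => ?_
  rw [smul_comm h]
  congr 1
  rw [Bimod.freeze_apply, Bimod.freeze_apply, Finset.smul_sum]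
  refine Finset.sum_congr rfl fun c _ => ?_
  have h1 : ∀ (c : Bool) (ℓ : Module.Dual 𝕜 V), h • Bimod.frozenCoeff (Poly.lin 𝕜) c ℓ =
      Bimod.frozenCoeff (Poly.lin 𝕜) c (ℓ ∘ₗ act 𝕜 h⁻¹) := by
    intro c ℓ; cases c <;> simp [Bimod.frozenCoeff, smul_lin]
  have h2 : ∀ (c : Bool) (ℓ : Module.Dual 𝕜 V), h • Bimod.frozenArg (Poly.lin 𝕜) c ℓ =
      Bimod.frozenArg (Poly.lin 𝕜) c (ℓ ∘ₗ act 𝕜 h⁻¹) := by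
    intro c ℓ; cases c <;> simp [Bimod.frozenArg, smul_lin]
  simp only [twisted_l, LinearMap.compMultilinearMap_apply, conj_apply, smul_mul', coeffAt_conj,
    Finset.smul_prod', h1, h2]

/-- The class of a cochain is equivariant. -/
theorem toMultivector_classAt (h g : G) (Φ : Cochain 𝕜 (Poly 𝕜 V) (Crossed 𝕜 V G) k) :
    toMultivector 𝕜 V (h * g * h⁻¹) k (classAt b (h * g * h⁻¹) k Φ) =
      pushMultivector 𝕜 V h (toMultivector 𝕜 V g k (classAt b g k (conj h k Φ))) := by
  let b' := b.map (DistribMulAction.toLinearEquiv 𝕜 V h)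
  have hb : ∀ i, b' i = h • b i := fun i => by simp [b']
  have hb' : ∀ i, b'.coord i = b.coord i ∘ₗ act 𝕜 h⁻¹ := fun i => by
    refine b'.ext fun j => ?_
    rw [Module.Basis.coord_apply, Module.Basis.repr_self, hb]
    simp
  rw [classAt_apply, classAt_apply, ← tensorOf_basis_independent b b', tensorOf_apply,
    tensorOf_apply]
  simp only [map_smul, map_sum, hb, hb', symbol_conj, toMultivector_mapL3At_push]

theorem comap_tensorOf_eq_zero {g : G} (ω : Module.Dual 𝕜 V [⋀^Fin k]→ₗ[𝕜] Poly 𝕜 V)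
    (h : ∀ v, Poly.comap (fixedSpace 𝕜 V g).subtype (ω v) = 0) :
    mapL3At g k (tensorOf b k ω) = 0 := by
  funext p
  rw [tensorOf_apply, map_smul, map_sum, Pi.smul_apply, Finset.sum_apply, Finset.sum_eq_zero,
    smul_zero, Pi.zero_apply]
  intro i _
  rw [mapL3At, LinearMap.pi_apply, TensorProduct.map_tmul, AlgHom.toLinearMap_apply, h,
    TensorProduct.zero_tmul]

/-- If the multivector field of a form has trivial component in `⋀^p V^g ⊗ ⋀^l N^g` over `V^g`,
then the form vanishes there on `p` functionals of `V^g` and `l` of `N^g`: pair with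
determinants. -/
theorem comap_apply_splitForms_eq_zero {g : G} (ω : Module.Dual 𝕜 V [⋀^Fin k]→ₗ[𝕜] Poly 𝕜 V)
    (h : mapL3At g k (tensorOf b k ω) = 0) (p : Deg k (codim 𝕜 V g))
    (x : Fin p.1 → Module.Dual 𝕜 (fixedSpace 𝕜 V g))
    (y : Fin (codim 𝕜 V g) → Module.Dual 𝕜 (normalSpace 𝕜 V g)) :
    Poly.comap (fixedSpace 𝕜 V g).subtype (ω (splitForms p x y)) = 0 := by
  let X : MultilinearMap 𝕜 (fun _ : Fin p.1 => fixedSpace 𝕜 V g) 𝕜 :=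
    (MultilinearMap.mkPiAlgebra 𝕜 (Fin p.1) 𝕜).compLinearMap x
  let Y : MultilinearMap 𝕜 (fun _ : Fin (codim 𝕜 V g) => normalSpace 𝕜 V g) 𝕜 :=
    (MultilinearMap.mkPiAlgebra 𝕜 (Fin (codim 𝕜 V g)) 𝕜).compLinearMap y
  let ψ := LinearMap.mul' 𝕜 𝕜 ∘ₗ TensorProduct.map
    (exteriorPower.alternatingMapLinearEquiv (MultilinearMap.alternatization X))
    (exteriorPower.alternatingMapLinearEquiv (MultilinearMap.alternatization Y))
  have h1 := pairing_tensorOf b ω (Poly.comap (fixedSpace 𝕜 V g).subtype).toLinearMap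
    (splitForms p x y) (ψ ∘ₗ projWedge g p) (fun v => by
      have h2 : (exteriorPower.alternatingMapLinearEquiv
          (MultilinearMap.alternatization X)).compAlternatingMap
          ((exteriorPower.ιMulti 𝕜 (p.1 : ℕ)).compLinearMap (projFixed 𝕜 V g)) =
          MultilinearMap.alternatization (X.compLinearMap fun _ => projFixed 𝕜 V g) := by
        ext v
        simp [MultilinearMap.alternatization_apply,
          exteriorPower.alternatingMapLinearEquiv_apply_ιMulti]
      have h3 : (exteriorPower.alternatingMapLinearEquiv
          (MultilinearMap.alternatization Y)).compAlternatingMap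
          ((exteriorPower.ιMulti 𝕜 (codim 𝕜 V g)).compLinearMap (projNormal 𝕜 V g)) =
          MultilinearMap.alternatization (Y.compLinearMap fun _ => projNormal 𝕜 V g) := by
        ext v
        simp [MultilinearMap.alternatization_apply,
          exteriorPower.alternatingMapLinearEquiv_apply_ιMulti]
      rw [LinearMap.comp_apply, projWedge_ιMulti, LinearMap.comp_apply, map_domCoprod, h2, h3,
        ← MultilinearMap.domCoprod_alternization, MultilinearMap.alternatization_apply, map_sum]
      refine Fintype.sum_equiv (Equiv.permCongr p.slots) _ _ fun σ => ?_
      rw [Equiv.Perm.sign_permCongr, Units.smul_def, Units.smul_def, map_zsmul]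
      congr 1
      rw [← Equiv.prod_comp p.slots, Fintype.prod_sum_type]
      simp [X, Y, splitForms])
  have h4 : TensorProduct.map (Poly.comap (fixedSpace 𝕜 V g).subtype).toLinearMap
      (projWedge g p) (tensorOf b k ω) = 0 := congrFun h p
  have h5 := TensorProduct.map_comp LinearMap.id ψ
    (Poly.comap (fixedSpace 𝕜 V g).subtype).toLinearMap (projWedge g p)
  rw [LinearMap.id_comp] at h5
  rw [h5, LinearMap.comp_apply, h4, map_zero, map_zero] at h1
  exact h1.symm

end Classes

/-! ### Products of twisted derivations -/

section TwistedDerivations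

variable {𝕜 : Type*} [Field 𝕜] [CharZero 𝕜] {V : Type*} [AddCommGroup V] [Module 𝕜 V]
  {G : Type*} [Group G] [Fintype G] [DistribMulAction G V] [SMulCommClass G 𝕜 V]

/-- An alternating sum of neighbouring pairs telescopes. -/
theorem sum_alternating_add {A : Type*} [AddCommGroup A] [Module 𝕜 A] {k : ℕ}
    (E : Fin (k + 1) → A) :
    ∑ i : Fin k, (-1 : 𝕜) ^ ((i : ℕ) + 1) • (E i.castSucc + E i.succ) =
      -E 0 + (-1 : 𝕜) ^ k • E (Fin.last k) := by
  induction k with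
  | zero => simp
  | succ k ih =>
    have h := ih (fun i => E i.castSucc)
    rw [Fin.sum_univ_castSucc]
    simp only [Fin.val_castSucc, Fin.succ_castSucc, Fin.val_last, Fin.castSucc_zero] at h ⊢
    rw [h, pow_succ, Fin.succ_last]
    simp

/-- The cochain `(f_1, …, f_k) ↦ c δ_1(f_1) ⋯ δ_k(f_k)`. -/
def prodCochain {k : ℕ} (c : Poly 𝕜 V) (δ : Fin k → Poly 𝕜 V →ₗ[𝕜] Poly 𝕜 V) :
    Cochain 𝕜 (Poly 𝕜 V) (Poly 𝕜 V) k :=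
  (LinearMap.mulLeft 𝕜 c).compMultilinearMap
    ((MultilinearMap.mkPiAlgebra 𝕜 (Fin k) (Poly 𝕜 V)).compLinearMap δ)

theorem prodCochain_apply {k : ℕ} (c : Poly 𝕜 V) (δ : Fin k → Poly 𝕜 V →ₗ[𝕜] Poly 𝕜 V)
    (f : Fin k → Poly 𝕜 V) : prodCochain c δ f = c * ∏ j, δ j (f j) := by
  simp [prodCochain]

/-- A product of twisted derivations is a cocycle of `Poly(V) U_g`, if the twists fit together:
`δ_j` has the left twist `α_j` and the right twist `α_{j+1}`, where `α_0` is the identity and the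
last twist is `g`. -/
theorem d_prodCochain (g : G) {k : ℕ} (c : Poly 𝕜 V) (δ : Fin k → Poly 𝕜 V →ₗ[𝕜] Poly 𝕜 V)
    (α : Fin (k + 1) → Poly 𝕜 V → Poly 𝕜 V)
    (h : ∀ j a b, δ j (a * b) = α j.castSucc a * δ j b + δ j a * α j.succ b)
    (h0 : ∀ a, α 0 a = a) (hk : ∀ a, α (Fin.last k) a = g • a) :
    (twisted 𝕜 V g).d k (prodCochain c δ) = 0 := by
  ext a
  -- The `i`-th argument is twisted, the others are differentiated. By the Leibniz rule, the `i`-th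
  -- inner face is `E i + E (i + 1)`, and the outer faces are the first and the last `E i`.
  let E : Fin (k + 1) → Poly 𝕜 V := fun i => c * (α i (a i) * ∏ j, δ j (a (i.succAbove j)))
  have h1 : ∀ i : Fin k, prodCochain c δ (Fin.contractNth i.castSucc (· * ·) a) =
      E i.castSucc + E i.succ := by
    intro i
    have h2 : ∀ j ∈ Finset.univ.erase i, δ j (Fin.contractNth i.castSucc (· * ·) a j) =
        δ j (a (i.castSucc.succAbove j)) := by
      intro j hj
      rcases lt_or_gt_of_ne (Finset.ne_of_mem_erase hj) with hlt | hlt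
      · rw [Fin.succAbove_of_castSucc_lt _ _ (Fin.castSucc_lt_castSucc_iff.2 hlt)]
        simp [Fin.contractNth, hlt]
      · rw [Fin.succAbove_of_le_castSucc _ _ (Fin.castSucc_le_castSucc_iff.2 hlt.le)]
        have h1 : ¬ ((j : ℕ) < i) := by simpa using hlt.le
        have h2 : (j : ℕ) ≠ i := fun h => (Finset.ne_of_mem_erase hj) (Fin.ext h)
        simp [Fin.contractNth, h1, h2]
    have h3 : ∀ j ∈ Finset.univ.erase i, δ j (a (i.succ.succAbove j)) =
        δ j (a (i.castSucc.succAbove j)) := by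
      intro j hj
      rcases lt_or_gt_of_ne (Finset.ne_of_mem_erase hj) with hlt | hlt
      · rw [Fin.succAbove_of_castSucc_lt _ _ (Fin.castSucc_lt_castSucc_iff.2 hlt),
          Fin.succAbove_of_castSucc_lt _ _ (by
            rw [Fin.lt_def] at hlt ⊢
            simp only [Fin.val_castSucc, Fin.val_succ]
            omega)]
      · rw [Fin.succAbove_of_le_castSucc _ _ (Fin.castSucc_le_castSucc_iff.2 hlt.le),
          Fin.succAbove_of_le_castSucc _ _ (by
            rw [Fin.lt_def] at hlt
            rw [Fin.le_def]
            simp only [Fin.val_castSucc, Fin.val_succ]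
            omega)]
    have h4 : Fin.contractNth i.castSucc (· * ·) a i = a i.castSucc * a i.succ := by
      simp [Fin.contractNth]
    simp only [prodCochain_apply, E]
    rw [← Finset.mul_prod_erase _ _ (Finset.mem_univ i), Finset.prod_congr rfl h2,
      ← Finset.mul_prod_erase Finset.univ (fun j => δ j (a (i.castSucc.succAbove j)))
        (Finset.mem_univ i),
      ← Finset.mul_prod_erase Finset.univ (fun j => δ j (a (i.succ.succAbove j)))
        (Finset.mem_univ i), Finset.prod_congr rfl h3, h4, h, Fin.succAbove_castSucc_self,
      Fin.succAbove_succ_self]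
    ring
  have h5 := sum_alternating_add (𝕜 := 𝕜) E
  simp only [← h1] at h5
  rw [Bimod.d_apply, h5, twisted_l, twisted_r, prodCochain_apply, prodCochain_apply]
  have h6 : E 0 = a 0 * (c * ∏ j, δ j (Fin.tail a j)) := by
    simp only [E, h0, Fin.succAbove_zero, Fin.tail]; ring
  have h7 : E (Fin.last k) = g • a (Fin.last k) * (c * ∏ j, δ j (Fin.init a j)) := by
    have : ∏ j, δ j (a ((Fin.last k).succAbove j)) = ∏ j, δ j (Fin.init a j) :=
      Finset.prod_congr rfl fun j _ => by rw [Fin.succAbove_last_apply]; rfl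
    simp only [E, hk]
    rw [this]
    ring
  rw [← h6, ← h7, pow_succ]
  simp

/-- The symbol of a product of operators `δ_j` acting on linear functionals as differentiation along
`w_j`. -/
theorem tensorOf_symbol_prodCochain (g : G) {k n : ℕ} (b : Module.Basis (Fin n) 𝕜 V)
    (c : Poly 𝕜 V) (δ : Fin k → Poly 𝕜 V →ₗ[𝕜] Poly 𝕜 V) (w : Fin k → V) (h1 : ∀ j, δ j 1 = 0)
    (h : ∀ j ℓ, δ j (Poly.lin 𝕜 ℓ) = algebraMap 𝕜 _ (ℓ (w j))) :
    tensorOf b k ((twisted 𝕜 V g).symbol (Poly.lin 𝕜) k (prodCochain c δ)) =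
      c ⊗ₜ exteriorPower.ιMulti 𝕜 k w := by
  refine tensorOf_eq_tmul b _ c w fun ℓ => ?_
  rw [Bimod.symbol_apply]
  refine Finset.sum_congr rfl fun σ _ => ?_
  congr 1
  rw [freeze_twisted, frozen, Finset.sum_eq_single Finset.univ]
  · simp [prodCochain_apply, h, Algebra.smul_def, mul_comm]
  · intro s _ hs
    obtain ⟨j, hj⟩ : ∃ j, j ∉ s := by
      by_contra! hc
      exact hs (Finset.eq_univ_iff_forall.2 hc)
    rw [prodCochain_apply, Finset.prod_eq_zero (Finset.mem_univ j), mul_zero, mul_zero]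
    simp [hj, h1]
  · simp

end TwistedDerivations

/-! ### The twisted cocycles -/

section Cocycles

variable {𝕜 : Type*} [Field 𝕜] [CharZero 𝕜] {V : Type*} [AddCommGroup V] [Module 𝕜 V]
  {G : Type*} [Group G] [Fintype G] [DistribMulAction G V] [SMulCommClass G 𝕜 V]
  {g : G} (e : Module.Basis (Fin (codim 𝕜 V g)) 𝕜 (normalSpace 𝕜 V g))

/-- The twisted Leibniz rule for divided differences. -/
theorem divDiff_mul (σ : Equiv.Perm (Fin (codim 𝕜 V g))) (j : Fin (codim 𝕜 V g))
    (a b : Poly 𝕜 V) : divDiff e σ j (a * b) =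
      Poly.comap (zPoint e σ j) a * divDiff e σ j b +
        divDiff e σ j a * Poly.comap (zPoint e σ (j + 1)) b := by
  apply mul_left_cancel₀ (lin_ne_zero e (σ j))
  rw [mul_add, mul_left_comm, ← mul_assoc _ (divDiff e σ j a), lin_mul_divDiff, lin_mul_divDiff,
    lin_mul_divDiff, map_mul, map_mul]
  ring

theorem divDiff_lin (σ : Equiv.Perm (Fin (codim 𝕜 V g))) (j : Fin (codim 𝕜 V g))
    (ℓ : Module.Dual 𝕜 V) : divDiff e σ j (Poly.lin 𝕜 ℓ) = algebraMap 𝕜 _ (ℓ (e (σ j) : V)) := by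
  apply mul_left_cancel₀ (lin_ne_zero e (σ j))
  rw [lin_mul_divDiff, Poly.comap_lin, Poly.comap_lin, ← map_sub, mul_comm, ← Algebra.smul_def,
    ← map_smul]
  congr 1
  ext v
  have := congrArg ℓ (zPoint_sub e σ j v)
  simp only [map_sub, map_smul, smul_eq_mul] at this
  simp [this, mul_comm]

theorem divDiff_one (σ : Equiv.Perm (Fin (codim 𝕜 V g))) (j : Fin (codim 𝕜 V g)) :
    divDiff e σ j 1 = 0 := by
  have := divDiff_mul e σ j 1 1
  simpa using this

theorem Poly.deriv_one (v : V) : Poly.deriv v (1 : Poly 𝕜 V) = 0 := by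
  have := Poly.deriv_mul v (1 : Poly 𝕜 V) 1
  simpa using this

theorem zPoint_zero (σ : Equiv.Perm (Fin (codim 𝕜 V g))) : zPoint e σ 0 = LinearMap.id := by
  ext v
  have h := sum_yCoord_smul e v
  have h' := projFixed_add_projNormal (𝕜 := 𝕜) (g := g) v
  simp [zPoint, zMap, h, h']

theorem zPoint_codim (σ : Equiv.Perm (Fin (codim 𝕜 V g))) :
    zPoint e σ (codim 𝕜 V g) = act 𝕜 g⁻¹ := by
  ext v
  have h := sum_yCoord_smul e (g⁻¹ • v)
  have h' := projFixed_add_projNormal (𝕜 := 𝕜) (g := g) (g⁻¹ • v)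
  rw [projFixed_inv_smul] at h'
  simp [zPoint, zMap, yTilde, h, h']

variable {k : ℕ} (p : Deg k (codim 𝕜 V g))

/-- The operators `∂_{u_1}, …, ∂_{u_p}`, followed by the divided differences of `Ω_g`. -/
def cocycleFactor (u : Fin p.1 → fixedSpace 𝕜 V g) (σ : Equiv.Perm (Fin (codim 𝕜 V g)))
    (j : Fin k) : Poly 𝕜 V →ₗ[𝕜] Poly 𝕜 V :=
  Sum.elim (fun a => Poly.deriv (u a : V)) (fun i => divDiff e σ i) (p.slots.symm j)

/-- The cocycle of a decomposable multivector field is a sum of products of twisted derivations. -/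
theorem sharp_fieldOp (f : Poly 𝕜 (fixedSpace 𝕜 V g)) (u : Fin p.1 → fixedSpace 𝕜 V g) :
    sharp p (twistedCocycle e) (fieldOp g p.1 (f ⊗ₜ exteriorPower.ιMulti 𝕜 (p.1 : ℕ) u)) =
      ((p.1 : ℕ).factorial : 𝕜)⁻¹ • ∑ τ : Equiv.Perm (Fin p.1), (Equiv.Perm.sign τ : ℤ) •
        ((codim 𝕜 V g).factorial : 𝕜)⁻¹ • ∑ σ : Equiv.Perm (Fin (codim 𝕜 V g)),
          (Equiv.Perm.sign σ : ℤ) • prodCochain (Poly.comap (projFixed 𝕜 V g) f)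
            (cocycleFactor e p (u ∘ τ) σ) := by
  ext a
  have h : ∀ (τ : Equiv.Perm (Fin p.1)) (σ : Equiv.Perm (Fin (codim 𝕜 V g))),
      prodCochain (Poly.comap (projFixed 𝕜 V g) f) (cocycleFactor e p (u ∘ τ) σ) a =
      Poly.comap (projFixed 𝕜 V g) f *
        ((∏ i, Poly.deriv (u (τ i) : V) (a (p.slots (Sum.inl i)))) *
          ∏ i, divDiff e σ i (a (p.slots (Sum.inr i)))) := by
    intro τ σ
    rw [prodCochain_apply, ← Equiv.prod_comp p.slots, Fintype.prod_sum_type]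
    simp [cocycleFactor]
  have h1 : sharp p (twistedCocycle e) (fieldOp g p.1
      (f ⊗ₜ exteriorPower.ιMulti 𝕜 (p.1 : ℕ) u)) a =
      fieldOp g p.1 (f ⊗ₜ exteriorPower.ιMulti 𝕜 (p.1 : ℕ) u) (fun i => a (p.slots (Sum.inl i))) *
      twistedCocycle e (fun i => a (p.slots (Sum.inr i))) := rfl
  have h2 : fieldOp g p.1 (f ⊗ₜ exteriorPower.ιMulti 𝕜 (p.1 : ℕ) u)
      (fun i => a (p.slots (Sum.inl i))) = Poly.comap (projFixed 𝕜 V g) f *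
      ((p.1 : ℕ).factorial : 𝕜)⁻¹ • ∑ τ : Equiv.Perm (Fin p.1), (Equiv.Perm.sign τ : ℤ) •
        ∏ i, Poly.deriv (u (τ i) : V) (a (p.slots (Sum.inl i))) := by
    have : multivectorOp g p.1 (exteriorPower.ιMulti 𝕜 (p.1 : ℕ) u) =
        ((p.1 : ℕ).factorial : 𝕜)⁻¹ • ∑ τ : Equiv.Perm (Fin p.1), (Equiv.Perm.sign τ : ℤ) •
          (MultilinearMap.mkPiAlgebra 𝕜 (Fin p.1) (Poly 𝕜 V)).compLinearMap
            (fun i => Poly.deriv (u (τ i) : V)) := by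
      rw [multivectorOp, LinearMap.smul_apply,
        exteriorPower.alternatingMapLinearEquiv_apply_ιMulti, MultilinearMap.alternatization_apply]
      rfl
    change Poly.comap (projFixed 𝕜 V g) f *
      (multivectorOp g p.1 (exteriorPower.ιMulti 𝕜 (p.1 : ℕ) u)) _ = _
    rw [this]
    simp
  rw [h1, h2]
  simp only [twistedCocycle, _root_.smul_apply, _root_.sum_apply, h,
    MultilinearMap.compLinearMap_apply, MultilinearMap.mkPiAlgebra_apply]
  simp only [Finset.mul_sum, Finset.sum_mul, smul_mul_assoc, mul_smul_comm, Finset.smul_sum,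
    mul_assoc]
  rw [Finset.sum_comm]
  refine Finset.sum_congr rfl fun τ _ => Finset.sum_congr rfl fun σ _ => ?_
  rw [smul_comm (Equiv.Perm.sign σ : ℤ), smul_comm (Equiv.Perm.sign σ : ℤ),
    smul_comm ((codim 𝕜 V g).factorial : 𝕜)⁻¹, smul_comm ((codim 𝕜 V g).factorial : 𝕜)⁻¹]

theorem d_prodCochain_cocycleFactor (c : Poly 𝕜 V) (u : Fin p.1 → fixedSpace 𝕜 V g)
    (σ : Equiv.Perm (Fin (codim 𝕜 V g))) :
    (twisted 𝕜 V g).d k (prodCochain c (cocycleFactor e p u σ)) = 0 := by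
  have hp := p.2
  -- The twists pull back along `z_σ^{j-p}`; truncated subtraction gives the identity for `j ≤ p`,
  -- as the first `p` factors are derivations.
  refine d_prodCochain g c _ (fun j => Poly.comap (zPoint e σ ((j : ℕ) - p.1))) ?_ ?_ ?_
  · intro j a b
    obtain ⟨s, rfl⟩ := p.slots.surjective j
    rcases s with i | i
    · have h1 : ((p.slots (Sum.inl i) : Fin k) : ℕ) = i := by simp [Deg.slots]
      have h2 : (i : ℕ) - p.1 = 0 := by omega
      have h3 : (i : ℕ) + 1 - p.1 = 0 := by omega
      simp only [cocycleFactor, Equiv.symm_apply_apply, Sum.elim_inl, Fin.val_castSucc,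
        Fin.val_succ, h1, h2, h3, zPoint_zero, Poly.comap_id, Poly.deriv_mul]
    · have h1 : ((p.slots (Sum.inr i) : Fin k) : ℕ) = p.1 + i := by simp [Deg.slots]
      have h2 : (p.1 : ℕ) + i - p.1 = i := by omega
      have h3 : (p.1 : ℕ) + i + 1 - p.1 = i + 1 := by omega
      simp only [cocycleFactor, Equiv.symm_apply_apply, Sum.elim_inr, Fin.val_castSucc,
        Fin.val_succ, h1, h2, h3, divDiff_mul]
  · intro a
    simp [zPoint_zero, Poly.comap_id]
  · intro a
    have : k - (p.1 : ℕ) = codim 𝕜 V g := by omega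
    rw [Fin.val_last, this, zPoint_codim, smul_poly_def]

theorem d_mapT1At (ξ : SectionsAt 𝕜 V g k) : (twisted 𝕜 V g).d k (mapT1At e k ξ) = 0 := by
  have key : ∀ p : Deg k (codim 𝕜 V g), (twisted 𝕜 V g).d k ∘ₗ sharp p (twistedCocycle e) ∘ₗ
      fieldOp g p.1 = 0 := by
    intro p
    refine TensorProduct.ext (LinearMap.ext fun f => ?_)
    refine exteriorPower.linearMap_ext (AlternatingMap.ext fun u => ?_)
    change (twisted 𝕜 V g).d k (sharp p (twistedCocycle e) (fieldOp g p.1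
      (f ⊗ₜ exteriorPower.ιMulti 𝕜 (p.1 : ℕ) u))) = 0
    rw [sharp_fieldOp]
    simp only [map_smul, map_sum, map_zsmul, d_prodCochain_cocycleFactor, smul_zero,
      Finset.sum_const_zero]
  rw [mapT1At, LinearMap.sum_apply, map_sum]
  refine Finset.sum_eq_zero fun p _ => ?_
  exact LinearMap.congr_fun (key p) (divideLambda e _ (ξ p))

theorem ιMulti_eq_det_smul (w : Fin (codim 𝕜 V g) → normalSpace 𝕜 V g) :
    exteriorPower.ιMulti 𝕜 (codim 𝕜 V g) w =
      e.det w • exteriorPower.ιMulti 𝕜 (codim 𝕜 V g) e := by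
  have : exteriorPower.ιMulti 𝕜 (codim 𝕜 V g) = (LinearMap.toSpanSingleton 𝕜 _
      (exteriorPower.ιMulti 𝕜 (codim 𝕜 V g) e)).compAlternatingMap e.det := by
    refine e.ext_alternating fun v hv => ?_
    let σ := Equiv.ofBijective v (Finite.injective_iff_bijective.1 hv)
    have h1 := (exteriorPower.ιMulti 𝕜 (codim 𝕜 V g)).map_perm e σ
    have h2 := e.det.map_perm e σ
    change exteriorPower.ιMulti 𝕜 (codim 𝕜 V g) (e ∘ σ) = e.det (e ∘ σ) • _
    rw [h1, h2, e.det_self]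
    simp only [Units.smul_def]
    rw [smul_assoc, one_smul]
  exact congrArg (fun F => F w) this

theorem mapL3At_tensorOf_cocycleFactor {n : ℕ} (b : Module.Basis (Fin n) 𝕜 V)
    (f : Poly 𝕜 (fixedSpace 𝕜 V g)) (u : Fin p.1 → fixedSpace 𝕜 V g)
    (τ : Equiv.Perm (Fin p.1)) (σ : Equiv.Perm (Fin (codim 𝕜 V g))) :
    mapL3At g k (tensorOf b k ((twisted 𝕜 V g).symbol (Poly.lin 𝕜) k
      (prodCochain (Poly.comap (projFixed 𝕜 V g) f) (cocycleFactor e p (u ∘ τ) σ)))) p =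
    (Equiv.Perm.sign τ : ℤ) • (Equiv.Perm.sign σ : ℤ) •
      (f ⊗ₜ (exteriorPower.ιMulti 𝕜 (p.1 : ℕ) u ⊗ₜ
        exteriorPower.ιMulti 𝕜 (codim 𝕜 V g) e)) := by
  have h3 := (exteriorPower.ιMulti 𝕜 (p.1 : ℕ)).map_perm u τ
  have h4 := (exteriorPower.ιMulti 𝕜 (codim 𝕜 V g)).map_perm e σ
  have h5 : Poly.comap (fixedSpace 𝕜 V g).subtype (Poly.comap (projFixed 𝕜 V g) f) = f := by
    rw [Poly.comap_comap]
    have : projFixed 𝕜 V g ∘ₗ (fixedSpace 𝕜 V g).subtype = LinearMap.id :=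
      LinearMap.ext fun v => projFixed_coe v
    rw [this, Poly.comap_id]
  rw [tensorOf_symbol_prodCochain g b _ _ (splitVectors p (u ∘ τ) (e ∘ σ)) ?_ ?_]
  · rw [mapL3At, LinearMap.pi_apply, TensorProduct.map_tmul, projWedge_splitVectors, h3, h4,
      AlgHom.toLinearMap_apply, h5]
    simp only [Units.smul_def, TensorProduct.tmul_smul, ← TensorProduct.smul_tmul']
    rw [smul_comm]
  · intro j
    obtain ⟨s, rfl⟩ := p.slots.surjective j
    rcases s with i | i <;> simp [cocycleFactor, Poly.deriv_one, divDiff_one]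
  · intro j ℓ
    obtain ⟨s, rfl⟩ := p.slots.surjective j
    rcases s with i | i <;> simp [cocycleFactor, Poly.deriv_lin, divDiff_lin, splitVectors]

/-- The component at `p` of `L_3 ∘ L_2`, as a linear map on cochains. -/
def componentOf {n : ℕ} (b : Module.Basis (Fin n) 𝕜 V) :
    Cochain 𝕜 (Poly 𝕜 V) (Poly 𝕜 V) k →ₗ[𝕜] Poly 𝕜 (fixedSpace 𝕜 V g) ⊗[𝕜]
      (⋀[𝕜]^(p.1 : ℕ) (fixedSpace 𝕜 V g) ⊗[𝕜] ⋀[𝕜]^(codim 𝕜 V g) (normalSpace 𝕜 V g)) :=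
  LinearMap.proj p ∘ₗ mapL3At g k ∘ₗ tensorOf b k ∘ₗ (twisted 𝕜 V g).symbol (Poly.lin 𝕜) k

theorem componentOf_sharp_fieldOp {n : ℕ} (b : Module.Basis (Fin n) 𝕜 V)
    (f : Poly 𝕜 (fixedSpace 𝕜 V g)) (u : Fin p.1 → fixedSpace 𝕜 V g) :
    componentOf p b (sharp p (twistedCocycle e)
      (fieldOp g p.1 (f ⊗ₜ exteriorPower.ιMulti 𝕜 (p.1 : ℕ) u))) =
      f ⊗ₜ (exteriorPower.ιMulti 𝕜 (p.1 : ℕ) u ⊗ₜ exteriorPower.ιMulti 𝕜 (codim 𝕜 V g) e) := by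
  have h : ∀ (τ : Equiv.Perm (Fin p.1)) (σ : Equiv.Perm (Fin (codim 𝕜 V g))),
      componentOf p b (prodCochain (Poly.comap (projFixed 𝕜 V g) f)
        (cocycleFactor e p (u ∘ τ) σ)) = (Equiv.Perm.sign τ : ℤ) • (Equiv.Perm.sign σ : ℤ) •
          (f ⊗ₜ (exteriorPower.ιMulti 𝕜 (p.1 : ℕ) u ⊗ₜ
            exteriorPower.ιMulti 𝕜 (codim 𝕜 V g) e)) := mapL3At_tensorOf_cocycleFactor e p b f u
  generalize componentOf p b = F at h ⊢
  rw [sharp_fieldOp, map_smul, map_sum]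
  refine factorial_inv_smul_sum_perm _ fun τ => ?_
  rw [map_zsmul, map_smul, map_sum]
  simp only [map_zsmul, h]
  rw [smul_comm, Finset.smul_sum]
  refine factorial_inv_smul_sum_perm (𝕜 := 𝕜) _ fun σ => ?_
  rcases Int.units_eq_one_or (Equiv.Perm.sign σ) with hσ | hσ <;>
    rcases Int.units_eq_one_or (Equiv.Perm.sign τ) with hτ | hτ <;> simp [hσ, hτ]

/-- `L_2` followed by `L_3` recovers the multivector field from its cocycle. -/
theorem mapL3At_tensorOf_mapT1At {n : ℕ} (b : Module.Basis (Fin n) 𝕜 V)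
    (ξ : SectionsAt 𝕜 V g k) :
    mapL3At g k (tensorOf b k ((twisted 𝕜 V g).symbol (Poly.lin 𝕜) k (mapT1At e k ξ))) = ξ := by
  have key : ∀ p : Deg k (codim 𝕜 V g), (componentOf p b ∘ₗ sharp p (twistedCocycle e) ∘ₗ
      fieldOp g p.1) ∘ₗ divideLambda e p.1 = LinearMap.id := by
    intro p
    refine sectionTensor_ext fun f u w => ?_
    have h1 : divideLambda e p.1 (f ⊗ₜ (exteriorPower.ιMulti 𝕜 (p.1 : ℕ) u ⊗ₜ
        exteriorPower.ιMulti 𝕜 (codim 𝕜 V g) w)) =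
        e.det w • (f ⊗ₜ exteriorPower.ιMulti 𝕜 (p.1 : ℕ) u) := by
      simp [divideLambda, exteriorPower.alternatingMapLinearEquiv_apply_ιMulti]
    rw [LinearMap.comp_apply, h1, map_smul, LinearMap.comp_apply, LinearMap.comp_apply,
      componentOf_sharp_fieldOp, ιMulti_eq_det_smul e w, LinearMap.id_apply,
      TensorProduct.tmul_smul, TensorProduct.tmul_smul]
  funext p
  rw [mapT1At, LinearMap.sum_apply]
  refine Eq.trans ?_ (LinearMap.congr_fun (key p) (ξ p))
  refine congrArg (componentOf p b) ((Finset.sum_eq_single p ?_ ?_).trans rfl)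
  · intro q _ hq
    exact absurd (Subsingleton.elim q p) hq
  · simp

end Cocycles

/-! ### Cocycles of the crossed product -/

section CrossedCocycles

variable {𝕜 : Type*} [Field 𝕜] [CharZero 𝕜] {V : Type*} [AddCommGroup V] [Module 𝕜 V]
  {G : Type*} [Group G] [Fintype G] [DistribMulAction G V] [SMulCommClass G 𝕜 V]

theorem coeffAt_single [DecidableEq G] (g h : G) (a : Poly 𝕜 V) :
    coeffAt 𝕜 V g (SkewMonoidAlgebra.single h a : Crossed 𝕜 V G) = if h = g then a else 0 := by
  simp [coeffAt, SkewMonoidAlgebra.coeff_single, Finsupp.single_apply]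

theorem single_eq_ofPoly_mul_U (g : G) (a : Poly 𝕜 V) :
    (SkewMonoidAlgebra.single g a : Crossed 𝕜 V G) = ofPoly 𝕜 V G a * U 𝕜 V g := by
  simp [U, ofPoly_apply, SkewMonoidAlgebra.single_mul_single]

theorem coeffAt_mul_ofPoly (g : G) (a : Poly 𝕜 V) (b : Crossed 𝕜 V G) :
    coeffAt 𝕜 V g (b * ofPoly 𝕜 V G a) = (g • a) * coeffAt 𝕜 V g b := by
  classical
  rw [crossed_eq_sum b, Finset.sum_mul, map_sum, map_sum, Finset.mul_sum]
  refine Finset.sum_congr rfl fun h _ => ?_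
  rw [ofPoly_apply, SkewMonoidAlgebra.single_mul_single, coeffAt_single, coeffAt_single, mul_one]
  split_ifs with hh
  · rw [hh, mul_comm]
  · simp

variable (𝕜 V G) in
/-- The crossed product as a bimodule over `Poly(V)`. -/
abbrev crossedBimod : Bimod 𝕜 (Poly 𝕜 V) (Crossed 𝕜 V G) :=
  (Bimod.self 𝕜 (Crossed 𝕜 V G)).restrict (ofPoly 𝕜 V G)

/-- Cochains with values in the crossed product are differentiated componentwise. -/
theorem d_coeffAt (g : G) {k : ℕ} (Φ : Cochain 𝕜 (Poly 𝕜 V) (Crossed 𝕜 V G) k) :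
    (twisted 𝕜 V g).d k ((coeffAt 𝕜 V g).compMultilinearMap Φ) =
      (coeffAt 𝕜 V g).compMultilinearMap ((crossedBimod 𝕜 V G).d k Φ) :=
  (crossedBimod 𝕜 V G).d_comp (coeffAt 𝕜 V g) (twisted 𝕜 V g)
    (fun a b => by simp [coeffAt_ofPoly_mul, twisted_l])
    (fun a b => by simp [coeffAt_mul_ofPoly, twisted_r]) Φ

theorem d_lsingle (g : G) {k : ℕ} (Ψ : Cochain 𝕜 (Poly 𝕜 V) (Poly 𝕜 V) k) :
    (crossedBimod 𝕜 V G).d k ((SkewMonoidAlgebra.lsingle 𝕜 g).compMultilinearMap Ψ) =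
      (SkewMonoidAlgebra.lsingle 𝕜 g).compMultilinearMap ((twisted 𝕜 V g).d k Ψ) :=
  (twisted 𝕜 V g).d_comp (SkewMonoidAlgebra.lsingle 𝕜 g) (crossedBimod 𝕜 V G)
    (fun a b => by
      simp [ofPoly_apply, twisted_l, SkewMonoidAlgebra.lsingle_apply,
        SkewMonoidAlgebra.single_mul_single])
    (fun a b => by
      simp [ofPoly_apply, twisted_r, SkewMonoidAlgebra.lsingle_apply,
        SkewMonoidAlgebra.single_mul_single, mul_comm]) Ψ

theorem d_conj (h : G) {k : ℕ} (Φ : Cochain 𝕜 (Poly 𝕜 V) (Crossed 𝕜 V G) k) :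
    (crossedBimod 𝕜 V G).d k (conj h k Φ) = conj h (k + 1) ((crossedBimod 𝕜 V G).d k Φ) := by
  have h1 : ∀ (k : ℕ) (Φ : Cochain 𝕜 (Poly 𝕜 V) (Crossed 𝕜 V G) k), conj h k Φ =
      Bimod.transport (MulSemiringAction.toAlgHom 𝕜 (Poly 𝕜 V) h)
        ((Bimod.self 𝕜 (Crossed 𝕜 V G)).conjU h) k Φ := by
    intro k Φ
    ext1 a
    simp [conj_apply, Bimod.conjU_apply]
  rw [h1, h1]
  exact (crossedBimod 𝕜 V G).d_transport _ _ _ ((Bimod.self 𝕜 (Crossed 𝕜 V G)).conjU_l h)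
    ((Bimod.self 𝕜 (Crossed 𝕜 V G)).conjU_r h) Φ

theorem average_coe {k : ℕ} (Φ : Cochain 𝕜 (Poly 𝕜 V) (Crossed 𝕜 V G) k) :
    (average k Φ).1 = (Fintype.card G : 𝕜)⁻¹ • ∑ h : G, conj h k Φ := by
  change ((Fintype.card G : 𝕜)⁻¹ • ∑ h : G, conj h k) Φ = _
  rw [LinearMap.smul_apply, LinearMap.sum_apply]

theorem d_average {k : ℕ} (Φ : Cochain 𝕜 (Poly 𝕜 V) (Crossed 𝕜 V G) k)
    (hΦ : (crossedBimod 𝕜 V G).d k Φ = 0) : (crossedBimod 𝕜 V G).d k (average k Φ).1 = 0 := by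
  rw [average_coe, map_smul, map_sum]
  simp only [d_conj, hΦ, map_zero, Finset.sum_const_zero, smul_zero]

section

variable (y : (g : G) → Module.Basis (Fin (codim 𝕜 V g)) 𝕜 (normalSpace 𝕜 V g)) {k : ℕ}
  (ξ : (g : G) → SectionsAt 𝕜 V g k)

theorem mapT1Raw_apply : mapT1Raw y k ξ =
    ∑ g, (SkewMonoidAlgebra.lsingle 𝕜 g).compMultilinearMap (mapT1At (y g) k (ξ g)) := by
  rw [mapT1Raw, LinearMap.sum_apply]
  rfl

theorem d_mapT1Raw : (crossedBimod 𝕜 V G).d k (mapT1Raw y k ξ) = 0 := by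
  rw [mapT1Raw_apply, map_sum]
  refine Finset.sum_eq_zero fun g _ => ?_
  rw [d_lsingle, d_mapT1At]
  ext1 a
  simp

theorem coeffAt_mapT1Raw (g : G) :
    (coeffAt 𝕜 V g).compMultilinearMap (mapT1Raw y k ξ) = mapT1At (y g) k (ξ g) := by
  classical
  ext1 a
  rw [mapT1Raw_apply, LinearMap.compMultilinearMap_apply, _root_.sum_apply, map_sum]
  simp only [LinearMap.compMultilinearMap_apply, SkewMonoidAlgebra.lsingle_apply, coeffAt_single]
  refine (Finset.sum_eq_single g ?_ ?_).trans ?_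
  · intro h _ hh
    rw [if_neg hh]
  · simp
  · rw [if_pos rfl]

theorem classAt_mapT1Raw {n : ℕ} (b : Module.Basis (Fin n) 𝕜 V) (g : G) :
    classAt b g k (mapT1Raw y k ξ) = ξ g := by
  rw [classAt_apply, coeffAt_mapT1Raw, mapL3At_tensorOf_mapT1At]

/-- As classes are equivariant, averaging does not change them if they form an invariant family. -/
theorem classAt_average {n : ℕ} (b : Module.Basis (Fin n) 𝕜 V)
    (Φ : Cochain 𝕜 (Poly 𝕜 V) (Crossed 𝕜 V G) k)
    (hΦ : (fun g => classAt b g k Φ) ∈ invariantSections 𝕜 V G k) (g : G) :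
    classAt b g k (average k Φ).1 = classAt b g k Φ := by
  have h1 : ∀ h : G, classAt b g k (conj h k Φ) = classAt b g k Φ := by
    intro h
    apply toMultivector_injective
    apply pushMultivector_injective h
    rw [← toMultivector_classAt]
    exact hΦ h g
  have : (Fintype.card G : 𝕜) ≠ 0 := by simp
  rw [average_coe, map_smul, map_sum]
  simp only [h1, Finset.sum_const, Finset.card_univ]
  rw [← Nat.cast_smul_eq_nsmul 𝕜, smul_smul, inv_mul_cancel₀ this, one_smul]

end

theorem cochain_ext_single {M : Type*} [AddCommGroup M] [Module 𝕜 M] {k : ℕ}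
    {F F' : Cochain 𝕜 (Crossed 𝕜 V G) M k}
    (h : ∀ (γ : Fin k → G) (a : Fin k → Poly 𝕜 V),
      F (fun j => SkewMonoidAlgebra.single (γ j) (a j)) =
        F' (fun j => SkewMonoidAlgebra.single (γ j) (a j))) : F = F' := by
  classical
  ext1 b
  have : b = fun j => ∑ g, SkewMonoidAlgebra.single g (coeffAt 𝕜 V g (b j)) :=
    funext fun j => crossed_eq_sum (b j)
  rw [this, MultilinearMap.map_sum, MultilinearMap.map_sum]
  exact Finset.sum_congr rfl fun γ _ => h γ _

theorem U_mul_apply {k : ℕ} (Φ : invariantCochains 𝕜 V G k) (h : G) (a : Fin k → Poly 𝕜 V) :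
    U 𝕜 V h * Φ.1 a = Φ.1 (fun j => h • a j) * U 𝕜 V h := by
  have h1 : conj h k Φ.1 = Φ.1 := Φ.2 h
  have h2 := congrArg (fun F => U 𝕜 V h * F a) h1
  simp only [conj_apply, ← mul_assoc, U_mul_U, mul_inv_cancel] at h2
  rw [← h2]
  simp [U]

/-- Up to the twist by `g_1 ⋯ g_{j-1}` of the `j`-th argument, multiplying neighbours in the crossed
product is multiplying neighbours in `Poly(V)`. -/
theorem contractNth_single {k : ℕ} (i : Fin k) (γ : Fin (k + 1) → G) (a : Fin (k + 1) → Poly 𝕜 V)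
    (j : Fin k) :
    Fin.contractNth i.castSucc (· * ·)
        (fun j => (SkewMonoidAlgebra.single (γ j) (a j) : Crossed 𝕜 V G)) j =
      SkewMonoidAlgebra.single (Fin.contractNth i.castSucc (· * ·) γ j)
        ((Fin.partialProd (Fin.contractNth i.castSucc (· * ·) γ) j.castSucc)⁻¹ •
          Fin.contractNth i.castSucc (· * ·)
            (fun j => Fin.partialProd γ j.castSucc • a j) j) := by
  rw [Fin.partialProd_contractNth, Function.comp_apply]
  rcases lt_trichotomy j i with h | h | h
  · rw [Fin.succAbove_of_castSucc_lt _ _ (by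
      rw [Fin.lt_def] at h ⊢; simp only [Fin.val_castSucc, Fin.val_succ]; omega)]
    have h1 : (j : ℕ) < i := h
    simp [Fin.contractNth, h1]
  · subst h
    rw [Fin.succAbove_of_castSucc_lt _ _ (by
      rw [Fin.lt_def]; simp only [Fin.val_castSucc, Fin.val_succ]; omega)]
    have h2 := Fin.partialProd_succ γ j.castSucc
    simp [Fin.contractNth, SkewMonoidAlgebra.single_mul_single, h2, mul_smul]
  · rw [Fin.succAbove_of_le_castSucc _ _ (by
      rw [Fin.lt_def] at h; rw [Fin.le_def]; simp only [Fin.val_castSucc, Fin.val_succ]; omega)]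
    have h1 : ¬ ((j : ℕ) < i) := by rw [Fin.lt_def] at h; omega
    have h2 : (j : ℕ) ≠ i := by rw [Fin.lt_def] at h; omega
    simp [Fin.contractNth, h1, h2]

theorem single_mul_mapT2 {k : ℕ} (Φ : invariantCochains 𝕜 V G k) (γ : Fin (k + 1) → G)
    (a : Fin (k + 1) → Poly 𝕜 V) :
    (SkewMonoidAlgebra.single (γ 0) (a 0) : Crossed 𝕜 V G) * mapT2 𝕜 V G k Φ
      (fun j => SkewMonoidAlgebra.single (Fin.tail γ j) (Fin.tail a j)) =
    ofPoly 𝕜 V G (a 0) * Φ.1 (Fin.tail fun j => Fin.partialProd γ j.castSucc • a j) *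
      U 𝕜 V (Fin.partialProd γ (Fin.last (k + 1))) := by
  rw [mapT2_single, single_eq_ofPoly_mul_U, mul_assoc, ← mul_assoc (U 𝕜 V (γ 0)), U_mul_apply,
    mul_assoc, U_mul_U, ← Fin.succ_last, Fin.partialProd_succ', mul_assoc]
  congr 3
  funext j
  rw [smul_smul]
  change _ = Fin.partialProd γ j.succ.castSucc • a j.succ
  rw [← Fin.succ_castSucc, Fin.partialProd_succ']
  rfl

theorem mapT2_mul_single {k : ℕ} (Φ : invariantCochains 𝕜 V G k) (γ : Fin (k + 1) → G)
    (a : Fin (k + 1) → Poly 𝕜 V) :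
    mapT2 𝕜 V G k Φ (fun j => SkewMonoidAlgebra.single (Fin.init γ j) (Fin.init a j)) *
      (SkewMonoidAlgebra.single (γ (Fin.last k)) (a (Fin.last k)) : Crossed 𝕜 V G) =
    Φ.1 (Fin.init fun j => Fin.partialProd γ j.castSucc • a j) *
      ofPoly 𝕜 V G (Fin.partialProd γ (Fin.last k).castSucc • a (Fin.last k)) *
      U 𝕜 V (Fin.partialProd γ (Fin.last (k + 1))) := by
  rw [mapT2_single, single_eq_ofPoly_mul_U, mul_assoc, ← mul_assoc (U 𝕜 V _),
    Bimod.U_mul_ofPoly, mul_assoc, U_mul_U, ← Fin.succ_last, Fin.partialProd_succ,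
    Fin.partialProd_init, mul_assoc]
  congr 2
  funext j
  rw [Fin.partialProd_init]
  rfl

theorem mapT2_contractNth {k : ℕ} (Φ : invariantCochains 𝕜 V G k) (i : Fin k)
    (γ : Fin (k + 1) → G) (a : Fin (k + 1) → Poly 𝕜 V) :
    mapT2 𝕜 V G k Φ (Fin.contractNth i.castSucc (· * ·)
        (fun j => (SkewMonoidAlgebra.single (γ j) (a j) : Crossed 𝕜 V G))) =
      Φ.1 (Fin.contractNth i.castSucc (· * ·) (fun j => Fin.partialProd γ j.castSucc • a j)) *
        U 𝕜 V (Fin.partialProd γ (Fin.last (k + 1))) := by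
  have h2 := funext (contractNth_single i γ a)
  have h3 : Fin.partialProd (Fin.contractNth i.castSucc (· * ·) γ) (Fin.last k) =
      Fin.partialProd γ (Fin.last (k + 1)) := by
    rw [Fin.partialProd_contractNth, Function.comp_apply, Fin.succAbove_of_le_castSucc,
      Fin.succ_last]
    rw [Fin.le_def]
    simp only [Fin.val_castSucc, Fin.val_succ, Fin.val_last]
    omega
  rw [h2, mapT2_single, h3]
  simp only [smul_inv_smul]

/-- The extension of an invariant cocycle to the crossed product is a cocycle: on elements
`a_j U_{g_j}` its coboundary is the coboundary over `Poly(V)` at the twisted arguments, times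
`U_{g_1 ⋯ g_{k+1}}`. -/
theorem hochschildD_mapT2 {k : ℕ} (Φ : invariantCochains 𝕜 V G k)
    (hΦ : (crossedBimod 𝕜 V G).d k Φ.1 = 0) : hochschildD 𝕜 k (mapT2 𝕜 V G k Φ) = 0 := by
  rw [← Bimod.d_self]
  refine cochain_ext_single fun γ a => ?_
  have h0 := congrArg (fun F => F (fun j => Fin.partialProd γ j.castSucc • a j) *
    U 𝕜 V (Fin.partialProd γ (Fin.last (k + 1)))) hΦ
  simp only [Bimod.d_apply, Bimod.restrict_l, Bimod.restrict_r, Bimod.self_l, Bimod.self_r,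
    add_mul, Finset.sum_mul, smul_mul_assoc, _root_.zero_apply, zero_mul,
    ← mapT2_contractNth, ← mapT2_mul_single] at h0
  have h1 := single_mul_mapT2 Φ γ a
  rw [Fin.castSucc_zero, Fin.partialProd_zero, one_smul, ← h1] at h0
  rw [Bimod.d_apply]
  exact h0

variable (y : (g : G) → Module.Basis (Fin (codim 𝕜 V g)) 𝕜 (normalSpace 𝕜 V g)) {k : ℕ}

theorem hochschildD_mapT (ξ : invariantSections 𝕜 V G k) : hochschildD 𝕜 k (mapT y k ξ) = 0 :=
  hochschildD_mapT2 _ (d_average _ (d_mapT1Raw y _))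

theorem mapL1_mapT2 (Φ : invariantCochains 𝕜 V G k) : mapL1 𝕜 V G k (mapT2 𝕜 V G k Φ) = Φ := by
  refine Subtype.ext ?_
  have h : MultilinearMap.compLinearMapₗ (fun _ => SkewMonoidAlgebra.lsingle 𝕜 (1 : G))
      (mapT2 𝕜 V G k Φ) = Φ.1 := by
    ext1 a
    have h1 := mapT2_single Φ a (fun _ => 1)
    have h2 : ∀ j, Fin.partialProd (fun _ : Fin k => (1 : G)) j = 1 := by
      intro j
      simp [Fin.partialProd]
    simp only [h2, one_smul] at h1
    refine h1.trans ?_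
    simp [U]
  rw [mapL1, LinearMap.comp_apply, h, average_of_mem Φ.2]

theorem mapL_mapT {n : ℕ} (b : Module.Basis (Fin n) 𝕜 V) (ξ : invariantSections 𝕜 V G k) :
    mapL b k (mapT y k ξ) = ξ.1 := by
  funext g
  have h : (fun g => classAt b g k (mapT1Raw y k ξ.1)) = ξ.1 :=
    funext fun g => classAt_mapT1Raw y ξ.1 b g
  rw [mapL_apply, mapT, LinearMap.comp_apply, mapL1_mapT2]
  refine (classAt_average b (mapT1Raw y k ξ.1) (by rw [h]; exact ξ.2) g).trans (congrFun h g)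

end CrossedCocycles

/-! ### The class map on Hochschild cochains -/

section ClassMap

universe u v w

variable {𝕜 : Type u} [Field 𝕜] [CharZero 𝕜] {V : Type v} [AddCommGroup V] [Module 𝕜 V]
  {G : Type w} [Group G] [Fintype G] [DistribMulAction G V] [SMulCommClass G 𝕜 V]
  {n : ℕ} (b : Module.Basis (Fin n) 𝕜 V)

theorem mapL1_coe {k : ℕ} (Ψ : Cochain 𝕜 (Crossed 𝕜 V G) (Crossed 𝕜 V G) k) :
    (mapL1 𝕜 V G k Ψ).1 = (Bimod.self 𝕜 (Crossed 𝕜 V G)).avgRes k Ψ := by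
  rw [mapL1, LinearMap.comp_apply, average_coe]
  ext1 a
  rw [Bimod.avgRes_apply, _root_.smul_apply, _root_.sum_apply]
  refine congrArg _ (Finset.sum_congr rfl fun h _ => ?_)
  rw [conj_apply, Bimod.conjU_apply]
  rfl

theorem mapL_mem (k : ℕ) (Ψ : Cochain 𝕜 (Crossed 𝕜 V G) (Crossed 𝕜 V G) k) :
    mapL b k Ψ ∈ invariantSections 𝕜 V G k := by
  intro h g
  have h1 : conj h k (mapL1 𝕜 V G k Ψ).1 = (mapL1 𝕜 V G k Ψ).1 := (mapL1 𝕜 V G k Ψ).2 h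
  rw [mapL_apply, mapL_apply, toMultivector_classAt, h1]

/-- `mapL` as a linear map into the invariant sections. -/
def mapLLin (k : ℕ) :
    Cochain 𝕜 (Crossed 𝕜 V G) (Crossed 𝕜 V G) k →ₗ[𝕜] invariantSections 𝕜 V G k where
  toFun Ψ := ⟨mapL b k Ψ, mapL_mem b k Ψ⟩
  map_add' Ψ Ψ' := by
    refine Subtype.ext (funext fun g => ?_)
    change mapL b k (Ψ + Ψ') g = mapL b k Ψ g + mapL b k Ψ' g
    rw [mapL_apply, mapL_apply, mapL_apply, map_add, Submodule.coe_add, map_add]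
  map_smul' c Ψ := by
    refine Subtype.ext (funext fun g => ?_)
    change mapL b k (c • Ψ) g = c • mapL b k Ψ g
    rw [mapL_apply, mapL_apply, map_smul, Submodule.coe_smul, map_smul]

/-- The component at `g` of the symbol of the averaged restriction to `Poly(V)`. -/
def symbolAt (g : G) (k : ℕ) : Cochain 𝕜 (Crossed 𝕜 V G) (Crossed 𝕜 V G) k →ₗ[𝕜]
    Module.Dual 𝕜 V [⋀^Fin k]→ₗ[𝕜] Poly 𝕜 V :=
  (twisted 𝕜 V g).symbol (Poly.lin 𝕜) k ∘ₗ (coeffAt 𝕜 V g).compMultilinearMapₗ 𝕜 ∘ₗ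
    (Bimod.self 𝕜 (Crossed 𝕜 V G)).avgRes k

theorem mapL_eq_symbolAt (g : G) {k : ℕ} (Ψ : Cochain 𝕜 (Crossed 𝕜 V G) (Crossed 𝕜 V G) k) :
    mapL b k Ψ g = mapL3At g k (tensorOf b k (symbolAt g k Ψ)) := by
  rw [mapL_apply, mapL1_coe, classAt_apply]
  rfl

theorem symbolAt_hochschildD (g : G) {k : ℕ}
    (Ψ : Cochain 𝕜 (Crossed 𝕜 V G) (Crossed 𝕜 V G) k) :
    symbolAt g (k + 1) (hochschildD 𝕜 k Ψ) =
      koszulD ((twisted 𝕜 V g).ad (Poly.lin 𝕜)) k (symbolAt g k Ψ) := by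
  rw [← Bimod.d_self, symbolAt, LinearMap.comp_apply, LinearMap.comp_apply, ← Bimod.d_avgRes,
    LinearMap.compMultilinearMapₗ_apply, ← d_coeffAt, Bimod.symbol_d]
  rfl

theorem coeffAt_avgSymbol (g : G) {k : ℕ}
    (Ψ : Cochain 𝕜 (Crossed 𝕜 V G) (Crossed 𝕜 V G) k) :
    (coeffAt 𝕜 V g).compAlternatingMap ((Bimod.self 𝕜 (Crossed 𝕜 V G)).avgSymbol k Ψ) =
      symbolAt g k Ψ :=
  ((crossedBimod 𝕜 V G).symbol_map (Poly.lin 𝕜) (twisted 𝕜 V g) (coeffAt 𝕜 V g)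
    (fun a m => by simp [coeffAt_ofPoly_mul, twisted_l]) _).symm

theorem mapL_hochschildD {k : ℕ} (Ψ : Cochain 𝕜 (Crossed 𝕜 V G) (Crossed 𝕜 V G) k) :
    mapL b (k + 1) (hochschildD 𝕜 k Ψ) = 0 := by
  funext g
  rw [mapL_eq_symbolAt, symbolAt_hochschildD]
  exact comap_tensorOf_eq_zero b _ fun v => comap_koszulD_twisted g _ v

/-- A cocycle of positive degree with trivial class is a coboundary. -/
theorem exists_hochschildD_of_mapL_eq_zero {k : ℕ}
    (Ψ : Cochain 𝕜 (Crossed 𝕜 V G) (Crossed 𝕜 V G) (k + 1))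
    (hΨ : hochschildD 𝕜 (k + 1) Ψ = 0) (h : mapL b (k + 1) Ψ = 0) :
    ∃ χ, Ψ = hochschildD 𝕜 k χ := by
  have : Module.Finite 𝕜 V := Module.Finite.of_basis b
  have h1 : ∀ g : G, ∃ θ, symbolAt g (k + 1) Ψ =
      koszulD ((twisted 𝕜 V g).ad (Poly.lin 𝕜)) k θ := by
    intro g
    refine exists_koszulD_twisted _ ?_ ?_
    · rw [← symbolAt_hochschildD, hΨ, map_zero]
    · refine comap_apply_splitForms_eq_zero b _ ?_
      rw [← mapL_eq_symbolAt, h]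
      rfl
  choose θ hθ using h1
  obtain ⟨χ, hχ⟩ := Bimod.exists_d_of_avgSymbol_eq b k (Bimod.self 𝕜 (Crossed 𝕜 V G)) Ψ
    (by rw [Bimod.d_self, hΨ])
    (∑ g, (SkewMonoidAlgebra.lsingle 𝕜 g).compAlternatingMap (θ g)) (by
      rw [map_sum]
      have h2 : ∀ g : G, koszulD (Bimod.self 𝕜 (Crossed 𝕜 V G)).adPoly k
          ((SkewMonoidAlgebra.lsingle 𝕜 g).compAlternatingMap (θ g)) =
          (SkewMonoidAlgebra.lsingle 𝕜 g).compAlternatingMap (symbolAt g (k + 1) Ψ) := by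
        intro g
        rw [hθ, koszulD_comp ((twisted 𝕜 V g).ad (Poly.lin 𝕜))]
        intro ℓ m
        rw [Bimod.ad_apply, Bimod.ad_apply, map_sub]
        simp [twisted_l, twisted_r, ofPoly_apply, SkewMonoidAlgebra.lsingle_apply,
          SkewMonoidAlgebra.single_mul_single, mul_comm]
      simp only [h2, ← coeffAt_avgSymbol]
      ext1 ℓ
      let ev : (Module.Dual 𝕜 V [⋀^Fin (k + 1)]→ₗ[𝕜] Crossed 𝕜 V G) →+ Crossed 𝕜 V G :=
        { toFun := fun ω => ω ℓ, map_zero' := rfl, map_add' := fun _ _ => rfl }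
      exact (crossed_eq_sum _).trans (map_sum ev (fun g =>
        (SkewMonoidAlgebra.lsingle 𝕜 g).compAlternatingMap ((coeffAt 𝕜 V g).compAlternatingMap
          ((Bimod.self 𝕜 (Crossed 𝕜 V G)).avgSymbol (k + 1) Ψ))) Finset.univ).symm)
  exact ⟨χ, by rw [hχ, Bimod.d_self]⟩

/-- A cocycle of degree zero with trivial class is zero. -/
theorem eq_zero_of_mapL_eq_zero (Ψ : Cochain 𝕜 (Crossed 𝕜 V G) (Crossed 𝕜 V G) 0)
    (hΨ : hochschildD 𝕜 0 Ψ = 0) (h : mapL b 0 Ψ = 0) : Ψ = 0 := by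
  have : Module.Finite 𝕜 V := Module.Finite.of_basis b
  have h1 : ∀ g : G, symbolAt g 0 Ψ = 0 := by
    intro g
    refine eq_zero_of_ad_twisted_eq_zero (g := g) _ ?_ ?_
    · rw [← symbolAt_hochschildD, hΨ, map_zero]
    · refine comap_apply_splitForms_eq_zero b _ ?_
      rw [← mapL_eq_symbolAt, h]
      rfl
  have h2 : ∀ c : Crossed 𝕜 V G, c * Ψ default = Ψ default * c := by
    intro c
    have h3 := congrArg (fun F => F fun _ => c) hΨ
    rw [← Bimod.d_self, Bimod.d_apply] at h3
    simp only [Finset.univ_eq_empty, Finset.sum_empty, add_zero, zero_add, pow_one,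
      neg_smul, one_smul, _root_.zero_apply, ← sub_eq_add_neg, sub_eq_zero] at h3
    refine Eq.trans ?_ (h3.trans ?_)
    · exact congrArg (fun a => c * Ψ a) (Subsingleton.elim _ _)
    · exact congrArg (fun a => Ψ a * c) (Subsingleton.elim _ _)
  have h4 := (Bimod.self 𝕜 (Crossed 𝕜 V G)).avgSymbol_zero_apply Ψ default
  rw [Bimod.average_const (Bimod.conjU_of_central _ _ h2)] at h4
  ext1 a
  rw [Subsingleton.elim a default, ← h4, crossed_eq_sum (Bimod.avgSymbol _ _ _ _)]
  refine Finset.sum_eq_zero fun g _ => ?_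
  have h5 := congrArg (fun F => F default) ((coeffAt_avgSymbol g Ψ).trans (h1 g))
  rw [LinearMap.compAlternatingMap_apply] at h5
  rw [h5]
  simp

theorem map_sub_of_leftInverse {R M N : Type*} [Ring R] [AddCommGroup M] [Module R M]
    [AddCommGroup N] [Module R N] (f : M →ₗ[R] N) (t : N →ₗ[R] M) (h : ∀ x, f (t x) = x) (m : M) :
    f (m - t (f m)) = 0 := by
  rw [map_sub, h, sub_self]

/-- `Ψ - T(L(Ψ))` is a cocycle with trivial class, if `Ψ` is a cocycle. -/
theorem cocycle_sub_mapT_mapLLin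
    (y : (g : G) → Module.Basis (Fin (codim 𝕜 V g)) 𝕜 (normalSpace 𝕜 V g)) {k : ℕ}
    (Ψ : Cochain 𝕜 (Crossed 𝕜 V G) (Crossed 𝕜 V G) k) (hΨ : hochschildD 𝕜 k Ψ = 0) :
    hochschildD 𝕜 k (Ψ - mapT y k (mapLLin b k Ψ)) = 0 ∧
      mapL b k (Ψ - mapT y k (mapLLin b k Ψ)) = 0 := by
  constructor
  · rw [map_sub, hΨ, hochschildD_mapT, sub_zero]
  · exact congrArg Subtype.val (map_sub_of_leftInverse (mapLLin b k) (mapT y k)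
      (fun ξ => Subtype.ext (mapL_mapT y b ξ)) Ψ)

theorem sectionComplex_d (k : ℕ) : (sectionComplex 𝕜 V G).d k (k + 1) = 0 :=
  CochainComplex.of_d (fun k => ModuleCat.of 𝕜 (invariantSections 𝕜 V G k)) (fun _ => 0) k

end ClassMap

theorem hochschildComplex_d {𝕜 : Type*} [CommRing 𝕜] {B : Type*} [Ring B] [Algebra 𝕜 B] (k : ℕ) :
    (hochschildComplex 𝕜 B).d k (k + 1) = ModuleCat.ofHom (hochschildD 𝕜 k) :=
  CochainComplex.of_d (fun k => ModuleCat.of 𝕜 (Cochain 𝕜 B B k))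
    (fun k => ModuleCat.ofHom (hochschildD 𝕜 k)) k

/-! ### Quasi-isomorphisms -/

section QuasiIso

universe u v

variable {R : Type u} [CommRing R] {K L : CochainComplex (ModuleCat.{v} R) ℕ}

theorem homologyMap_eq_zero (φ : K ⟶ K) (k : ℕ)
    (h : ∀ z : K.X k, (K.d k (k + 1)).hom z = 0 →
      ∃ i, ∃ y : K.X i, (φ.f k).hom z = (K.d i k).hom y) :
    HomologicalComplex.homologyMap φ k = 0 := by
  rw [← cancel_epi (K.homologyπ k), HomologicalComplex.homologyπ_naturality, Limits.comp_zero]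
  ext x
  obtain ⟨i, y, hy⟩ := h ((K.iCycles k).hom x) (by
    have := K.iCycles_d k (k + 1)
    exact congrArg (fun F => F.hom x) this)
  have h1 : (HomologicalComplex.cyclesMap φ k).hom x = (K.toCycles i k).hom y := by
    apply (ModuleCat.mono_iff_injective (K.iCycles k)).1 inferInstance
    have h2 := congrArg (fun F => F.hom x) (HomologicalComplex.cyclesMap_i φ k)
    have h3 := congrArg (fun F => F.hom y) (K.toCycles_i i k)
    exact h2.trans (hy.trans h3.symm)
  have h4 := congrArg (fun F => F.hom y) (K.toCycles_comp_homologyπ i k)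
  exact (congrArg (K.homologyπ k).hom h1).trans h4

/-- A chain map `T` with left inverse `L` is a quasi-isomorphism, if `z - T L z` is a coboundary for
every cocycle `z`. -/
theorem quasiIso_of_retraction (T : K ⟶ L) (P : L ⟶ K) (hTP : T ≫ P = 𝟙 K)
    (h : ∀ (k : ℕ) (z : L.X k), (L.d k (k + 1)).hom z = 0 →
      ∃ i, ∃ y : L.X i, z - (T.f k).hom ((P.f k).hom z) = (L.d i k).hom y) : QuasiIso T := by
  refine ⟨fun k => ?_⟩
  rw [quasiIsoAt_iff_isIso_homologyMap]
  refine ⟨HomologicalComplex.homologyMap P k, ?_, ?_⟩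
  · rw [← HomologicalComplex.homologyMap_comp, hTP, HomologicalComplex.homologyMap_id]
  · have h1 := homologyMap_eq_zero (𝟙 L - P ≫ T) k (fun z hz => h k z hz)
    rw [HomologicalComplex.homologyMap_sub, sub_eq_zero, HomologicalComplex.homologyMap_id,
      HomologicalComplex.homologyMap_comp] at h1
    exact h1.symm

end QuasiIso

section ChainMaps

universe u v w

variable {𝕜 : Type u} [Field 𝕜] [CharZero 𝕜] {V : Type v} [AddCommGroup V] [Module 𝕜 V]
  {G : Type w} [Group G] [Fintype G] [DistribMulAction G V] [SMulCommClass G 𝕜 V]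

/-- `mapT` as a chain map. -/
def chainT (y : (g : G) → Module.Basis (Fin (codim 𝕜 V g)) 𝕜 (normalSpace 𝕜 V g)) :
    sectionComplex 𝕜 V G ⟶ hochschildComplex 𝕜 (Crossed 𝕜 V G) :=
  CochainComplex.ofHom (X := sectionComplex 𝕜 V G) (Y := hochschildComplex 𝕜 (Crossed 𝕜 V G))
    (fun k => ModuleCat.ofHom (mapT y k)) (fun k => by
      rw [sectionComplex_d, hochschildComplex_d]
      refine ModuleCat.hom_ext (LinearMap.ext fun ξ => ?_)
      exact (hochschildD_mapT y ξ).trans (map_zero (mapT y (k + 1))).symm)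

/-- `mapL` as a chain map. -/
def chainL {n : ℕ} (b : Module.Basis (Fin n) 𝕜 V) :
    hochschildComplex 𝕜 (Crossed 𝕜 V G) ⟶ sectionComplex 𝕜 V G :=
  CochainComplex.ofHom (X := hochschildComplex 𝕜 (Crossed 𝕜 V G)) (Y := sectionComplex 𝕜 V G)
    (fun k => ModuleCat.ofHom (mapLLin b k)) (fun k => by
      rw [sectionComplex_d, hochschildComplex_d]
      refine ModuleCat.hom_ext (LinearMap.ext fun Ψ => ?_)
      exact (Subtype.ext (mapL_hochschildD b Ψ)).symm)

theorem chainT_comp_chainL {n : ℕ} (b : Module.Basis (Fin n) 𝕜 V)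
    (y : (g : G) → Module.Basis (Fin (codim 𝕜 V g)) 𝕜 (normalSpace 𝕜 V g)) :
    chainT y ≫ chainL b = 𝟙 (sectionComplex 𝕜 V G) := by
  refine HomologicalComplex.hom_ext _ _ fun k => ?_
  refine ModuleCat.hom_ext (LinearMap.ext fun ξ => ?_)
  exact Subtype.ext (mapL_mapT y b ξ)

theorem quasiIso_chainT {n : ℕ} (b : Module.Basis (Fin n) 𝕜 V)
    (y : (g : G) → Module.Basis (Fin (codim 𝕜 V g)) 𝕜 (normalSpace 𝕜 V g)) :
    QuasiIso (chainT y) := by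
  refine quasiIso_of_retraction (chainT y) (chainL b) (chainT_comp_chainL b y) fun k Ψ hΨ => ?_
  rw [hochschildComplex_d] at hΨ
  obtain ⟨h1, h2⟩ := cocycle_sub_mapT_mapLLin b y Ψ hΨ
  cases k with
  | zero =>
    refine ⟨0, 0, ?_⟩
    rw [map_zero]
    exact eq_zero_of_mapL_eq_zero b _ h1 h2
  | succ k =>
    obtain ⟨χ, hχ⟩ := exists_hochschildD_of_mapL_eq_zero b _ h1 h2
    refine ⟨k, χ, ?_⟩
    rw [hochschildComplex_d]
    exact hχ

end ChainMaps

end TwistedHH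

end


theorem mainTheorem3 {𝕜 : Type*} [Field 𝕜] [CharZero 𝕜]
    {V : Type*} [AddCommGroup V] [Module 𝕜 V]
    {G : Type*} [Group G] [Fintype G] [DistribMulAction G V] [SMulCommClass G 𝕜 V]
    {n : ℕ} (x : Module.Basis (Fin n) 𝕜 V)
    (y : (g : G) →
      Module.Basis (Fin (TwistedHH.codim 𝕜 V g)) 𝕜 (TwistedHH.normalSpace 𝕜 V g)) :
    ∃ (T : TwistedHH.sectionComplex 𝕜 V G ⟶
          TwistedHH.hochschildComplex 𝕜 (TwistedHH.Crossed 𝕜 V G))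
      (L : TwistedHH.hochschildComplex 𝕜 (TwistedHH.Crossed 𝕜 V G) ⟶
          TwistedHH.sectionComplex 𝕜 V G),
      (∀ (k : ℕ) (ξ : TwistedHH.invariantSections 𝕜 V G k),
        (T.f k).hom ξ = TwistedHH.mapT y k ξ) ∧
      (∀ (k : ℕ) (Ψ : TwistedHH.Cochain 𝕜 (TwistedHH.Crossed 𝕜 V G)
          (TwistedHH.Crossed 𝕜 V G) k),
        ((L.f k).hom Ψ : TwistedHH.invariantSections 𝕜 V G k).1 = TwistedHH.mapL x k Ψ) ∧
      T ≫ L = 𝟙 (TwistedHH.sectionComplex 𝕜 V G) ∧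
      QuasiIso T :=
  ⟨TwistedHH.chainT y, TwistedHH.chainL x, fun _ _ => rfl, fun _ _ => rfl,
    TwistedHH.chainT_comp_chainL x y, TwistedHH.quasiIso_chainT x y⟩
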